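/- Let $G=([n],E,w)$ be a finite simple graph with positive edge weights. Its EPR Hamiltonian on $n$ qubits is $$H_G=\sum_{uv\in E} w_{uv}\,h_{uv},\qquad h_{uv}=\tfrac12\left(I+X_uX_v-Y_uY_v+Z_uZ_v\right)=2|\phi_+\rangle\langle\phi_+|_{uv},\qquad |\phi_+\rangle=\tfrac1{\sqrt2}(|00\rangle+|11\rangle).$$ Let $\lambda_{\max}(H_G)$ be its largest eigenvalue, $W_G=\sum_{uv\in E}w_{uv}$, and $\mathrm{FM}_G$ the maximum of $\sum_{uv\in E} w_{uv}m_{uv}$ over all fractional matchings $m:E\to[0,1]$ (that is, $\sum_{v\in N(u)}m_{uv}\le 1$ for every vertex $u$). Let $\varphi=\frac{1+\sqrt5}2$, $\theta=\frac12\ln\varphi$ and $P=\frac1{\sqrt2}(X-Y)$. (1) For every such $G$ one has $\lambda_{\max}(H_G)\le W_G+\mathrm{FM}_G$. For every maximum-weight fractional matching $m$ of $G$, and every order of the factors, the unit vector $$|\chi\rangle=\prod_{uv\in E}e^{i\gamma_{uv}P_uP_v}\,|0\rangle^{\otimes n},\qquad \gamma_{uv}=\tfrac12\arccos\left(e^{-\theta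 m_{uv}}\right),$$ satisfies $$0\le\frac{\varphi}{2}\left(W_G+\mathrm{FM}_G\right)\le\langle\chi|H_G|\chi\rangle\le\lambda_{\max}(H_G),$$ and hence $\langle\chi|H_G|\chi\rangle\ge\frac{\varphi}{2}\lambda_{\max}(H_G)$, where $\frac{\varphi}{2}=\frac{1+\sqrt5}4\approx0.809$. (2) The circuit and the bounds are efficiently computable. There is a single random access machine program that, on input $(n,w)$, outputs the list of gates of such a circuit (one gate for each edge $uv$, described by $u$, $v$ and the value $m_{uv}$ for some maximum-weight fractional matching $m$, which determines $\gamma_{uv}$), together with the number $W_G+\mathrm{FM}_G$. For real weights it takes a number of steps polynomial in $n$, where arithmetic operations and comparisons of real numbers have unit cost. For rational weights its bit cost is polynomial in $n$ plus the binary length of the weight matrix. Consequently the EPR problem has an efficient algorithm with approximation ratio at least $\frac{\varphi}{2}$. -/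

import Mathlib

noncomputable section

namespace EPR

open Matrix

/-! ### Weighted graphs and fractional matchings -/

/-- A weighted graph on the vertex set `Fin n` with positive edge weights in `K`, stored as its
symmetric weight matrix: `u` and `v` are adjacent exactly when `0 < w u v`. -/
structure WGraph (n : ℕ) (K : Type) [Zero K] [LinearOrder K] where
  w : Fin n → Fin n → K
  symm : ∀ u v, w u v = w v u
  loopless : ∀ u, w u u = 0
  nonneg : ∀ u v, 0 ≤ w u v

/-- A graph with rational weights, seen as a graph with real weights. -/
def WGraph.toReal {n : ℕ} (G : WGraph n ℚ) : WGraph n ℝ where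
  w u v := (G.w u v : ℝ)
  symm u v := by rw [G.symm u v]
  loopless u := by rw [G.loopless u, Rat.cast_zero]
  nonneg u v := Rat.cast_nonneg.mpr (G.nonneg u v)

namespace WGraph

variable {n : ℕ} (G : WGraph n ℝ)

/-- The edge set; every undirected edge `{u, v}` is listed once, as the pair with `u < v`. -/
def edges : Finset (Fin n × Fin n) :=
  Finset.univ.filter fun e => e.1 < e.2 ∧ 0 < G.w e.1 e.2

/-- The total edge weight `W`. -/
def totalWeight : ℝ := ∑ e ∈ G.edges, G.w e.1 e.2

/-- `m` is a fractional matching: a function on the (undirected) edges with values in `[0, 1]`,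
extended by `0` to non-edges, whose sum over the edges at each vertex is at most `1`. -/
structure IsFracMatching (m : Fin n → Fin n → ℝ) : Prop where
  symm : ∀ u v, m u v = m v u
  nonneg : ∀ u v, 0 ≤ m u v
  le_one : ∀ u v, m u v ≤ 1
  supp : ∀ u v, ¬ 0 < G.w u v → m u v = 0
  sum_le_one : ∀ u, ∑ v, m u v ≤ 1

/-- The weight of a (fractional) matching. -/
def matchingWeight (m : Fin n → Fin n → ℝ) : ℝ := ∑ e ∈ G.edges, G.w e.1 e.2 * m e.1 e.2

/-- `m` is a fractional matching of maximum weight. -/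
def IsMaxFracMatching (m : Fin n → Fin n → ℝ) : Prop :=
  G.IsFracMatching m ∧ ∀ m', G.IsFracMatching m' → G.matchingWeight m' ≤ G.matchingWeight m

/-- `FM`, the maximum weight of a fractional matching. -/
def FM : ℝ := sSup (G.matchingWeight '' {m | G.IsFracMatching m})

end WGraph

/-! ### Qubits and the EPR Hamiltonian -/

/-- Labels of the computational basis of `n` qubits. -/
abbrev Basis (n : ℕ) : Type := Fin n → Fin 2

/-- Operators on `n` qubits. -/
abbrev Op (n : ℕ) : Type := Matrix (Basis n) (Basis n) ℂ

/-- The Pauli matrix `X`. -/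
def pauliX : Matrix (Fin 2) (Fin 2) ℂ := !![0, 1; 1, 0]

/-- The Pauli matrix `Y`. -/
def pauliY : Matrix (Fin 2) (Fin 2) ℂ := !![0, -Complex.I; Complex.I, 0]

/-- The Pauli matrix `Z`. -/
def pauliZ : Matrix (Fin 2) (Fin 2) ℂ := !![1, 0; 0, -1]

/-- The one-qubit operator `A` acting on qubit `i`, tensored with the identity elsewhere. -/
def onQubit {n : ℕ} (A : Matrix (Fin 2) (Fin 2) ℂ) (i : Fin n) : Op n :=
  Matrix.of fun x y => if ∀ k, k ≠ i → x k = y k then A (x i) (y i) else 0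

/-- The EPR local term `½ (I + XᵢXⱼ - YᵢYⱼ + ZᵢZⱼ)` (which is `2|φ₊⟩⟨φ₊|` on qubits `i ≠ j`). -/
def eprTerm {n : ℕ} (i j : Fin n) : Op n :=
  (1 / 2 : ℂ) • (1 + onQubit pauliX i * onQubit pauliX j - onQubit pauliY i * onQubit pauliY j
    + onQubit pauliZ i * onQubit pauliZ j)

/-- The EPR Hamiltonian of a weighted graph. -/
def hamiltonian {n : ℕ} (G : WGraph n ℝ) : Op n :=
  ∑ e ∈ G.edges, (G.w e.1 e.2 : ℂ) • eprTerm e.1 e.2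

/-- The largest eigenvalue of a Hermitian operator (whose spectrum is finite, real and
non-empty, so that the supremum is a maximum). -/
def lambdaMax {n : ℕ} (H : Op n) : ℝ := sSup (spectrum ℝ H)

/-- The energy `⟨ψ|H|ψ⟩`. -/
def energy {n : ℕ} (H : Op n) (ψ : Basis n → ℂ) : ℝ := (star ψ ⬝ᵥ (H *ᵥ ψ)).re

/-! ### The circuit -/

/-- The one-qubit operator `P = (X - Y) / √2`. -/
def opP : Matrix (Fin 2) (Fin 2) ℂ := ((1 / √2 : ℝ) : ℂ) • (pauliX - pauliY)

/-- The parameter `θ = ½ ln φ`, with `φ` the golden ratio. -/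
def theta : ℝ := Real.log Real.goldenRatio / 2

/-- The angle `γ = ½ arccos (exp (-θ x))` of an edge of matching value `x`. -/
def angle (x : ℝ) : ℝ := Real.arccos (Real.exp (-theta * x)) / 2

/-- The two-qubit gate `exp (i γ P_u P_v)`. -/
def gate {n : ℕ} (u v : Fin n) (γ : ℝ) : Op n :=
  NormedSpace.exp ((Complex.I * (γ : ℂ)) • (onQubit opP u * onQubit opP v))

/-- A circuit description over `K`: the entry `(u, v, x)` stands for the gate
`exp (i γ P_u P_v)` with `γ = ½ arccos (exp (-θ x))`. -/
abbrev Circuit (n : ℕ) (K : Type) : Type := List (Fin n × Fin n × K)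

/-- The state that a circuit prepares from `|0…0⟩`. -/
def Circuit.state {n : ℕ} (C : Circuit n ℝ) : Basis n → ℂ :=
  (C.map fun g => gate g.1 g.2.1 (angle g.2.2)).prod *ᵥ Pi.single (fun _ => 0) 1

/-- A circuit with rational parameters, seen as a circuit with real parameters. -/
def Circuit.toReal {n : ℕ} (C : Circuit n ℚ) : Circuit n ℝ :=
  C.map fun g => (g.1, g.2.1, (g.2.2 : ℝ))

/-- `C` is a circuit of the fractional matching algorithm on `G`: it has exactly one gate for each
edge `uv`, in any order, with angle given by `m u v` for some maximum-weight fractional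
matching `m`. -/
def IsMatchingCircuit {n : ℕ} (G : WGraph n ℝ) (C : Circuit n ℝ) : Prop :=
  ∃ m, G.IsMaxFracMatching m ∧
    ∃ l : List (Fin n × Fin n), l.Nodup ∧ (∀ e, e ∈ l ↔ e ∈ G.edges) ∧
      C = l.map fun e => (e.1, e.2, m e.1 e.2)

/-! ### Random access machines

A program is a structured imperative program that works on natural-number variables, arrays of
natural numbers, and arrays of numbers from an ordered field `K`. Variables and arrays have fixed
names (numerals in the program); arrays are addressed by two computed natural numbers. -/

/-- The memory of the machine. -/
structure Store (K : Type) where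
  /-- natural-number variables -/
  var : ℕ → ℕ
  /-- arrays of natural numbers: name, row, column -/
  arr : ℕ → ℕ → ℕ → ℕ
  /-- arrays of field elements: name, row, column -/
  mem : ℕ → ℕ → ℕ → K

/-- Expressions for natural numbers. -/
inductive NExp : Type
  | lit (c : ℕ)
  | var (x : ℕ)
  | arr (a : ℕ) (i j : NExp)
  | plus (e f : NExp)
  | minus (e f : NExp)
  | times (e f : NExp)

/-- Expressions for field elements. -/
inductive FExp : Type
  | lit (c : ℤ)
  | mem (a : ℕ) (i j : NExp)
  | plus (e f : FExp)
  | minus (e f : FExp)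
  | times (e f : FExp)
  | divide (e f : FExp)

/-- Tests. -/
inductive Test : Type
  | natLE (e f : NExp)
  | fieldLE (e f : FExp)
  | not (b : Test)
  | and (b c : Test)

/-- Programs. -/
inductive Program : Type
  | skip
  | setVar (x : ℕ) (e : NExp)
  | setArr (a : ℕ) (i j e : NExp)
  | setMem (a : ℕ) (i j : NExp) (e : FExp)
  | seq (p q : Program)
  | cond (b : Test) (p q : Program)
  | loop (b : Test) (p : Program)

section Semantics

variable {K : Type} [Field K] [LinearOrder K]

/-- Value of a natural-number expression (subtraction is truncated). -/
def NExp.eval (s : Store K) : NExp → ℕ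
  | .lit c => c
  | .var x => s.var x
  | .arr a i j => s.arr a (i.eval s) (j.eval s)
  | .plus e f => e.eval s + f.eval s
  | .minus e f => e.eval s - f.eval s
  | .times e f => e.eval s * f.eval s

/-- Value of a field expression. -/
def FExp.eval (s : Store K) : FExp → K
  | .lit c => (c : K)
  | .mem a i j => s.mem a (i.eval s) (j.eval s)
  | .plus e f => e.eval s + f.eval s
  | .minus e f => e.eval s - f.eval s
  | .times e f => e.eval s * f.eval s
  | .divide e f => e.eval s / f.eval s

/-- Truth of a test. -/
def Test.eval (s : Store K) : Test → Prop
  | .natLE e f => e.eval s ≤ f.eval s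
  | .fieldLE e f => e.eval s ≤ f.eval s
  | .not b => ¬ b.eval s
  | .and b c => b.eval s ∧ c.eval s

/-- Overwrite a variable. -/
def Store.setVar (s : Store K) (x v : ℕ) : Store K :=
  { s with var := Function.update s.var x v }

/-- Overwrite one cell of an array of natural numbers. -/
def Store.setArr (s : Store K) (a i j v : ℕ) : Store K :=
  { s with arr := fun a' i' j' => if a' = a ∧ i' = i ∧ j' = j then v else s.arr a' i' j' }

/-- Overwrite one cell of an array of field elements. -/
def Store.setMem (s : Store K) (a i j : ℕ) (v : K) : Store K :=
  { s with mem := fun a' i' j' => if a' = a ∧ i' = i ∧ j' = j then v else s.mem a' i' j' }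

/-- `Exec size p s t k`: started in `s`, the program `p` halts in `t` at cost `k`.
Each instruction and each evaluation of a test costs `1` (the expressions in a program are fixed,
so they account for constantly many operations); writing a natural number costs in addition its
binary length, and writing a field element `v` costs in addition `size v`.
With `size = 0` field operations have unit cost (the real RAM); with `size` the binary length of a
rational number, `k` is the logarithmic (bit) cost. -/
inductive Exec (size : K → ℕ) : Program → Store K → Store K → ℕ → Prop
  | skip (s) : Exec size .skip s s 1
  | setVar (x e s) :
      Exec size (.setVar x e) s (s.setVar x (e.eval s)) (1 + Nat.size (e.eval s))
  | setArr (a i j e s) :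
      Exec size (.setArr a i j e) s (s.setArr a (i.eval s) (j.eval s) (e.eval s))
        (1 + Nat.size (e.eval s))
  | setMem (a i j e s) :
      Exec size (.setMem a i j e) s (s.setMem a (i.eval s) (j.eval s) (e.eval s))
        (1 + size (e.eval s))
  | seq {p q s t u k l} : Exec size p s t k → Exec size q t u l →
      Exec size (.seq p q) s u (k + l)
  | cond_true {b p q s t k} : b.eval s → Exec size p s t k →
      Exec size (.cond b p q) s t (1 + k)
  | cond_false {b p q s t k} : ¬ b.eval s → Exec size q s t k →
      Exec size (.cond b p q) s t (1 + k)
  | loop_true {b p s t u k l} : b.eval s → Exec size p s t k → Exec size (.loop b p) t u l →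
      Exec size (.loop b p) s u (1 + k + l)
  | loop_false {b p s} : ¬ b.eval s → Exec size (.loop b p) s s 1

end Semantics

/-- Binary length of a rational number in lowest terms. -/
def bitSize (q : ℚ) : ℕ := Nat.size q.num.natAbs + Nat.size q.den

/-- Binary length of the weight matrix of a graph with `n` vertices and rational weights. -/
def WGraph.inputLength {n : ℕ} (G : WGraph n ℚ) : ℕ := n + ∑ u, ∑ v, bitSize (G.w u v)

/-- The initial memory on input `G`: the number of vertices is in variable `0`, the weight matrix
in field array `0`; everything else is `0`. -/
def WGraph.input {n : ℕ} {K : Type} [Zero K] [LinearOrder K] (G : WGraph n K) : Store K where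
  var x := if x = 0 then n else 0
  arr _ _ _ := 0
  mem a i j := if h : a = 0 ∧ i < n ∧ j < n then G.w ⟨i, h.2.1⟩ ⟨j, h.2.2⟩ else 0

/-- The final memory `t` describes the circuit `C` and the number `b`: the number of gates is in
variable `0`, the qubits of gate `k` are in columns `0` and `1` of row `k` of natural-number
array `0`, its parameter is in cell `(k, 0)` of field array `0`, and `b` is in cell `(0, 0)` of
field array `1`. -/
def Store.Outputs {n : ℕ} {K : Type} (t : Store K) (C : Circuit n K) (b : K) : Prop :=
  t.var 0 = C.length ∧
  (∀ k : Fin C.length, t.arr 0 k 0 = (C.get k).1 ∧ t.arr 0 k 1 = (C.get k).2.1 ∧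
    t.mem 0 k 0 = (C.get k).2.2) ∧
  t.mem 1 0 0 = b

end EPR

end

noncomputable section

namespace EPR

open Matrix

/-! ### One-qubit operators and the EPR term -/

/-! Upper bound. Two EPR terms that share one vertex satisfy `h * h = 2h` and `h * h' * h = h`. In a
unit state these relations bound the energy of `h h' + h' h` by the sum of the two energies.
Squaring the sum of the terms of a star with `d` edges then gives `E² ≤ (d + 1) E` for its total
energy `E`, so `E ≤ d + 1` (`sum_energy_le_card_add_one`). Applied to the edges whose energy exceeds
1, this says that the excesses `max (e_uv - 1) 0` form a fractional matching, so no energy exceeds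
`W + FM`.

Lower bound. All gates are diagonal in the joint eigenbasis of the operators `P`, which is indexed
by sign vectors `s`, and `|0…0⟩` is a uniform superposition of that basis. Hence the prepared state
has coefficients `exp (i Φ(s))` with `Φ` quadratic in `s`, whatever the order of the gates. An EPR
term only flips signs at its two ends, so its energy is an average over `s` that factors over the
other vertices into products of cosines (`energy_eprTerm_ising`). Since `cos 2γ = exp (-θ m)`, a
product of cosines around `u` is the exponential of a sum of matching values, and the constraint at
`u` bounds it below by `exp (-θ (1 - m_uv))`. What remains for each edge is an inequality in its own
matching value (`goldenRatio_mul_le`), with equality at 0 and 1, which gives energy at least `φ/2 (1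
+ m_uv)`. Summing with the weights yields `φ/2 (W + FM)`.

Algorithm. A permutation `p` of the vertices gives a fractional matching with value `½` for each of
`p v = u` and `p u = v`. Dual potentials `a`, `b` of the assignment problem average to the
fractional vertex cover `(a + b) / 2`, so an optimal assignment gives a maximum fractional matching
(`WGraph.permMatching_isMax`). The Hungarian method finds both. The program stores only values
obtained by adding, subtracting and halving, so binary lengths grow additively with the number of
steps, and a polynomial step count implies a polynomial bit cost (`Steps.exec`). -/

theorem onQubit_mulVec {n : ℕ} (A : Matrix (Fin 2) (Fin 2) ℂ) (i : Fin n) (ψ : Basis n → ℂ)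
    (x : Basis n) :
    (onQubit A i *ᵥ ψ) x = ∑ b, A (x i) b * ψ (Function.update x i b) := by
  symm
  simp only [mulVec, dotProduct, onQubit, of_apply]
  refine Finset.sum_of_injOn (fun b => Function.update x i b) ?_ ?_ ?_ ?_
  · exact fun a _ b _ h => Function.update_injective x i h
  · simp
  · intro y _ hy
    rw [if_neg, zero_mul]
    intro h
    refine hy ⟨y i, by simp, ?_⟩
    funext k
    by_cases hk : k = i
    · subst hk; simp
    · simp [hk, h k hk]
  · intro b _
    rw [if_pos]
    · simp
    · intro k hk; simp [hk]

theorem onQubit_mul_onQubit_mulVec {n : ℕ} (A B : Matrix (Fin 2) (Fin 2) ℂ) {i j : Fin n}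
    (h : i ≠ j) (ψ : Basis n → ℂ) (x : Basis n) :
    ((onQubit A i * onQubit B j) *ᵥ ψ) x =
      ∑ a, ∑ b, A (x i) a * B (x j) b * ψ (Function.update (Function.update x i a) j b) := by
  rw [← mulVec_mulVec, onQubit_mulVec]
  refine Finset.sum_congr rfl fun a _ => ?_
  rw [onQubit_mulVec, Finset.mul_sum]
  refine Finset.sum_congr rfl fun b _ => ?_
  rw [Function.update_of_ne h.symm, mul_assoc]

theorem ext_mulVec {n : ℕ} {A B : Op n} (h : ∀ ψ x, (A *ᵥ ψ) x = (B *ᵥ ψ) x) : A = B := by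
  ext x y
  simpa using h (Pi.single y 1) x

theorem onQubit_commute {n : ℕ} (A B : Matrix (Fin 2) (Fin 2) ℂ) {i j : Fin n} (h : i ≠ j) :
    onQubit A i * onQubit B j = onQubit B j * onQubit A i := by
  refine ext_mulVec fun ψ x => ?_
  rw [onQubit_mul_onQubit_mulVec A B h, onQubit_mul_onQubit_mulVec B A h.symm, Finset.sum_comm]
  refine Finset.sum_congr rfl fun a _ => Finset.sum_congr rfl fun b _ => ?_
  rw [Function.update_comm h, mul_comm (A _ _)]

theorem onQubit_conjTranspose {n : ℕ} (A : Matrix (Fin 2) (Fin 2) ℂ) (i : Fin n) :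
    (onQubit A i)ᴴ = onQubit Aᴴ i := by
  ext x y
  simp only [conjTranspose_apply, onQubit, of_apply]
  by_cases h : ∀ k, k ≠ i → x k = y k
  · rw [if_pos h, if_pos fun k hk => (h k hk).symm]
  · rw [if_neg h, if_neg fun h' => h fun k hk => (h' k hk).symm, star_zero]

theorem onQubit_mul_isHermitian {n : ℕ} {A : Matrix (Fin 2) (Fin 2) ℂ} (hA : Aᴴ = A)
    {i j : Fin n} (h : i ≠ j) : (onQubit A i * onQubit A j).IsHermitian := by
  rw [IsHermitian, conjTranspose_mul, onQubit_conjTranspose, onQubit_conjTranspose, hA,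
    onQubit_commute A A h]

theorem pauliX_conjTranspose : pauliXᴴ = pauliX := by
  ext i j; fin_cases i <;> fin_cases j <;> simp [pauliX]

theorem pauliY_conjTranspose : pauliYᴴ = pauliY := by
  ext i j; fin_cases i <;> fin_cases j <;> simp [pauliY]

theorem pauliZ_conjTranspose : pauliZᴴ = pauliZ := by
  ext i j; fin_cases i <;> fin_cases j <;> simp [pauliZ]

theorem eprTerm_isHermitian {n : ℕ} {i j : Fin n} (h : i ≠ j) :
    (eprTerm i j).IsHermitian := by
  have h1 := onQubit_mul_isHermitian pauliX_conjTranspose h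
  have h2 := onQubit_mul_isHermitian pauliY_conjTranspose h
  have h3 := onQubit_mul_isHermitian pauliZ_conjTranspose h
  have h4 := ((isHermitian_one.add h1).sub h2).add h3
  rw [IsHermitian, eprTerm, conjTranspose_smul, h4.eq]
  simp

theorem eprTerm_comm {n : ℕ} {i j : Fin n} (h : i ≠ j) : eprTerm i j = eprTerm j i := by
  simp only [eprTerm, onQubit_commute _ _ h]

/-- The EPR term projects the two qubits onto `|00⟩ + |11⟩`. -/
theorem eprTerm_mulVec {n : ℕ} {i j : Fin n} (h : i ≠ j) (ψ : Basis n → ℂ) (x : Basis n) :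
    (eprTerm i j *ᵥ ψ) x =
      if x i = x j then ∑ b, ψ (Function.update (Function.update x i b) j b) else 0 := by
  have h1 : ψ x = ψ (Function.update (Function.update x i (x i)) j (x j)) := by simp
  have key : (eprTerm i j *ᵥ ψ) x = (1 / 2 : ℂ) * (ψ x +
      ((onQubit pauliX i * onQubit pauliX j) *ᵥ ψ) x -
      ((onQubit pauliY i * onQubit pauliY j) *ᵥ ψ) x +
      ((onQubit pauliZ i * onQubit pauliZ j) *ᵥ ψ) x) := by
    rw [eprTerm, smul_mulVec, add_mulVec, sub_mulVec, add_mulVec, one_mulVec]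
    simp only [Pi.smul_apply, Pi.add_apply, Pi.sub_apply, smul_eq_mul]
  rw [key, onQubit_mul_onQubit_mulVec _ _ h, onQubit_mul_onQubit_mulVec _ _ h,
    onQubit_mul_onQubit_mulVec _ _ h, h1]
  generalize x i = a
  generalize x j = b
  fin_cases a <;> fin_cases b <;> simp [pauliX, pauliY, pauliZ] <;> ring

theorem eprTerm_mul_self {n : ℕ} {i j : Fin n} (h : i ≠ j) :
    eprTerm i j * eprTerm i j = (2 : ℂ) • eprTerm i j := by
  refine ext_mulVec fun ψ x => ?_
  rw [← mulVec_mulVec, smul_mulVec, Pi.smul_apply, eprTerm_mulVec h, eprTerm_mulVec h]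
  simp only [eprTerm_mulVec h, Function.update_self, Function.update_of_ne h.symm,
    Function.update_idem, Function.update_comm h, if_true]
  split_ifs <;> (simp [two_mul]; try ring)

/-- The middle factor forces the new common value of qubits `i` and `j` to be `x k`, and the inner
term forces the new value of `i` and `k` to be `x k` again. Both sums collapse, `k` is unchanged,
and only the sum of a single term is left. -/
theorem eprTerm_mul_mul {n : ℕ} {i j k : Fin n} (hij : i ≠ j) (hik : i ≠ k) (hjk : j ≠ k) :
    eprTerm i j * eprTerm i k * eprTerm i j = eprTerm i j := by
  refine ext_mulVec fun ψ x => ?_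
  rw [← mulVec_mulVec, ← mulVec_mulVec, eprTerm_mulVec hij, eprTerm_mulVec hij]
  split_ifs with h
  swap; · rfl
  have hk : ∀ c, Function.update (Function.update x i c) j c k = x k := fun c => by
    simp [Function.update_of_ne hik.symm, Function.update_of_ne hjk.symm]
  have e : ∀ b, (Function.update (Function.update (Function.update (Function.update
      (Function.update (Function.update x i (x k)) j (x k)) i (x k)) k (x k)) i b) j b) =
      (Function.update (Function.update x i b) j b) := by
    intro b
    funext l
    simp only [Function.update_apply]
    split_ifs <;> simp_all
  have hi : ∀ c, Function.update (Function.update x i c) j c i = c := fun c => by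
    simp [Function.update_of_ne hij]
  simp only [eprTerm_mulVec hij, eprTerm_mulVec hik, hk, hi]
  have hj : ∀ (y : Basis n) d, Function.update (Function.update y i d) k d j = y j := fun y d => by
    simp [Function.update_of_ne hij.symm, Function.update_of_ne hjk]
  have hi' : ∀ (y : Basis n) d, Function.update (Function.update y i d) k d i = d := fun y d => by
    simp [Function.update_of_ne hik]
  simp only [hj, hi', Function.update_self, Finset.sum_ite_eq', Finset.mem_univ, if_true, e]

/-! ### Energies and the largest eigenvalue -/

theorem energy_add {n : ℕ} (A B : Op n) (ψ : Basis n → ℂ) :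
    energy (A + B) ψ = energy A ψ + energy B ψ := by
  simp [energy, add_mulVec, dotProduct_add]

theorem energy_sub {n : ℕ} (A B : Op n) (ψ : Basis n → ℂ) :
    energy (A - B) ψ = energy A ψ - energy B ψ := by
  simp [energy, sub_mulVec, dotProduct_sub]

theorem energy_smul {n : ℕ} (r : ℝ) (A : Op n) (ψ : Basis n → ℂ) :
    energy ((r : ℂ) • A) ψ = r * energy A ψ := by
  simp [energy, smul_mulVec, dotProduct_smul]

theorem energy_sum {n : ℕ} {ι : Type*} (S : Finset ι) (A : ι → Op n) (ψ : Basis n → ℂ) :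
    energy (∑ i ∈ S, A i) ψ = ∑ i ∈ S, energy (A i) ψ := by
  classical
  induction S using Finset.induction_on with
  | empty => simp [energy]
  | insert a s ha ih => rw [Finset.sum_insert ha, Finset.sum_insert ha, energy_add, ih]

theorem energy_one {n : ℕ} {ψ : Basis n → ℂ} (hψ : star ψ ⬝ᵥ ψ = 1) : energy (1 : Op n) ψ = 1 := by
  simp [energy, hψ]

open scoped ComplexOrder in
theorem energy_nonneg {n : ℕ} {A : Op n} (hA : A.PosSemidef) (ψ : Basis n → ℂ) :
    0 ≤ energy A ψ := hA.re_dotProduct_nonneg ψ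

open scoped ComplexOrder in
theorem energy_conjTranspose_mul_self_nonneg {n : ℕ} (B : Op n) (ψ : Basis n → ℂ) :
    0 ≤ energy (Bᴴ * B) ψ := energy_nonneg (posSemidef_conjTranspose_mul_self B) ψ

/-- The variance of a Hermitian operator in a unit state is nonnegative. -/
theorem energy_sq_le {n : ℕ} {A : Op n} (hA : A.IsHermitian) {ψ : Basis n → ℂ}
    (hψ : star ψ ⬝ᵥ ψ = 1) : energy A ψ ^ 2 ≤ energy (A * A) ψ := by
  have h := energy_conjTranspose_mul_self_nonneg (A - ((energy A ψ : ℝ) : ℂ) • 1) ψ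
  have e : (A - ((energy A ψ : ℝ) : ℂ) • 1)ᴴ * (A - ((energy A ψ : ℝ) : ℂ) • 1) =
      A * A - ((2 * energy A ψ : ℝ) : ℂ) • A + ((energy A ψ ^ 2 : ℝ) : ℂ) • 1 := by
    rw [conjTranspose_sub, conjTranspose_smul, conjTranspose_one, hA.eq]
    simp only [Complex.star_def, Complex.conj_ofReal, Complex.ofReal_mul, Complex.ofReal_pow,
      Complex.ofReal_ofNat, sub_mul, mul_sub, smul_mul_assoc, mul_smul_comm, one_mul, mul_one]
    module
  rw [e, energy_add, energy_sub, energy_smul, energy_smul, energy_one hψ] at h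
  nlinarith

/-- Monogamy of entanglement on a star: operators that satisfy the Temperley–Lieb relations of a
star have total energy at most one more than their number. -/
theorem sum_energy_le_card_add_one {n : ℕ} {ι : Type*} (S : Finset ι) (h : ι → Op n)
    (hh : ∀ v ∈ S, (h v).IsHermitian) (h2 : ∀ v ∈ S, h v * h v = (2 : ℂ) • h v)
    (h3 : ∀ v ∈ S, ∀ w ∈ S, v ≠ w → h v * h w * h v = h v) {ψ : Basis n → ℂ}
    (hψ : star ψ ⬝ᵥ ψ = 1) : ∑ v ∈ S, energy (h v) ψ ≤ S.card + 1 := by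
  classical
  set E := ∑ v ∈ S, energy (h v) ψ with hE
  -- Off the diagonal this is `‖(h w * h v - h w) ψ‖² ≥ 0`, expanded with the two relations. On the
  -- diagonal `h v * h v + h v * h v = 4 h v`, which accounts for the extra `2 * energy (h v) ψ`.
  have pair : ∀ v ∈ S, ∀ w ∈ S, energy (h v * h w + h w * h v) ψ ≤
      energy (h v) ψ + energy (h w) ψ + if v = w then 2 * energy (h v) ψ else 0 := by
    intro v hv w hw
    by_cases hvw : v = w
    · subst hvw
      rw [h2 v hv, if_pos rfl, energy_add, show (2 : ℂ) = ((2 : ℝ) : ℂ) by norm_num, energy_smul]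
      linarith
    · have hn := energy_conjTranspose_mul_self_nonneg (h w * h v - h w) ψ
      have e : (h w * h v - h w)ᴴ * (h w * h v - h w) =
          ((2 : ℝ) : ℂ) • (h v + h w - (h v * h w + h w * h v)) := by
        rw [conjTranspose_sub, conjTranspose_mul, (hh v hv).eq, (hh w hw).eq]
        have e1 : h v * h w * (h w * h v) = (2 : ℂ) • h v := by
          rw [mul_assoc, ← mul_assoc (h w), h2 w hw, smul_mul_assoc, mul_smul_comm, ← mul_assoc,
            h3 v hv w hw hvw]
        have e2 : h v * h w * h w = (2 : ℂ) • (h v * h w) := by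
          rw [mul_assoc, h2 w hw, mul_smul_comm]
        have e3 : h w * (h w * h v) = (2 : ℂ) • (h w * h v) := by
          rw [← mul_assoc, h2 w hw, smul_mul_assoc]
        rw [sub_mul, mul_sub, mul_sub, e1, e2, e3, h2 w hw]
        push_cast
        module
      rw [e, energy_smul, energy_sub, energy_add] at hn
      rw [if_neg hvw]
      linarith
  have hA : (∑ v ∈ S, h v).IsHermitian := by
    rw [IsHermitian, conjTranspose_sum]
    exact Finset.sum_congr rfl fun v hv => (hh v hv).eq
  have hsq := energy_sq_le hA hψ
  have hAA : 2 * energy ((∑ v ∈ S, h v) * ∑ v ∈ S, h v) ψ =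
      ∑ v ∈ S, ∑ w ∈ S, energy (h v * h w + h w * h v) ψ := by
    simp only [energy_add, Finset.sum_add_distrib]
    rw [Finset.sum_comm (f := fun v w => energy (h w * h v) ψ), Finset.sum_mul_sum, energy_sum]
    simp only [energy_sum]
    ring
  have hle := Finset.sum_le_sum fun v hv => Finset.sum_le_sum fun w hw => pair v hv w hw
  rw [← hAA] at hle
  simp only [Finset.sum_add_distrib, Finset.sum_const, nsmul_eq_mul, Finset.sum_ite_eq,
    ← Finset.mul_sum, ← hE] at hle
  rw [Finset.sum_congr rfl fun v hv => if_pos hv, ← Finset.mul_sum, ← hE] at hle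
  rw [energy_sum, ← hE] at hsq
  have hc : (0 : ℝ) ≤ S.card := Nat.cast_nonneg _
  -- The estimates combine to `E² ≤ (card + 1) E`, which fails when `E > card + 1 > 0`.
  by_contra hlt
  push Not at hlt
  nlinarith

theorem sum_energy_eprTerm_le {n : ℕ} (u : Fin n) (S : Finset (Fin n)) (hu : u ∉ S)
    {ψ : Basis n → ℂ} (hψ : star ψ ⬝ᵥ ψ = 1) :
    ∑ v ∈ S, energy (eprTerm u v) ψ ≤ S.card + 1 := by
  have hne : ∀ v ∈ S, u ≠ v := fun v hv h => hu (h ▸ hv)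
  exact sum_energy_le_card_add_one S _ (fun v hv => eprTerm_isHermitian (hne v hv))
    (fun v hv => eprTerm_mul_self (hne v hv))
    (fun v hv w hw h => eprTerm_mul_mul (hne v hv) (hne w hw) h) hψ

theorem hamiltonian_isHermitian {n : ℕ} (G : WGraph n ℝ) : (hamiltonian G).IsHermitian := by
  rw [IsHermitian, hamiltonian, conjTranspose_sum]
  refine Finset.sum_congr rfl fun e he => ?_
  have h : e.1 ≠ e.2 := (Finset.mem_filter.mp he).2.1.ne
  rw [conjTranspose_smul, (eprTerm_isHermitian h).eq]
  simp

theorem energy_hamiltonian {n : ℕ} (G : WGraph n ℝ) (ψ : Basis n → ℂ) :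
    energy (hamiltonian G) ψ = ∑ e ∈ G.edges, G.w e.1 e.2 * energy (eprTerm e.1 e.2) ψ := by
  simp only [hamiltonian, energy_sum, energy_smul]

open scoped ComplexOrder in
theorem energy_le_lambdaMax {n : ℕ} {H : Op n} (hH : H.IsHermitian) {ψ : Basis n → ℂ}
    (hψ : star ψ ⬝ᵥ ψ = 1) : energy H ψ ≤ lambdaMax H := by
  have hB : (((lambdaMax H : ℝ) : ℂ) • (1 : Op n) - H).IsHermitian := by
    rw [IsHermitian, conjTranspose_sub, hH.eq, conjTranspose_smul, conjTranspose_one]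
    simp
  -- An eigenvalue `μ` of `λ - H` comes from the eigenvalue `λ - μ ≤ λ` of `H`. Hence `μ ≥ 0`, and
  -- `λ - H` is positive semidefinite.
  have key : ∀ μ ∈ spectrum ℝ (((lambdaMax H : ℝ) : ℂ) • (1 : Op n) - H),
      lambdaMax H - μ ∈ spectrum ℝ H := by
    intro μ hm
    rw [spectrum.mem_iff] at hm ⊢
    contrapose! hm
    rw [← IsUnit.neg_iff]
    convert hm using 1
    rw [map_sub, Algebra.algebraMap_eq_smul_one (lambdaMax H), Complex.coe_smul]
    abel
  have hP : (((lambdaMax H : ℝ) : ℂ) • (1 : Op n) - H).PosSemidef := by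
    rw [hB.posSemidef_iff_eigenvalues_nonneg]
    intro i
    have hm : hB.eigenvalues i ∈ spectrum ℝ (((lambdaMax H : ℝ) : ℂ) • (1 : Op n) - H) := by
      rw [hB.spectrum_real_eq_range_eigenvalues]; exact ⟨i, rfl⟩
    have hm' := key _ hm
    have hbd : BddAbove (spectrum ℝ H) := by
      rw [hH.spectrum_real_eq_range_eigenvalues]; exact (Set.finite_range _).bddAbove
    have := le_csSup hbd hm'
    rw [← lambdaMax] at this
    simpa using this
  have := energy_nonneg hP ψ
  rw [energy_sub, energy_smul, energy_one hψ] at this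
  linarith

theorem lambdaMax_le {n : ℕ} {H : Op n} (hH : H.IsHermitian) {c : ℝ}
    (h : ∀ ψ : Basis n → ℂ, star ψ ⬝ᵥ ψ = 1 → energy H ψ ≤ c) : lambdaMax H ≤ c := by
  refine csSup_le ?_ ?_ <;> rw [hH.spectrum_real_eq_range_eigenvalues]
  · exact Set.range_nonempty _
  · rintro _ ⟨i, rfl⟩
    have h1 : star (⇑(hH.eigenvectorBasis i)) ⬝ᵥ ⇑(hH.eigenvectorBasis i) = 1 := by
      have := (orthonormal_iff_ite.mp hH.eigenvectorBasis.orthonormal) i i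
      rw [if_pos rfl, EuclideanSpace.inner_eq_star_dotProduct] at this
      rw [← this, dotProduct_comm]
    have h2 := h _ h1
    rw [energy, hH.mulVec_eigenvectorBasis, dotProduct_smul, h1] at h2
    simpa using h2

/-! ### Fractional matchings -/

namespace WGraph

/-- Passes to sums over ordered pairs, where the constraints at the vertices and exchanges of
summation apply directly. -/
theorem sum_edges_eq {n : ℕ} (G : WGraph n ℝ) {F : Fin n → Fin n → ℝ}
    (hF : ∀ u v, F u v = F v u) (h0 : ∀ u v, ¬ 0 < G.w u v → F u v = 0) :
    ∑ e ∈ G.edges, F e.1 e.2 = (∑ u, ∑ v, F u v) / 2 := by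
  have h1 : ∑ e ∈ G.edges, F e.1 e.2 = ∑ u, ∑ v, if u < v then F u v else 0 := by
    rw [edges, Finset.sum_filter, ← Finset.univ_product_univ, Finset.sum_product]
    refine Finset.sum_congr rfl fun u _ => Finset.sum_congr rfl fun v _ => ?_
    by_cases huv : u < v
    · by_cases hw : 0 < G.w u v
      · simp [huv, hw]
      · simp [hw, h0 u v hw]
    · simp [huv]
  have h2 : ∑ u, ∑ v, F u v = (∑ u, ∑ v, if u < v then F u v else 0) +
      ∑ u, ∑ v, if v < u then F u v else 0 := by
    simp only [← Finset.sum_add_distrib]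
    refine Finset.sum_congr rfl fun u _ => Finset.sum_congr rfl fun v _ => ?_
    rcases lt_trichotomy u v with h | h | h
    · simp [h, h.not_gt]
    · subst h; simp [h0 u u (by simp [G.loopless])]
    · simp [h, h.not_gt]
  rw [h1, h2, Finset.sum_comm (f := fun u v => if v < u then F u v else 0)]
  simp only [hF _ _]
  ring

theorem matchingWeight_le_totalWeight {n : ℕ} (G : WGraph n ℝ) {m : Fin n → Fin n → ℝ}
    (hm : G.IsFracMatching m) : G.matchingWeight m ≤ G.totalWeight :=
  Finset.sum_le_sum fun _ _ => mul_le_of_le_one_right (G.nonneg _ _) (hm.le_one _ _)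

theorem bddAbove_matchingWeight {n : ℕ} (G : WGraph n ℝ) :
    BddAbove (G.matchingWeight '' {m | G.IsFracMatching m}) := by
  refine ⟨G.totalWeight, ?_⟩
  rintro _ ⟨m, hm, rfl⟩
  exact G.matchingWeight_le_totalWeight hm

theorem IsFracMatching.le_FM {n : ℕ} {G : WGraph n ℝ} {m : Fin n → Fin n → ℝ}
    (hm : G.IsFracMatching m) : G.matchingWeight m ≤ G.FM :=
  le_csSup G.bddAbove_matchingWeight ⟨m, hm, rfl⟩

theorem IsMaxFracMatching.eq_FM {n : ℕ} {G : WGraph n ℝ} {m : Fin n → Fin n → ℝ}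
    (hm : G.IsMaxFracMatching m) : G.FM = G.matchingWeight m := by
  refine le_antisymm (csSup_le ⟨_, m, hm.1, rfl⟩ ?_) hm.1.le_FM
  rintro _ ⟨m', hm', rfl⟩
  exact hm.2 m' hm'

end WGraph

/-- The state itself supplies a fractional matching: the amount by which each edge energy exceeds 1.
-/
theorem energy_hamiltonian_le {n : ℕ} (G : WGraph n ℝ) {ψ : Basis n → ℂ}
    (hψ : star ψ ⬝ᵥ ψ = 1) : energy (hamiltonian G) ψ ≤ G.totalWeight + G.FM := by
  set m : Fin n → Fin n → ℝ := fun u v =>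
    if 0 < G.w u v then max (energy (eprTerm u v) ψ - 1) 0 else 0 with hm
  have hloop : ∀ u v, 0 < G.w u v → u ≠ v := by
    rintro u v h rfl
    rw [G.loopless] at h
    exact lt_irrefl _ h
  have hnonneg : ∀ u v, 0 ≤ m u v := by
    intro u v
    simp only [hm]
    split_ifs
    · exact le_max_right _ _
    · exact le_rfl
  have hsum : ∀ u, ∑ v, m u v ≤ 1 := by
    intro u
    -- Only neighbours with energy above 1 count. On them the star bound `card + 1` leaves a total
    -- excess of at most 1.
    set S := Finset.univ.filter fun v => 0 < G.w u v ∧ 0 < energy (eprTerm u v) ψ - 1 with hS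
    have hu : u ∉ S := by simp [hS, G.loopless]
    have h1 := sum_energy_eprTerm_le u S hu hψ
    have h2 : ∑ v, m u v = ∑ v ∈ S, (energy (eprTerm u v) ψ - 1) := by
      rw [hS, Finset.sum_filter]
      refine Finset.sum_congr rfl fun v _ => ?_
      simp only [hm]
      by_cases ha : 0 < G.w u v
      · by_cases hb : 0 < energy (eprTerm u v) ψ - 1
        · simp only [ha, hb, and_self, if_true]; exact max_eq_left hb.le
        · simp only [ha, hb, and_false, if_true, if_false]; exact max_eq_right (not_lt.mp hb)
      · simp [ha]
    rw [h2, Finset.sum_sub_distrib]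
    simp only [Finset.sum_const, nsmul_eq_mul, mul_one]
    linarith
  have hfrac : G.IsFracMatching m := by
    refine ⟨?_, hnonneg, ?_, ?_, hsum⟩
    · intro u v
      simp only [hm, G.symm v u]
      split_ifs with h
      · rw [eprTerm_comm (hloop u v h)]
      · rfl
    · exact fun u v => (Finset.single_le_sum (fun v _ => hnonneg u v) (Finset.mem_univ v)).trans
        (hsum u)
    · intro u v h
      simp [hm, h]
  refine le_trans ?_ (add_le_add_right hfrac.le_FM _)
  rw [energy_hamiltonian, WGraph.totalWeight, WGraph.matchingWeight, ← Finset.sum_add_distrib]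
  refine Finset.sum_le_sum fun e he => ?_
  have hw : 0 < G.w e.1 e.2 := (Finset.mem_filter.mp he).2.2
  have : energy (eprTerm e.1 e.2) ψ ≤ 1 + m e.1 e.2 := by
    simp only [hm, hw, if_true]
    linarith [le_max_left (energy (eprTerm e.1 e.2) ψ - 1) 0]
  nlinarith

theorem lambdaMax_hamiltonian_le {n : ℕ} (G : WGraph n ℝ) :
    lambdaMax (hamiltonian G) ≤ G.totalWeight + G.FM :=
  lambdaMax_le (hamiltonian_isHermitian G) fun _ hψ => energy_hamiltonian_le G hψ

/-! ### The eigenbasis of the operators `P` -/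

/-- The phase `exp (-iπ/4)`. -/
def phase : ℂ := (1 - Complex.I) / ((√2 : ℝ) : ℂ)

theorem sqrt_two_sq : ((√2 : ℝ) : ℂ) ^ 2 = 2 := by
  rw [← Complex.ofReal_pow, Real.sq_sqrt (by norm_num)]; norm_num

theorem sqrt_two_ne_zero : ((√2 : ℝ) : ℂ) ≠ 0 := by simp

theorem phase_sq : phase ^ 2 = -Complex.I := by
  rw [phase, div_pow, sqrt_two_sq]
  ring_nf
  rw [Complex.I_sq]; ring

theorem star_phase_mul_phase : star phase * phase = 1 := by
  rw [phase, star_div₀, div_mul_div_comm]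
  simp only [Complex.star_def, map_sub, map_one, Complex.conj_I, Complex.conj_ofReal]
  rw [← sq, sqrt_two_sq]
  ring_nf
  rw [Complex.I_sq]; ring

/-- Component of the (unnormalized) eigenvector of `P` with eigenvalue `t`. -/
def signComp (t : ℤˣ) (b : Fin 2) : ℂ := if b = 0 then 1 else ((t : ℤ) : ℂ) * phase

/-- The product of one-qubit eigenvectors of `P` with eigenvalues `s`. -/
def signVec {n : ℕ} (s : Fin n → ℤˣ) : Basis n → ℂ := fun x => ∏ k, signComp (s k) (x k)

theorem unit_sq (t : ℤˣ) : ((t : ℤ) : ℂ) ^ 2 = 1 := by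
  rcases Int.units_eq_one_or t with rfl | rfl <;> simp

theorem signVec_update {n : ℕ} (s : Fin n → ℤˣ) (x : Basis n) (i : Fin n) (b : Fin 2) :
    signVec s (Function.update x i b) =
      signComp (s i) b * ∏ k ∈ Finset.univ.erase i, signComp (s k) (x k) := by
  rw [signVec, ← Finset.mul_prod_erase _ _ (Finset.mem_univ i), Function.update_self]
  congr 1
  refine Finset.prod_congr rfl fun k hk => ?_
  rw [Function.update_of_ne (Finset.ne_of_mem_erase hk)]

theorem signVec_eq {n : ℕ} (s : Fin n → ℤˣ) (x : Basis n) (i : Fin n) :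
    signVec s x = signComp (s i) (x i) * ∏ k ∈ Finset.univ.erase i, signComp (s k) (x k) := by
  rw [← signVec_update, Function.update_eq_self]

theorem onQubit_opP_signVec {n : ℕ} (s : Fin n → ℤˣ) (i : Fin n) :
    onQubit opP i *ᵥ signVec s = ((s i : ℤ) : ℂ) • signVec s := by
  funext x
  rw [onQubit_mulVec, Pi.smul_apply, smul_eq_mul, signVec_eq s x i]
  simp only [signVec_update]
  generalize ∏ k ∈ Finset.univ.erase i, signComp (s k) (x k) = R
  generalize hb : x i = b
  have h2 := sqrt_two_ne_zero
  have hs := unit_sq (s i)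
  fin_cases b
  · simp only [opP, pauliX, pauliY, signComp, phase, Fin.sum_univ_two]
    simp
    field_simp
    ring_nf
    rw [Complex.I_sq, sqrt_two_sq]
    ring
  · simp only [opP, pauliX, pauliY, signComp, phase, Fin.sum_univ_two]
    simp
    field_simp
    rw [hs]; ring

/-- The continuous linear map `A ↦ A *ᵥ e` is applied termwise to the exponential series; the norm
put on matrices only serves the convergence. -/
theorem exp_mulVec_of_eigen {n : ℕ} {M : Op n} {e : Basis n → ℂ} {μ : ℂ} (h : M *ᵥ e = μ • e) :
    NormedSpace.exp M *ᵥ e = Complex.exp μ • e := by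
  have hpow : ∀ k : ℕ, (M ^ k) *ᵥ e = μ ^ k • e := by
    intro k
    induction k with
    | zero => simp
    | succ k ih => rw [pow_succ', ← mulVec_mulVec, ih, mulVec_smul, h, smul_smul, pow_succ]
  let _ : NormedRing (Op n) := Matrix.linftyOpNormedRing
  let _ : NormedAlgebra ℂ (Op n) := Matrix.linftyOpNormedAlgebra
  have h1 := NormedSpace.exp_series_hasSum_exp' (𝕂 := ℂ) M
  have h2 := NormedSpace.exp_series_hasSum_exp' (𝕂 := ℂ) μ
  let L : Op n →ₗ[ℂ] (Basis n → ℂ) :=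
    { toFun := fun A => A *ᵥ e
      map_add' := fun A B => add_mulVec A B e
      map_smul' := fun c A => smul_mulVec c A e }
  have h3 := h1.mapL (LinearMap.toContinuousLinearMap L)
  have h4 : HasSum (fun k : ℕ => ((Nat.factorial k : ℂ)⁻¹ • μ ^ k) • e) (NormedSpace.exp μ • e) :=
    h2.smul_const e
  rw [← Complex.exp_eq_exp_ℂ] at h4
  have h5 : (fun k : ℕ => (LinearMap.toContinuousLinearMap L) (((Nat.factorial k : ℂ)⁻¹) • M ^ k)) =
      fun k : ℕ => ((Nat.factorial k : ℂ)⁻¹ • μ ^ k) • e := by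
    funext k
    change (((Nat.factorial k : ℂ)⁻¹) • M ^ k) *ᵥ e = _
    rw [smul_mulVec, hpow, smul_smul, smul_eq_mul]
  rw [h5] at h3
  exact HasSum.unique h3 h4

theorem gate_mulVec_signVec {n : ℕ} (u v : Fin n) (γ : ℝ) (s : Fin n → ℤˣ) :
    gate u v γ *ᵥ signVec s =
      Complex.exp (Complex.I * γ * ((s u : ℤ) * (s v : ℤ))) • signVec s := by
  apply exp_mulVec_of_eigen
  rw [smul_mulVec, ← mulVec_mulVec, onQubit_opP_signVec, mulVec_smul, onQubit_opP_signVec,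
    smul_smul, smul_smul]
  congr 1
  ring

/-- The vector with coefficients `f` in the eigenbasis of the operators `P`. -/
def ofSign {n : ℕ} (f : (Fin n → ℤˣ) → ℂ) : Basis n → ℂ := (1 / 2 ^ n : ℂ) • ∑ s, f s • signVec s

/-- The sum over all sign vectors factors over the qubits, and at each qubit the two eigenvectors
add up to `2|0⟩`. -/
theorem ofSign_one {n : ℕ} : ofSign (fun _ : Fin n → ℤˣ => 1) = Pi.single (fun _ => 0) 1 := by
  funext x
  have h : ∑ s : Fin n → ℤˣ, signVec s x = ∏ k, ∑ t : ℤˣ, signComp t (x k) := by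
    rw [Finset.prod_univ_sum, Fintype.piFinset_univ]; rfl
  have h' : ∀ b : Fin 2, ∑ t : ℤˣ, signComp t b = if b = 0 then 2 else 0 := by
    intro b
    rw [UnitsInt.univ, Finset.sum_pair (by decide)]
    fin_cases b <;> simp [signComp]; norm_num
  simp only [ofSign, one_smul, Pi.smul_apply, Finset.sum_apply, h, h', smul_eq_mul]
  by_cases hx : x = fun _ => 0
  · subst hx
    simp
  · rw [Pi.single_eq_of_ne hx]
    obtain ⟨k, hk⟩ := Function.ne_iff.mp hx
    rw [Finset.prod_eq_zero (Finset.mem_univ k) (by simpa using hk), mul_zero]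

/-- The amplitudes of the state that a circuit prepares, in the eigenbasis of the `P`s. -/
def Circuit.amplitude {n : ℕ} (C : Circuit n ℝ) (s : Fin n → ℤˣ) : ℂ :=
  (C.map fun g => Complex.exp (Complex.I * angle g.2.2 * ((s g.1 : ℤ) * (s g.2.1 : ℤ)))).prod

theorem Circuit.state_eq {n : ℕ} (C : Circuit n ℝ) : C.state = ofSign C.amplitude := by
  induction C with
  | nil =>
    rw [Circuit.state]
    simp only [List.map_nil, List.prod_nil, one_mulVec]
    rw [← ofSign_one]; rfl
  | cons g C ih =>
    rw [Circuit.state, List.map_cons, List.prod_cons, ← mulVec_mulVec, ← Circuit.state, ih,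
      ofSign, mulVec_smul, mulVec_sum, ofSign]
    congr 1
    refine Finset.sum_congr rfl fun s _ => ?_
    rw [mulVec_smul, gate_mulVec_signVec, smul_smul, Circuit.amplitude, Circuit.amplitude,
      List.map_cons, List.prod_cons, mul_comm]

/-- The inner product factors over the qubits. As `phase` has modulus 1, the factor at a qubit with
signs `a`, `b` is `1 + ab`. -/
theorem star_signVec_dotProduct {n : ℕ} (s t : Fin n → ℤˣ) :
    star (signVec s) ⬝ᵥ signVec t = if s = t then 2 ^ n else 0 := by
  have h : star (signVec s) ⬝ᵥ signVec t =
      ∏ k, ∑ b, star (signComp (s k) b) * signComp (t k) b := by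
    rw [Finset.prod_univ_sum, Fintype.piFinset_univ]
    simp only [dotProduct, Pi.star_apply, signVec, star_prod, Finset.prod_mul_distrib]
  have h' : ∀ a b : ℤˣ, ∑ c, star (signComp a c) * signComp b c = if a = b then 2 else 0 := by
    intro a b
    have e : ∑ c, star (signComp a c) * signComp b c = 1 + ((a : ℤ) : ℂ) * ((b : ℤ) : ℂ) := by
      have := star_phase_mul_phase
      simp only [Complex.star_def] at this
      simp only [signComp, Fin.sum_univ_two]
      simp
      linear_combination ((a : ℤ) : ℂ) * ((b : ℤ) : ℂ) * this
    rw [e]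
    rcases Int.units_eq_one_or a with rfl | rfl <;> rcases Int.units_eq_one_or b with rfl | rfl <;>
      simp <;> norm_num
  rw [h]
  simp only [h']
  split_ifs with hst
  · subst hst; simp
  · obtain ⟨k, hk⟩ := Function.ne_iff.mp hst
    exact Finset.prod_eq_zero (Finset.mem_univ k) (by simpa using hk)

theorem star_ofSign_dotProduct {n : ℕ} (f g : (Fin n → ℤˣ) → ℂ) :
    star (ofSign f) ⬝ᵥ ofSign g = (1 / 2 ^ n : ℂ) * ∑ s, star (f s) * g s := by
  have h2 : (2 : ℂ) ^ n ≠ 0 := pow_ne_zero _ two_ne_zero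
  have e : star (∑ s, f s • signVec s) ⬝ᵥ ∑ s, g s • signVec s =
      2 ^ n * ∑ s, star (f s) * g s := by
    rw [star_sum, sum_dotProduct, Finset.mul_sum]
    refine Finset.sum_congr rfl fun s _ => ?_
    rw [dotProduct_sum, Finset.sum_eq_single s]
    · rw [star_smul, smul_dotProduct, dotProduct_smul, star_signVec_dotProduct, if_pos rfl,
        smul_eq_mul, smul_eq_mul]
      ring
    · intro t _ ht
      rw [star_smul, smul_dotProduct, dotProduct_smul, star_signVec_dotProduct, if_neg ht.symm]
      simp
    · simp
  rw [ofSign, ofSign, star_smul, smul_dotProduct, dotProduct_smul, e, smul_eq_mul, smul_eq_mul]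
  simp only [star_div₀, star_one, star_pow, Complex.star_def, Complex.conj_ofNat]
  field_simp

/-- Flip the sign at one vertex. -/
def flip {n : ℕ} (u : Fin n) (s : Fin n → ℤˣ) : Fin n → ℤˣ := Function.update s u (-s u)

theorem flip_self {n : ℕ} (u : Fin n) (s : Fin n → ℤˣ) : flip u s u = -s u := by simp [flip]

theorem flip_of_ne {n : ℕ} {u k : Fin n} (h : k ≠ u) (s : Fin n → ℤˣ) : flip u s k = s k := by
  simp [flip, h]

theorem flip_involutive {n : ℕ} (u : Fin n) : Function.Involutive (flip u) := by
  intro s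
  funext k
  by_cases hk : k = u
  · subst hk; simp [flip]
  · simp [flip, hk]

theorem sum_flip {n : ℕ} {M : Type*} [AddCommMonoid M] (u : Fin n) (F : (Fin n → ℤˣ) → M) :
    ∑ s, F (flip u s) = ∑ s, F s :=
  Equiv.sum_comp (flip_involutive u).toPerm F

theorem signVec_eq_two {n : ℕ} (s : Fin n → ℤˣ) (x : Basis n) {i j : Fin n} (h : i ≠ j) :
    signVec s x = signComp (s i) (x i) * signComp (s j) (x j) *
      ∏ k ∈ (Finset.univ.erase i).erase j, signComp (s k) (x k) := by
  rw [signVec_eq s x i, ← Finset.mul_prod_erase (Finset.univ.erase i) _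
    (Finset.mem_erase.mpr ⟨h.symm, Finset.mem_univ j⟩), mul_assoc]

/-- All vectors involved share the factor over the qubits other than `i` and `j`. What remains is a
finite check on two signs and two bits, using `phase² = -i`. -/
theorem eprTerm_mulVec_signVec {n : ℕ} {i j : Fin n} (h : i ≠ j) (s : Fin n → ℤˣ) :
    eprTerm i j *ᵥ signVec s = (1 / 2 : ℂ) • (signVec s + signVec (flip i (flip j s)) -
      (Complex.I * ((s i : ℤ) * (s j : ℤ))) • (signVec (flip i s) + signVec (flip j s))) := by
  funext x
  have key : ∀ (t : Fin n → ℤˣ) (y : Basis n), (∀ k, k ≠ i → k ≠ j → t k = s k) →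
      (∀ k, k ≠ i → k ≠ j → y k = x k) → signVec t y =
      signComp (t i) (y i) * signComp (t j) (y j) *
      ∏ k ∈ (Finset.univ.erase i).erase j, signComp (s k) (x k) := by
    intro t y ht hy
    rw [signVec_eq_two t y h]
    congr 1
    refine Finset.prod_congr rfl fun k hk => ?_
    simp only [Finset.mem_erase] at hk
    rw [ht k hk.2.1 hk.1, hy k hk.2.1 hk.1]
  rw [eprTerm_mulVec h]
  simp only [Pi.smul_apply, Pi.add_apply, Pi.sub_apply, smul_eq_mul]
  have hu : ∀ b, signVec s (Function.update (Function.update x i b) j b) = _ := fun b =>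
    key s _ (fun _ _ _ => rfl) fun k hi hj => by simp [hi, hj]
  simp only [hu]
  rw [key s x (fun _ _ _ => rfl) (fun _ _ _ => rfl),
    key (flip i (flip j s)) x (fun k hi hj => by rw [flip_of_ne hi, flip_of_ne hj])
      (fun _ _ _ => rfl),
    key (flip i s) x (fun k hi hj => by rw [flip_of_ne hi]) (fun _ _ _ => rfl),
    key (flip j s) x (fun k hi hj => by rw [flip_of_ne hj]) (fun _ _ _ => rfl)]
  generalize ∏ k ∈ (Finset.univ.erase i).erase j, signComp (s k) (x k) = R
  simp only [Function.update_self, Function.update_of_ne h, flip_self, flip_of_ne h,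
    flip_of_ne h.symm]
  generalize x i = a
  generalize x j = b
  have hp := phase_sq
  have hI := Complex.I_sq
  rcases Int.units_eq_one_or (s i) with h1 | h1 <;> rcases Int.units_eq_one_or (s j) with h2 | h2 <;>
  rw [h1, h2] <;> fin_cases a <;> fin_cases b <;> simp [signComp] <;> ring_nf <;>
  (try rw [hp]) <;> (try ring_nf) <;> (try rw [hI]) <;> (try ring)

/-- Moving a flip from the basis vectors to the coefficients reindexes the sum by an involution. A
single flip negates `s i * s j`, hence the opposite sign before `Complex.I`. -/
theorem eprTerm_mulVec_ofSign {n : ℕ} {i j : Fin n} (h : i ≠ j) (f : (Fin n → ℤˣ) → ℂ) :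
    eprTerm i j *ᵥ ofSign f = ofSign fun s => (1 / 2 : ℂ) * (f s + f (flip i (flip j s)) +
      Complex.I * ((s i : ℤ) * (s j : ℤ)) * (f (flip i s) + f (flip j s))) := by
  rw [ofSign, mulVec_smul, mulVec_sum, ofSign]
  congr 1
  simp only [mulVec_smul, eprTerm_mulVec_signVec h]
  have e1 : ∑ s, f (flip i (flip j s)) • signVec s = ∑ s, f s • signVec (flip i (flip j s)) := by
    rw [← sum_flip j, ← sum_flip i]
    refine Finset.sum_congr rfl fun s _ => ?_
    have : flip j (flip i s) = flip i (flip j s) := by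
      simpa [flip, h, h.symm] using Function.update_comm h (-s i) (-s j) s
    rw [flip_involutive j, flip_involutive i, this]
  have e2 : ∀ k, (k = i ∨ k = j) → ∑ s, (((s i : ℤ) : ℂ) * (s j : ℤ) * f (flip k s)) • signVec s =
      -∑ s, (((s i : ℤ) : ℂ) * (s j : ℤ) * f s) • signVec (flip k s) := by
    intro k hk
    rw [← sum_flip k, ← Finset.sum_neg_distrib]
    refine Finset.sum_congr rfl fun s _ => ?_
    rw [flip_involutive k, ← neg_smul]
    congr 1
    rcases hk with rfl | rfl
    · rw [flip_self, flip_of_ne h.symm]; push_cast; ring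
    · rw [flip_self, flip_of_ne h]; push_cast; ring
  have e3 := e2 i (Or.inl rfl)
  have e4 := e2 j (Or.inr rfl)
  have lhs : ∑ s, f s • (1 / 2 : ℂ) • (signVec s + signVec (flip i (flip j s)) -
      (Complex.I * ((s i : ℤ) * (s j : ℤ))) • (signVec (flip i s) + signVec (flip j s))) =
      (1 / 2 : ℂ) • (∑ s, f s • signVec s + ∑ s, f s • signVec (flip i (flip j s)) -
        Complex.I • (∑ s, (((s i : ℤ) : ℂ) * (s j : ℤ) * f s) • signVec (flip i s) +
        ∑ s, (((s i : ℤ) : ℂ) * (s j : ℤ) * f s) • signVec (flip j s))) := by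
    simp only [← Finset.sum_add_distrib, ← Finset.sum_sub_distrib, Finset.smul_sum]
    refine Finset.sum_congr rfl fun s _ => ?_
    module
  have rhs : ∑ s, ((1 / 2 : ℂ) * (f s + f (flip i (flip j s)) +
      Complex.I * ((s i : ℤ) * (s j : ℤ)) * (f (flip i s) + f (flip j s)))) • signVec s =
      (1 / 2 : ℂ) • (∑ s, f s • signVec s + ∑ s, f (flip i (flip j s)) • signVec s +
        Complex.I • (∑ s, (((s i : ℤ) : ℂ) * (s j : ℤ) * f (flip i s)) • signVec s +
        ∑ s, (((s i : ℤ) : ℂ) * (s j : ℤ) * f (flip j s)) • signVec s)) := by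
    simp only [← Finset.sum_add_distrib, Finset.smul_sum]
    refine Finset.sum_congr rfl fun s _ => ?_
    module
  rw [lhs, rhs, e1, e3, e4]
  module

/-! ### Energy of a commuting product state -/

/-- Once the signs at `u` and `v` are fixed, the other signs are independent. -/
theorem sum_factor_two {n : ℕ} {u v : Fin n} (h : u ≠ v) (c : ℤˣ → ℤˣ → ℂ)
    (g : Fin n → ℤˣ → ℤˣ → ℤˣ → ℂ) :
    ∑ s : Fin n → ℤˣ, c (s u) (s v) *
      ∏ b ∈ (Finset.univ.erase u).erase v, g b (s u) (s v) (s b) =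
    ∑ x, ∑ y, c x y * ∏ b ∈ (Finset.univ.erase u).erase v, ∑ t, g b x y t := by
  have split : ∀ F : Fin n → ℂ, ∏ b, F b =
      F u * (F v * ∏ b ∈ (Finset.univ.erase u).erase v, F b) := by
    intro F
    rw [← Finset.mul_prod_erase _ _ (Finset.mem_univ u), ← Finset.mul_prod_erase
      (Finset.univ.erase u) _ (Finset.mem_erase.mpr ⟨h.symm, Finset.mem_univ v⟩)]
  have hne : ∀ b ∈ (Finset.univ.erase u).erase v, b ≠ u ∧ b ≠ v := fun b hb => by
    simp only [Finset.mem_erase] at hb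
    exact ⟨hb.2.1, hb.1⟩
  -- Indicator factors at `u` and `v` fix the signs there, so that the whole sum is a product over
  -- all sites of one-site sums.
  let k : ℤˣ → ℤˣ → Fin n → ℤˣ → ℂ := fun x y b t =>
    if b = u then (if t = x then 1 else 0) else if b = v then (if t = y then 1 else 0) else g b x y t
  have key : ∀ x y, ∏ b ∈ (Finset.univ.erase u).erase v, ∑ t, g b x y t =
      ∑ s : Fin n → ℤˣ, (if s u = x then 1 else 0) * ((if s v = y then 1 else 0) *
        ∏ b ∈ (Finset.univ.erase u).erase v, g b x y (s b)) := by
    intro x y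
    have e : ∏ b, ∑ t, k x y b t = ∏ b ∈ (Finset.univ.erase u).erase v, ∑ t, g b x y t := by
      rw [split]
      simp only [k, if_true, if_neg h.symm, Finset.sum_ite_eq', Finset.mem_univ, one_mul]
      refine Finset.prod_congr rfl fun b hb => ?_
      simp only [(hne b hb).1, (hne b hb).2, if_false]
    rw [← e, Finset.prod_univ_sum, Fintype.piFinset_univ]
    refine Finset.sum_congr rfl fun s _ => ?_
    rw [split]
    simp only [k, if_true, if_neg h.symm]
    congr 2
    refine Finset.prod_congr rfl fun b hb => ?_
    simp only [(hne b hb).1, (hne b hb).2, if_false]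
  simp only [key, Finset.mul_sum]
  simp only [Finset.sum_comm (t := (Finset.univ : Finset (Fin n → ℤˣ)))]
  refine Finset.sum_congr rfl fun s _ => ?_
  rw [Finset.sum_eq_single (s u), Finset.sum_eq_single (s v)]
  · simp
  · intro y _ hy; simp [hy.symm]
  · exact fun hh => (hh (Finset.mem_univ _)).elim
  · intro x _ hx; simp [hx.symm]
  · exact fun hh => (hh (Finset.mem_univ _)).elim

/-- The phase of the basis state `s` under commuting two-body rotations with angles `Γ`. -/
def isingPhase {n : ℕ} (Γ : Fin n → Fin n → ℝ) (s : Fin n → ℤˣ) : ℝ :=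
  (∑ a, ∑ b, Γ a b * ((s a : ℤ) * (s b : ℤ))) / 2

/-- Exactly the pairs that contain `u` change sign. The phase difference is linear in the signs of
the other vertices, so its exponential factors over them. -/
theorem isingPhase_flip {n : ℕ} {Γ : Fin n → Fin n → ℝ} (hs : ∀ a b, Γ a b = Γ b a)
    (h0 : ∀ a, Γ a a = 0) (u : Fin n) (s : Fin n → ℤˣ) :
    isingPhase Γ (flip u s) = isingPhase Γ s - 2 * ((s u : ℤ) * ∑ b, Γ u b * (s b : ℤ)) := by
  have e : ∀ a b, Γ a b * (((flip u s a : ℤˣ) : ℤ) * ((flip u s b : ℤˣ) : ℤ)) =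
      Γ a b * ((s a : ℤ) * (s b : ℤ)) - (if a = u then 2 * (Γ u b * ((s u : ℤ) * (s b : ℤ))) else 0)
        - (if b = u then 2 * (Γ u a * ((s u : ℤ) * (s a : ℤ))) else 0) := by
    intro a b
    by_cases ha : a = u
    · subst ha
      by_cases hb : b = a
      · subst hb; simp [h0]
      · simp only [flip_self, flip_of_ne hb, if_true, if_neg hb]; push_cast; ring
    · by_cases hb : b = u
      · subst hb
        simp only [flip_self, flip_of_ne ha, if_true, if_neg ha, hs b a]; push_cast; ring
      · simp [flip_of_ne ha, flip_of_ne hb, ha, hb]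
  simp only [isingPhase, e, Finset.sum_sub_distrib]
  rw [Finset.sum_comm (f := fun a b => if a = u then 2 * (Γ u b * ((s u : ℤ) * (s b : ℤ) : ℝ)) else 0)]
  simp only [Finset.sum_ite_eq', Finset.mem_univ, if_true, Finset.mul_sum]
  rw [sub_sub, ← Finset.sum_add_distrib, sub_div]
  congr 1
  rw [Finset.sum_div]
  refine Finset.sum_congr rfl fun b _ => ?_
  ring

theorem star_exp_mul_exp (a b : ℝ) : star (Complex.exp (Complex.I * a)) * Complex.exp (Complex.I * b) =
    Complex.exp (Complex.I * ((b - a : ℝ) : ℂ)) := by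
  rw [Complex.star_def, ← Complex.exp_conj, ← Complex.exp_add]
  congr 1
  simp only [map_mul, Complex.conj_I, Complex.conj_ofReal]
  push_cast; ring

theorem sum_units_exp (a : ℝ) : ∑ t : ℤˣ, Complex.exp (Complex.I * ((a * (t : ℤ) : ℝ) : ℂ)) =
    2 * (Real.cos a : ℂ) := by
  rw [UnitsInt.univ, Finset.sum_pair (by decide), Complex.ofReal_cos, Complex.cos]
  push_cast
  ring_nf

/-- The normalisation: four sign pairs at the ends, and a factor 2 from `sum_units_exp` at every
other vertex. -/
theorem four_mul_two_pow {n : ℕ} {u v : Fin n} (h : u ≠ v) :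
    (4 : ℂ) * 2 ^ ((Finset.univ.erase u).erase v).card = 2 ^ n := by
  have h1 : ((Finset.univ.erase u).erase v).card + 1 = (Finset.univ.erase u).card :=
    Finset.card_erase_add_one (Finset.mem_erase.mpr ⟨h.symm, Finset.mem_univ v⟩)
  have h2 : (Finset.univ.erase u).card + 1 = n := by
    rw [Finset.card_erase_add_one (Finset.mem_univ u), Finset.card_univ, Fintype.card_fin]
  conv_rhs => rw [← h2, ← h1]
  ring

theorem sum_split_two {n : ℕ} {u v : Fin n} (h : u ≠ v) (F : Fin n → ℝ) :
    ∑ b, F b = F u + (F v + ∑ b ∈ (Finset.univ.erase u).erase v, F b) := by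
  rw [← Finset.add_sum_erase _ _ (Finset.mem_univ u), ← Finset.add_sum_erase
    (Finset.univ.erase u) _ (Finset.mem_erase.mpr ⟨h.symm, Finset.mem_univ v⟩)]

/-- The phase difference is `-2 s_u ∑ Γ_ub s_b`. Averaging over `s_b` gives a cosine for each `b ≠
v`; the term of `v`, weighted by `i s_u s_v`, averages to the sine. -/
theorem sum_flip_one {n : ℕ} {Γ : Fin n → Fin n → ℝ} (hs : ∀ a b, Γ a b = Γ b a)
    (h0 : ∀ a, Γ a a = 0) {u v : Fin n} (h : u ≠ v) :
    ∑ s, star (Complex.exp (Complex.I * isingPhase Γ s)) *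
      (Complex.I * ((s u : ℤ) * (s v : ℤ)) * Complex.exp (Complex.I * isingPhase Γ (flip u s))) =
    2 ^ n * ((Real.sin (2 * Γ u v) *
      ∏ b ∈ (Finset.univ.erase u).erase v, Real.cos (2 * Γ u b) : ℝ) : ℂ) := by
  let c : ℤˣ → ℤˣ → ℂ := fun x y : ℤˣ => Complex.I * ((x : ℤ) * (y : ℤ)) *
        Complex.exp (Complex.I * ((-2 * Γ u v * ((x : ℤ) * (y : ℤ)) : ℝ) : ℂ))
  let g : Fin n → ℤˣ → ℤˣ → ℤˣ → ℂ := fun b (x _ t : ℤˣ) =>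
        Complex.exp (Complex.I * ((-2 * Γ u b * (x : ℤ) * (t : ℤ) : ℝ) : ℂ))
  have e : ∀ s : Fin n → ℤˣ, star (Complex.exp (Complex.I * isingPhase Γ s)) *
      (Complex.I * ((s u : ℤ) * (s v : ℤ)) * Complex.exp (Complex.I * isingPhase Γ (flip u s))) =
      c (s u) (s v) *
      ∏ b ∈ (Finset.univ.erase u).erase v, g b (s u) (s v) (s b) := by
    intro s
    simp only [c, g]
    rw [mul_left_comm, star_exp_mul_exp, isingPhase_flip hs h0, sum_split_two h,
      ← Complex.exp_sum, mul_assoc (Complex.I * (((s u : ℤ) : ℂ) * ((s v : ℤ) : ℂ))), ← Complex.exp_add, h0, ← Finset.mul_sum, ← mul_add]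
    congr 3
    rw [← Complex.ofReal_sum, ← Complex.ofReal_add]
    congr 1
    have : ∑ b ∈ (Finset.univ.erase u).erase v, -2 * Γ u b * ((s u : ℤ) : ℝ) * ((s b : ℤ) : ℝ) =
        -2 * ((s u : ℤ) : ℝ) * ∑ b ∈ (Finset.univ.erase u).erase v, Γ u b * ((s b : ℤ) : ℝ) := by
      rw [Finset.mul_sum]
      exact Finset.sum_congr rfl fun b _ => by ring
    rw [this]
    ring
  refine (Finset.sum_congr rfl fun s _ => e s).trans ((sum_factor_two h c g).trans ?_)
  simp only [c, g, sum_units_exp, Finset.prod_mul_distrib, Finset.prod_const]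
  have hc : ∀ (x : ℤˣ) b, Real.cos (-2 * Γ u b * ((x : ℤ) : ℝ)) = Real.cos (2 * Γ u b) := by
    intro x b
    rcases Int.units_eq_one_or x with rfl | rfl <;> simp
  simp only [hc, ← Finset.sum_mul]
  rw [← four_mul_two_pow h]
  simp only [UnitsInt.univ, Finset.sum_pair (show (1 : ℤˣ) ≠ -1 by decide)]
  have hsin : (Real.sin (2 * Γ u v) : ℂ) = _ := Complex.ofReal_sin _
  rw [Complex.sin] at hsin
  push_cast at hsin ⊢
  rw [hsin]
  ring_nf

/-- Flipping both ends preserves the coupling between them. Another vertex `b` sees the sum or the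
difference of its two angles according to the sign of `s_u s_v`, and each case accounts for half of
the sign pairs. -/
theorem sum_flip_two {n : ℕ} {Γ : Fin n → Fin n → ℝ} (hs : ∀ a b, Γ a b = Γ b a)
    (h0 : ∀ a, Γ a a = 0) {u v : Fin n} (h : u ≠ v) :
    ∑ s, star (Complex.exp (Complex.I * isingPhase Γ s)) *
      Complex.exp (Complex.I * isingPhase Γ (flip u (flip v s))) =
    2 ^ n * (((∏ b ∈ (Finset.univ.erase u).erase v, Real.cos (2 * Γ u b + 2 * Γ v b) +
      ∏ b ∈ (Finset.univ.erase u).erase v, Real.cos (2 * Γ u b - 2 * Γ v b)) / 2 : ℝ) : ℂ) := by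
  let c : ℤˣ → ℤˣ → ℂ := fun _ _ : ℤˣ => 1
  let g : Fin n → ℤˣ → ℤˣ → ℤˣ → ℂ := fun b (x y t : ℤˣ) =>
        Complex.exp (Complex.I * (((-2 * Γ u b * (x : ℤ) - 2 * Γ v b * (y : ℤ)) * (t : ℤ) : ℝ) : ℂ))
  have e : ∀ s : Fin n → ℤˣ, star (Complex.exp (Complex.I * isingPhase Γ s)) *
      Complex.exp (Complex.I * isingPhase Γ (flip u (flip v s))) =
      c (s u) (s v) *
      ∏ b ∈ (Finset.univ.erase u).erase v, g
          b (s u) (s v) (s b) := by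
    intro s
    simp only [c, g]
    rw [star_exp_mul_exp, isingPhase_flip hs h0, isingPhase_flip hs h0, sum_split_two h,
      sum_split_two h, ← Complex.exp_sum, h0, h0, ← Finset.mul_sum, one_mul]
    simp only [flip_self, flip_of_ne h]
    rw [← Complex.ofReal_sum]
    congr 3
    have e1 : ∑ b ∈ (Finset.univ.erase u).erase v, (-2 * Γ u b * ((s u : ℤ) : ℝ) -
          2 * Γ v b * ((s v : ℤ) : ℝ)) * ((s b : ℤ) : ℝ) =
        -2 * ((s u : ℤ) : ℝ) * ∑ b ∈ (Finset.univ.erase u).erase v, Γ u b * ((s b : ℤ) : ℝ) -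
        2 * ((s v : ℤ) : ℝ) * ∑ b ∈ (Finset.univ.erase u).erase v, Γ v b * ((s b : ℤ) : ℝ) := by
      rw [Finset.mul_sum, Finset.mul_sum, ← Finset.sum_sub_distrib]
      exact Finset.sum_congr rfl fun b _ => by ring
    have e2 : ∑ b ∈ (Finset.univ.erase u).erase v, Γ u b * (((flip v s b : ℤˣ) : ℤ) : ℝ) =
        ∑ b ∈ (Finset.univ.erase u).erase v, Γ u b * ((s b : ℤ) : ℝ) :=
      Finset.sum_congr rfl fun b hb => by rw [flip_of_ne (Finset.ne_of_mem_erase hb)]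
    rw [e1, e2, hs v u]
    push_cast
    ring
  refine (Finset.sum_congr rfl fun s _ => e s).trans ((sum_factor_two h c g).trans ?_)
  simp only [c, g, sum_units_exp, Finset.prod_mul_distrib, Finset.prod_const]
  rw [← four_mul_two_pow h]
  have h1 : ∀ b, Real.cos (-2 * Γ u b * ((1 : ℤˣ) : ℤ) - 2 * Γ v b * ((1 : ℤˣ) : ℤ)) =
      Real.cos (2 * Γ u b + 2 * Γ v b) := fun b => by
    rw [← Real.cos_neg]; push_cast; ring_nf
  have h2 : ∀ b, Real.cos (-2 * Γ u b * ((-1 : ℤˣ) : ℤ) - 2 * Γ v b * ((-1 : ℤˣ) : ℤ)) =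
      Real.cos (2 * Γ u b + 2 * Γ v b) := fun b => by
    push_cast; ring_nf
  have h3 : ∀ b, Real.cos (-2 * Γ u b * ((1 : ℤˣ) : ℤ) - 2 * Γ v b * ((-1 : ℤˣ) : ℤ)) =
      Real.cos (2 * Γ u b - 2 * Γ v b) := fun b => by
    rw [← Real.cos_neg]; push_cast; ring_nf
  have h4 : ∀ b, Real.cos (-2 * Γ u b * ((-1 : ℤˣ) : ℤ) - 2 * Γ v b * ((1 : ℤˣ) : ℤ)) =
      Real.cos (2 * Γ u b - 2 * Γ v b) := fun b => by
    push_cast; ring_nf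
  simp only [UnitsInt.univ, Finset.sum_pair (show (1 : ℤˣ) ≠ -1 by decide), h1, h2, h3, h4]
  push_cast
  ring

/-- The constant 1 is the norm of the state, the sum and difference products come from the double
flip, and the sine terms from the two single flips. -/
theorem energy_eprTerm_ising {n : ℕ} {Γ : Fin n → Fin n → ℝ} (hs : ∀ a b, Γ a b = Γ b a)
    (h0 : ∀ a, Γ a a = 0) {u v : Fin n} (h : u ≠ v) :
    energy (eprTerm u v) (ofSign fun s => Complex.exp (Complex.I * isingPhase Γ s)) =
    (1 + (∏ b ∈ (Finset.univ.erase u).erase v, Real.cos (2 * Γ u b + 2 * Γ v b) +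
      ∏ b ∈ (Finset.univ.erase u).erase v, Real.cos (2 * Γ u b - 2 * Γ v b)) / 2 +
      Real.sin (2 * Γ u v) * (∏ b ∈ (Finset.univ.erase u).erase v, Real.cos (2 * Γ u b) +
      ∏ b ∈ (Finset.univ.erase u).erase v, Real.cos (2 * Γ v b))) / 2 := by
  have h2 : (2 : ℂ) ^ n ≠ 0 := pow_ne_zero _ two_ne_zero
  rw [energy, eprTerm_mulVec_ofSign h, star_ofSign_dotProduct]
  have f1 := sum_flip_one hs h0 h
  have f2 := sum_flip_one hs h0 h.symm
  have f3 := sum_flip_two hs h0 h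
  have f4 : ∑ s, star (Complex.exp (Complex.I * isingPhase Γ s)) *
      Complex.exp (Complex.I * isingPhase Γ s) = 2 ^ n := by
    simp only [star_exp_mul_exp]
    simp
  have key : ∑ s, star (Complex.exp (Complex.I * isingPhase Γ s)) *
      ((1 / 2 : ℂ) * (Complex.exp (Complex.I * isingPhase Γ s) +
        Complex.exp (Complex.I * isingPhase Γ (flip u (flip v s))) +
        Complex.I * ((s u : ℤ) * (s v : ℤ)) * (Complex.exp (Complex.I * isingPhase Γ (flip u s)) +
          Complex.exp (Complex.I * isingPhase Γ (flip v s))))) =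
      (1 / 2 : ℂ) * (∑ s, star (Complex.exp (Complex.I * isingPhase Γ s)) *
          Complex.exp (Complex.I * isingPhase Γ s) +
        ∑ s, star (Complex.exp (Complex.I * isingPhase Γ s)) *
          Complex.exp (Complex.I * isingPhase Γ (flip u (flip v s))) +
        ∑ s, star (Complex.exp (Complex.I * isingPhase Γ s)) *
          (Complex.I * ((s u : ℤ) * (s v : ℤ)) *
            Complex.exp (Complex.I * isingPhase Γ (flip u s))) +
        ∑ s, star (Complex.exp (Complex.I * isingPhase Γ s)) *
          (Complex.I * ((s v : ℤ) * (s u : ℤ)) *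
            Complex.exp (Complex.I * isingPhase Γ (flip v s)))) := by
    simp only [← Finset.sum_add_distrib, Finset.mul_sum]
    refine Finset.sum_congr rfl fun s _ => ?_
    ring
  rw [key, f1, f2, f3, f4, hs v u, Finset.erase_right_comm (a := v)]
  rw [← Complex.ofReal_re ((1 + _ + _) / 2)]
  congr 1
  push_cast
  field_simp
  ring

theorem star_ofSign_ising {n : ℕ} (Γ : Fin n → Fin n → ℝ) :
    star (ofSign fun s => Complex.exp (Complex.I * isingPhase Γ s)) ⬝ᵥ
      (ofSign fun s => Complex.exp (Complex.I * isingPhase Γ s)) = 1 := by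
  rw [star_ofSign_dotProduct]
  simp only [star_exp_mul_exp]
  simp

/-! ### The scalar inequality -/

theorem log_goldenRatio_pos : 0 < Real.log Real.goldenRatio := Real.log_pos Real.one_lt_goldenRatio

theorem log_goldenRatio_lt : Real.log Real.goldenRatio < Real.goldenRatio - 1 :=
  Real.log_lt_sub_one_of_pos Real.goldenRatio_pos Real.one_lt_goldenRatio.ne'

/-- The difference `h` of the two sides vanishes at both `0` and `φ - 1`. Its derivative has the
sign of a cubic `c` that is convex on the nonnegative axis, positive at `0` and negative at `φ - 1`.
So `h` first increases and then decreases, and stays nonnegative in between. -/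
theorem goldenRatio_log_le {s : ℝ} (hs0 : 0 ≤ s) (hs1 : s ≤ Real.goldenRatio - 1) :
    Real.goldenRatio * Real.log (1 + Real.goldenRatio * s ^ 2) ≤
      (2 * s + s ^ 2) * Real.log Real.goldenRatio := by
  have hsq := Real.goldenRatio_sq
  have h1 := Real.one_lt_goldenRatio
  have hL0 := log_goldenRatio_pos
  have hL1 := log_goldenRatio_lt
  set φ := Real.goldenRatio with hφ
  set L := Real.log φ with hL
  have hpos : ∀ x : ℝ, 0 < 1 + φ * x ^ 2 := fun x => by positivity
  let c : ℝ → ℝ := fun x => L * (1 + x) * (1 + φ * x ^ 2) - φ ^ 2 * x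
  let h : ℝ → ℝ := fun x => (2 * x + x ^ 2) * L - φ * Real.log (1 + φ * x ^ 2)
  -- Convexity of `c` in chord form. The gap to the chord factors explicitly, so no second
  -- derivative is needed.
  have hcconv : ∀ a x b, 0 ≤ a → a ≤ x → x ≤ b → (b - a) * c x ≤ (b - x) * c a + (x - a) * c b := by
    intro a x b ha hax hxb
    have e : (b - x) * c a + (x - a) * c b - (b - a) * c x =
        L * φ * (b - a) * (b - x) * (x - a) * (1 + a + b + x) := by simp only [c]; ring
    have h2 : 0 ≤ L * φ * (b - a) * (b - x) * (x - a) * (1 + a + b + x) := by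
      have : 0 ≤ b - a := by linarith
      have : 0 ≤ b - x := by linarith
      have : 0 ≤ x - a := by linarith
      have : 0 ≤ 1 + a + b + x := by linarith
      have : 0 ≤ φ := by linarith
      positivity
    linarith
  have hc0 : c 0 = L := by simp [c]
  -- Modulo `φ² = φ + 1` the value is `φ (L φ - 1)`, which is negative because `L < φ - 1 = 1/φ`.
  have hc1 : c (φ - 1) < 0 := by
    have e : c (φ - 1) = φ * (L * φ - 1) + (φ ^ 2 - φ - 1) * (L * (φ ^ 2 - φ) - φ) := by
      simp only [c]; ring
    rw [e, show φ ^ 2 - φ - 1 = 0 by linarith, zero_mul, add_zero]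
    have : L * φ < 1 := by nlinarith
    nlinarith
  have hccont : Continuous c := by fun_prop
  obtain ⟨z, ⟨hz0, hz1⟩, hz⟩ : (0 : ℝ) ∈ c '' Set.Icc 0 (φ - 1) :=
    intermediate_value_Icc' (by linarith) hccont.continuousOn ⟨hc1.le, by rw [hc0]; exact hL0.le⟩
  have hzlt : z < φ - 1 := lt_of_le_of_ne hz1 (by rintro rfl; linarith)
  have hder : ∀ x, HasDerivAt h (2 * c x / (1 + φ * x ^ 2)) x := by
    intro x
    have d1 : HasDerivAt (fun x : ℝ => (2 * x + x ^ 2) * L) ((2 + 2 * x) * L) x := by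
      have := (((hasDerivAt_id x).const_mul 2).add (hasDerivAt_pow 2 x)).mul_const L
      simpa using this
    have d2 : HasDerivAt (fun x : ℝ => 1 + φ * x ^ 2) (φ * (2 * x)) x := by
      have := ((hasDerivAt_pow 2 x).const_mul φ).const_add 1
      simpa using this
    have d3 := d1.sub ((d2.log (hpos x).ne').const_mul φ)
    have hne := (hpos x).ne'
    have e : 2 * c x / (1 + φ * x ^ 2) =
        (2 + 2 * x) * L - φ * (φ * (2 * x) / (1 + φ * x ^ 2)) := by
      simp only [c]
      field_simp
    rw [e]
    exact d3
  have hcont : Continuous h := continuous_iff_continuousAt.mpr fun x => (hder x).continuousAt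
  have h00 : h 0 = 0 := by simp [h]
  have h11 : h (φ - 1) = 0 := by
    have e1 : 2 * (φ - 1) + (φ - 1) ^ 2 = φ := by linarith
    have e2 : 1 + φ * (φ - 1) ^ 2 = φ := by
      have : φ * (φ - 1) ^ 2 = (φ - 1) * (φ ^ 2 - φ) := by ring
      rw [this, hsq]; ring
    simp only [h, e1, e2]; rw [← hL]; ring
  -- The chord inequality together with `c z = 0` and `c (φ - 1) < 0` gives `c ≥ 0` left of `z` and
  -- `c ≤ 0` right of it.
  have hnn : 0 ≤ h s := by
    rcases le_total s z with hsz | hsz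
    · have mono : MonotoneOn h (Set.Icc 0 z) := by
        refine monotoneOn_of_deriv_nonneg (convex_Icc 0 z) hcont.continuousOn
          (fun x _ => (hder x).differentiableAt.differentiableWithinAt) fun x hx => ?_
        rw [interior_Icc] at hx
        rw [(hder x).deriv]
        have h3 := hcconv x z (φ - 1) hx.1.le hx.2.le hzlt.le
        rw [hz] at h3
        have h4 : 0 ≤ c x := by
          by_contra hneg
          push Not at hneg
          have h5 : (φ - 1 - z) * c x < 0 := mul_neg_of_pos_of_neg (by linarith) hneg
          have h6 : (z - x) * c (φ - 1) < 0 := mul_neg_of_pos_of_neg (by linarith [hx.2]) hc1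
          linarith
        exact div_nonneg (by linarith) (hpos x).le
      rw [← h00]
      exact mono ⟨le_rfl, hz0⟩ ⟨hs0, hsz⟩ hs0
    · have anti : AntitoneOn h (Set.Icc z (φ - 1)) := by
        refine antitoneOn_of_deriv_nonpos (convex_Icc z (φ - 1)) hcont.continuousOn
          (fun x _ => (hder x).differentiableAt.differentiableWithinAt) fun x hx => ?_
        rw [interior_Icc] at hx
        rw [(hder x).deriv]
        have h3 := hcconv z x (φ - 1) hz0 hx.1.le hx.2.le
        rw [hz] at h3
        have h4 : c x ≤ 0 := by
          by_contra hpos'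
          push Not at hpos'
          have h5 : 0 < (φ - 1 - z) * c x := mul_pos (by linarith) hpos'
          have h6 : (x - z) * c (φ - 1) < 0 := mul_neg_of_pos_of_neg (by linarith [hx.1]) hc1
          linarith
        exact div_nonpos_of_nonpos_of_nonneg (by linarith) (hpos x).le
      rw [← h11]
      exact anti ⟨hsz, hs1⟩ ⟨hz1, le_rfl⟩ hs1
  simp only [h] at hnn
  linarith

theorem two_mul_theta : 2 * theta = Real.log Real.goldenRatio := by rw [theta]; ring

theorem theta_pos : 0 < theta := by rw [theta]; linarith [log_goldenRatio_pos]

/-- The contribution of an edge with matching value `x`. -/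
theorem goldenRatio_mul_le {x : ℝ} (h0 : 0 ≤ x) (h1 : x ≤ 1) :
    Real.goldenRatio * (1 + x) ≤ 1 + Real.exp (-theta * (1 - x)) ^ 2 +
      2 * (√(1 - Real.exp (-theta * x) ^ 2) * Real.exp (-theta * (1 - x))) := by
  have hsq := Real.goldenRatio_sq
  have hp := Real.goldenRatio_pos
  have hg1 := Real.one_lt_goldenRatio
  have hθ := theta_pos
  have h2θ := two_mul_theta
  set φ := Real.goldenRatio with hφ
  set s := √(1 - Real.exp (-theta * x) ^ 2) * Real.exp (-theta * (1 - x)) with hs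
  have hle : Real.exp (-theta * x) ^ 2 ≤ 1 := by
    rw [← Real.exp_nat_mul]
    apply Real.exp_le_one_iff.mpr
    push_cast
    nlinarith
  have hs0 : 0 ≤ s := by positivity
  -- Since `exp (-2θ) = 1/φ`, the product of the two squared exponentials does not depend on `x`.
  have hs2 : s ^ 2 = Real.exp (-theta * (1 - x)) ^ 2 - φ⁻¹ := by
    rw [hs, mul_pow, Real.sq_sqrt (by linarith), sub_mul, one_mul]
    congr 1
    rw [← mul_pow, ← Real.exp_add, ← Real.exp_nat_mul, ← Real.exp_log hp, ← Real.exp_neg,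
      ← h2θ]
    congr 1
    push_cast; ring
  have hinv : φ⁻¹ = φ - 1 := by
    field_simp
    linarith
  have hE : Real.exp (-theta * (1 - x)) ^ 2 ≤ 1 := by
    rw [← Real.exp_nat_mul]
    apply Real.exp_le_one_iff.mpr
    push_cast
    nlinarith
  have hs1 : s ≤ φ - 1 := by
    refine le_of_sq_le_sq ?_ (by linarith)
    rw [hs2, hinv]
    nlinarith
  have key := goldenRatio_log_le hs0 hs1
  -- In terms of `s`, the matching value is `x = log (1 + φ s²) / log φ`. The claim becomes `φ x ≤ 2
  -- s + s²`, which is `goldenRatio_log_le`.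
  have hlog : Real.log (1 + φ * s ^ 2) = x * Real.log φ := by
    have : 1 + φ * s ^ 2 = Real.exp (x * Real.log φ) := by
      rw [hs2, mul_sub, mul_inv_cancel₀ hp.ne', ← Real.exp_nat_mul]
      have : φ * Real.exp ((2 : ℕ) * (-theta * (1 - x))) =
          Real.exp (Real.log φ + (2 : ℕ) * (-theta * (1 - x))) := by
        rw [Real.exp_add, Real.exp_log hp]
      rw [this, ← h2θ]
      push_cast
      ring_nf
    rw [this, Real.log_exp]
  rw [← hφ] at key
  rw [hlog] at key
  have hL : 0 < Real.log φ := log_goldenRatio_pos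
  have k2 : φ * x ≤ 2 * s + s ^ 2 := by
    have : φ * x * Real.log φ ≤ (2 * s + s ^ 2) * Real.log φ := by linarith
    exact le_of_mul_le_mul_right this hL
  rw [hs2, hinv] at k2
  linarith

/-- When the products are expanded, the odd powers of the `y i` cancel in the sum and the even ones
are nonnegative. The second conjunct is needed to carry the induction. -/
theorem two_mul_prod_le {ι : Type*} (S : Finset ι) (x y : ι → ℝ) (hx : ∀ i ∈ S, 0 ≤ x i)
    (hy : ∀ i ∈ S, 0 ≤ y i) :
    2 * ∏ i ∈ S, x i ≤ ∏ i ∈ S, (x i + y i) + ∏ i ∈ S, (x i - y i) ∧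
      ∏ i ∈ S, (x i - y i) ≤ ∏ i ∈ S, (x i + y i) := by
  classical
  induction S using Finset.induction_on with
  | empty => norm_num
  | insert a S ha ih =>
    obtain ⟨ih1, ih2⟩ := ih (fun i hi => hx i (Finset.mem_insert_of_mem hi))
      (fun i hi => hy i (Finset.mem_insert_of_mem hi))
    have hxa := hx a (Finset.mem_insert_self a S)
    have hya := hy a (Finset.mem_insert_self a S)
    have hp : 0 ≤ ∏ i ∈ S, x i := Finset.prod_nonneg fun i hi => hx i (Finset.mem_insert_of_mem hi)
    simp only [Finset.prod_insert ha]
    generalize ∏ i ∈ S, x i = p at *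
    generalize ∏ i ∈ S, (x i + y i) = q at *
    generalize ∏ i ∈ S, (x i - y i) = r at *
    have e1 : 0 ≤ x a * (q + r - 2 * p) := mul_nonneg hxa (by linarith)
    have e2 : 0 ≤ y a * (q - r) := mul_nonneg hya (by linarith)
    have e3 : 0 ≤ x a * (q - r) := mul_nonneg hxa (by linarith)
    have e4 : 0 ≤ y a * (q + r) := mul_nonneg hya (by linarith)
    constructor <;> linarith

/-! ### The guarantee of the matching circuit -/

theorem cos_two_mul_angle {x : ℝ} (h : 0 ≤ x) : Real.cos (2 * angle x) = Real.exp (-theta * x) := by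
  rw [angle, mul_div_cancel₀ _ two_ne_zero, Real.cos_arccos]
  · linarith [Real.exp_pos (-theta * x)]
  · exact Real.exp_le_one_iff.mpr (by nlinarith [theta_pos])

theorem sin_two_mul_angle (x : ℝ) :
    Real.sin (2 * angle x) = √(1 - Real.exp (-theta * x) ^ 2) := by
  rw [angle, mul_div_cancel₀ _ two_ne_zero, Real.sin_arccos]

theorem angle_zero : angle 0 = 0 := by simp [angle]

theorem IsMatchingCircuit.length_eq {n : ℕ} {G : WGraph n ℝ} {C : Circuit n ℝ}
    (hC : IsMatchingCircuit G C) : C.length = G.edges.card := by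
  obtain ⟨m, _, l, hl, hmem, rfl⟩ := hC
  have : l.toFinset = G.edges := by ext e; simp [hmem]
  rw [List.length_map, ← this, List.toFinset_card_of_nodup hl]

/-- The amplitudes are products of scalar phases, so the ordered list of gates can be replaced by
the edge set. Non-edges have angle 0 and may be included. -/
theorem IsMatchingCircuit.state_eq {n : ℕ} {G : WGraph n ℝ} {C : Circuit n ℝ}
    (hC : IsMatchingCircuit G C) : ∃ m, G.IsMaxFracMatching m ∧
      C.state = ofSign fun s => Complex.exp (Complex.I * isingPhase (fun a b => angle (m a b)) s) := by
  obtain ⟨m, hm, l, hl, hmem, rfl⟩ := hC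
  refine ⟨m, hm, ?_⟩
  have hl' : l.toFinset = G.edges := by ext e; simp [hmem]
  rw [Circuit.state_eq]
  congr 1
  funext s
  have e1 : isingPhase (fun a b => angle (m a b)) s =
      ∑ e ∈ G.edges, angle (m e.1 e.2) * ((s e.1 : ℤ) * (s e.2 : ℤ)) := by
    rw [isingPhase]
    refine (G.sum_edges_eq (F := fun a b => angle (m a b) * ((s a : ℤ) * (s b : ℤ))) ?_ ?_).symm
    · intro u v; simp only [hm.1.symm u v]; ring
    · intro u v h; simp only [hm.1.supp u v h, angle_zero, zero_mul]
  rw [e1, Complex.ofReal_sum, Finset.mul_sum, Complex.exp_sum, ← hl', List.prod_toFinset _ hl,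
    Circuit.amplitude, List.map_map]
  congr 1
  refine List.map_congr_left fun e _ => ?_
  simp only [Function.comp_apply]
  push_cast
  ring_nf

theorem sum_erase_erase_le {n : ℕ} {G : WGraph n ℝ} {m : Fin n → Fin n → ℝ}
    (hm : G.IsFracMatching m) {u v : Fin n} (h : u ≠ v) :
    ∑ b ∈ (Finset.univ.erase u).erase v, m u b ≤ 1 - m u v := by
  have := hm.sum_le_one u
  rw [sum_split_two h] at this
  linarith [hm.nonneg u u]

/-- This is the purpose of the choice of angles: `log (cos 2γ)` is linear in the matching value, so
the matching constraint at `u` controls the whole product. -/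
theorem exp_le_prod_cos {n : ℕ} {G : WGraph n ℝ} {m : Fin n → Fin n → ℝ}
    (hm : G.IsFracMatching m) {u v : Fin n} (h : u ≠ v) :
    Real.exp (-theta * (1 - m u v)) ≤
      ∏ b ∈ (Finset.univ.erase u).erase v, Real.cos (2 * angle (m u b)) := by
  rw [Finset.prod_congr rfl fun b _ => cos_two_mul_angle (hm.nonneg u b), ← Real.exp_sum,
    ← Finset.mul_sum]
  apply Real.exp_le_exp.mpr
  nlinarith [sum_erase_erase_le hm h, theta_pos]

theorem le_energy_eprTerm {n : ℕ} {G : WGraph n ℝ} {m : Fin n → Fin n → ℝ}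
    (hm : G.IsFracMatching m) {u v : Fin n} (h : u ≠ v) :
    Real.goldenRatio / 2 * (1 + m u v) ≤ energy (eprTerm u v)
      (ofSign fun s => Complex.exp (Complex.I * isingPhase (fun a b => angle (m a b)) s)) := by
  have h0 : ∀ a, angle (m a a) = 0 := fun a => by
    rw [hm.supp a a (by simp [G.loopless]), angle_zero]
  rw [energy_eprTerm_ising (Γ := fun a b => angle (m a b)) (fun a b => by rw [hm.symm]) h0 h]
  have p1 := exp_le_prod_cos hm h
  have p2 := exp_le_prod_cos hm h.symm
  rw [Finset.erase_right_comm, hm.symm v u] at p2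
  have hcos : ∀ a b, 0 ≤ Real.cos (2 * angle (m a b)) := fun a b => by
    rw [cos_two_mul_angle (hm.nonneg a b)]; exact (Real.exp_pos _).le
  have hsin : ∀ a b, 0 ≤ Real.sin (2 * angle (m a b)) := fun a b => by
    rw [sin_two_mul_angle]; exact Real.sqrt_nonneg _
  -- By the addition formulas, `x - y` and `x + y` are the cosines of the sum and of the difference
  -- of the doubled angles.
  have p3 := (two_mul_prod_le ((Finset.univ.erase u).erase v)
    (fun b => Real.cos (2 * angle (m u b)) * Real.cos (2 * angle (m v b)))
    (fun b => Real.sin (2 * angle (m u b)) * Real.sin (2 * angle (m v b)))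
    (fun b _ => mul_nonneg (hcos u b) (hcos v b)) (fun b _ => mul_nonneg (hsin u b) (hsin v b))).1
  simp only [← Real.cos_add, ← Real.cos_sub, Finset.prod_mul_distrib] at p3
  have hE := Real.exp_pos (-theta * (1 - m u v))
  have p4 := mul_le_mul p1 p2 hE.le (hE.le.trans p1)
  have p5 := goldenRatio_mul_le (hm.nonneg u v) (hm.le_one u v)
  have p6 : Real.sin (2 * angle (m u v)) * (2 * Real.exp (-theta * (1 - m u v))) ≤
      Real.sin (2 * angle (m u v)) *
      (∏ b ∈ (Finset.univ.erase u).erase v, Real.cos (2 * angle (m u b)) +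
      ∏ b ∈ (Finset.univ.erase u).erase v, Real.cos (2 * angle (m v b))) :=
    mul_le_mul_of_nonneg_left (by linarith) (hsin u v)
  rw [← sin_two_mul_angle] at p5
  linarith

theorem IsMatchingCircuit.guarantee {n : ℕ} {G : WGraph n ℝ} {C : Circuit n ℝ}
    (hC : IsMatchingCircuit G C) :
    star C.state ⬝ᵥ C.state = 1 ∧
    0 ≤ Real.goldenRatio / 2 * (G.totalWeight + G.FM) ∧
    Real.goldenRatio / 2 * (G.totalWeight + G.FM) ≤ energy (hamiltonian G) C.state ∧
    energy (hamiltonian G) C.state ≤ lambdaMax (hamiltonian G) ∧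
    Real.goldenRatio / 2 * lambdaMax (hamiltonian G) ≤ energy (hamiltonian G) C.state := by
  obtain ⟨m, hm, hst⟩ := hC.state_eq
  have hunit : star C.state ⬝ᵥ C.state = 1 := by rw [hst]; exact star_ofSign_ising _
  have hp := Real.goldenRatio_pos
  have hsum : G.totalWeight + G.FM = ∑ e ∈ G.edges, G.w e.1 e.2 * (1 + m e.1 e.2) := by
    rw [hm.eq_FM, WGraph.totalWeight, WGraph.matchingWeight, ← Finset.sum_add_distrib]
    exact Finset.sum_congr rfl fun e _ => by ring
  have hlow : Real.goldenRatio / 2 * (G.totalWeight + G.FM) ≤ energy (hamiltonian G) C.state := by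
    rw [hsum, energy_hamiltonian, Finset.mul_sum]
    refine Finset.sum_le_sum fun e he => ?_
    have h := le_energy_eprTerm hm.1 (Finset.mem_filter.mp he).2.1.ne
    rw [hst]
    have := mul_le_mul_of_nonneg_left h (G.nonneg e.1 e.2)
    linarith
  have hup := energy_le_lambdaMax (hamiltonian_isHermitian G) hunit
  refine ⟨hunit, mul_nonneg (by linarith) ?_, hlow, hup, ?_⟩
  · rw [hsum]
    exact Finset.sum_nonneg fun e _ => mul_nonneg (G.nonneg _ _) (by linarith [hm.1.nonneg e.1 e.2])
  · exact (mul_le_mul_of_nonneg_left (lambdaMax_hamiltonian_le G) (by linarith)).trans hlow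

/-! ### Unit-cost runs of programs -/

section Steps

variable {K : Type} [Field K] [LinearOrder K]

/-- `Steps p s t k`: started in `s`, the program `p` halts in `t` after `k` instructions and
tests. -/
inductive Steps : Program → Store K → Store K → ℕ → Prop
  | skip (s) : Steps .skip s s 1
  | setVar (x e s) : Steps (.setVar x e) s (s.setVar x (e.eval s)) 1
  | setArr (a i j e s) :
      Steps (.setArr a i j e) s (s.setArr a (i.eval s) (j.eval s) (e.eval s)) 1
  | setMem (a i j e s) :
      Steps (.setMem a i j e) s (s.setMem a (i.eval s) (j.eval s) (e.eval s)) 1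
  | seq {p q s t u k l} : Steps p s t k → Steps q t u l → Steps (.seq p q) s u (k + l)
  | cond_true {b p q s t k} : b.eval s → Steps p s t k → Steps (.cond b p q) s t (1 + k)
  | cond_false {b p q s t k} : ¬ b.eval s → Steps q s t k → Steps (.cond b p q) s t (1 + k)
  | loop_true {b p s t u k l} : b.eval s → Steps p s t k → Steps (.loop b p) t u l →
      Steps (.loop b p) s u (1 + k + l)
  | loop_false {b p s} : ¬ b.eval s → Steps (.loop b p) s s 1

end Steps

/-! ### From unit cost to logarithmic cost -/

/-- A bound on the growth of the binary length. -/
def NExp.rank : NExp → ℕ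
  | .lit c => c
  | .var _ => 0
  | .arr _ _ _ => 0
  | .plus e f => e.rank + f.rank + 1
  | .minus e f => e.rank + f.rank + 1
  | .times e f => e.rank + f.rank

/-- No multiplications. -/
def NExp.linear : NExp → Bool
  | .plus e f => e.linear && f.linear
  | .minus e f => e.linear && f.linear
  | .times _ _ => false
  | _ => true

/-- The literal `2`. -/
def FExp.isTwo : FExp → Bool
  | .lit c => c == 2
  | _ => false

/-- A bound on the growth of the binary length. -/
def FExp.rank : FExp → ℕ
  | .lit c => c.natAbs
  | .mem _ _ _ => 0
  | .plus e f => e.rank + f.rank + 1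
  | .minus e f => e.rank + f.rank + 1
  | .times e f => e.rank + f.rank
  | .divide e _ => e.rank + 1

/-- No multiplications, and division by `2` only. -/
def FExp.linear : FExp → Bool
  | .lit _ => true
  | .mem _ _ _ => true
  | .plus e f => e.linear && f.linear
  | .minus e f => e.linear && f.linear
  | .times _ _ => false
  | .divide e f => e.linear && f.isTwo

/-- A bound on the growth of the binary length in one step. -/
def Program.rank : Program → ℕ
  | .skip => 0
  | .setVar _ e => e.rank
  | .setArr _ _ _ e => e.rank
  | .setMem _ _ _ e => e.rank
  | .seq p q => p.rank + q.rank
  | .cond _ p q => p.rank + q.rank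
  | .loop _ p => p.rank

/-- All stored values are computed without multiplications. -/
def Program.linear : Program → Bool
  | .skip => true
  | .setVar _ e => e.linear
  | .setArr _ _ _ e => e.linear
  | .setMem _ _ _ e => e.linear
  | .seq p q => p.linear && q.linear
  | .cond _ p q => p.linear && q.linear
  | .loop _ p => p.linear

section Cost

variable {K : Type}

/-- A grading of the field elements that controls their size and grows slowly under linear
operations. -/
structure SizeGrading [Field K] (size : K → ℕ) (L : ℕ) (Adm : ℕ → K → Prop) : Prop where
  mono : ∀ {B B' x}, B ≤ B' → Adm B x → Adm B' x
  add : ∀ {B x y}, Adm B x → Adm B y → Adm (B + 1) (x + y)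
  sub : ∀ {B x y}, Adm B x → Adm B y → Adm (B + 1) (x - y)
  half : ∀ {B x}, Adm B x → Adm (B + 1) (x / 2)
  int : ∀ c : ℤ, Adm c.natAbs (c : K)
  size_le : ∀ {B x}, Adm B x → size x ≤ L + 3 * B

/-- All numbers in the memory have grade at most `B`. -/
structure Store.Graded (Adm : ℕ → K → Prop) (B : ℕ) (s : Store K) : Prop where
  var : ∀ x, Nat.size (s.var x) ≤ B
  arr : ∀ a i j, Nat.size (s.arr a i j) ≤ B
  mem : ∀ a i j, Adm B (s.mem a i j)

theorem nat_size_add_le {a b B : ℕ} (ha : Nat.size a ≤ B) (hb : Nat.size b ≤ B) :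
    Nat.size (a + b) ≤ B + 1 := by
  rw [Nat.size_le] at *
  rw [pow_succ]; omega

theorem NExp.size_eval_le {Adm : ℕ → K → Prop} {B : ℕ} {s : Store K} (hs : s.Graded Adm B)
    (e : NExp) (he : e.linear = true) : Nat.size (e.eval s) ≤ B + e.rank := by
  induction e with
  | lit c =>
    simp only [NExp.eval, NExp.rank]
    exact (Nat.size_le.mpr Nat.lt_two_pow_self).trans (Nat.le_add_left _ _)
  | var x => exact hs.var x
  | arr a i j => exact hs.arr a _ _
  | plus e f ihe ihf =>
    simp only [NExp.linear, Bool.and_eq_true] at he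
    have h1 := (ihe he.1).trans (show B + e.rank ≤ B + e.rank + f.rank by omega)
    have h2 := (ihf he.2).trans (show B + f.rank ≤ B + e.rank + f.rank by omega)
    have := nat_size_add_le h1 h2
    simp only [NExp.eval, NExp.rank]
    omega
  | minus e f ihe ihf =>
    simp only [NExp.linear, Bool.and_eq_true] at he
    have h1 := ihe he.1
    have := Nat.size_le_size (Nat.sub_le (e.eval s) (f.eval s))
    simp only [NExp.eval, NExp.rank]
    omega
  | times e f => simp [NExp.linear] at he

theorem FExp.graded_eval [Field K] {size : K → ℕ} {L : ℕ} {Adm : ℕ → K → Prop}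
    (hA : SizeGrading size L Adm) {B : ℕ} {s : Store K} (hs : s.Graded Adm B)
    (e : FExp) (he : e.linear = true) : Adm (B + e.rank) (e.eval s) := by
  induction e with
  | lit c => exact hA.mono (Nat.le_add_left _ _) (hA.int c)
  | mem a i j => exact hs.mem a _ _
  | plus e f ihe ihf =>
    simp only [FExp.linear, Bool.and_eq_true] at he
    have h1 := hA.mono (show B + e.rank ≤ B + e.rank + f.rank by omega) (ihe he.1)
    have h2 := hA.mono (show B + f.rank ≤ B + e.rank + f.rank by omega) (ihf he.2)
    exact hA.mono (by simp only [FExp.rank]; omega) (hA.add h1 h2)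
  | minus e f ihe ihf =>
    simp only [FExp.linear, Bool.and_eq_true] at he
    have h1 := hA.mono (show B + e.rank ≤ B + e.rank + f.rank by omega) (ihe he.1)
    have h2 := hA.mono (show B + f.rank ≤ B + e.rank + f.rank by omega) (ihf he.2)
    exact hA.mono (by simp only [FExp.rank]; omega) (hA.sub h1 h2)
  | times e f => simp [FExp.linear] at he
  | divide e f ihe _ =>
    simp only [FExp.linear, Bool.and_eq_true] at he
    cases f with
    | lit c =>
      have hc : c = 2 := by simpa [FExp.isTwo] using he.2
      subst hc
      have := hA.half (ihe he.1)
      simpa [FExp.eval, FExp.rank, add_assoc] using this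
    | _ => simp [FExp.isTwo] at he

theorem Store.Graded.mono [Field K] {size : K → ℕ} {L : ℕ} {Adm : ℕ → K → Prop}
    (hA : SizeGrading size L Adm) {B B' : ℕ} {s : Store K} (hs : s.Graded Adm B) (h : B ≤ B') :
    s.Graded Adm B' :=
  ⟨fun x => (hs.var x).trans h, fun a i j => (hs.arr a i j).trans h,
    fun a i j => hA.mono h (hs.mem a i j)⟩

/-- A program without multiplications that runs for `k` steps has cost linear in `k` times the
binary length of the numbers that it can reach. -/
theorem Steps.exec [Field K] [LinearOrder K] {size : K → ℕ} {L : ℕ} {Adm : ℕ → K → Prop} (hA : SizeGrading size L Adm)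
    {p : Program} {s t : Store K} {k : ℕ} (h : Steps p s t k) (hp : p.linear = true) {κ : ℕ}
    (hκ : p.rank ≤ κ) (B : ℕ) (hs : s.Graded Adm B) :
    t.Graded Adm (B + κ * k) ∧
      ∃ k', Exec size p s t k' ∧ k' ≤ k * (1 + (L + 3 * (B + κ * k))) := by
  induction h generalizing B with
  | skip s => exact ⟨hs.mono hA (by omega), 1, .skip s, by omega⟩
  | setVar x e s =>
    have h1 := (NExp.size_eval_le hs e hp).trans
      (show B + e.rank ≤ B + κ * 1 by simp only [Program.rank] at hκ; omega)
    have hs' := hs.mono hA (show B ≤ B + κ * 1 by omega)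
    refine ⟨⟨fun y => ?_, hs'.arr, hs'.mem⟩, _, .setVar x e s, by omega⟩
    simp only [Store.setVar, Function.update_apply]
    split_ifs
    exacts [h1, hs'.var y]
  | setArr a i j e s =>
    have h1 := (NExp.size_eval_le hs e hp).trans
      (show B + e.rank ≤ B + κ * 1 by simp only [Program.rank] at hκ; omega)
    have hs' := hs.mono hA (show B ≤ B + κ * 1 by omega)
    refine ⟨⟨hs'.var, fun a' i' j' => ?_, hs'.mem⟩, _, .setArr a i j e s, by omega⟩
    simp only [Store.setArr]
    split_ifs
    exacts [h1, hs'.arr _ _ _]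
  | setMem a i j e s =>
    have h1 := hA.mono (show B + e.rank ≤ B + κ * 1 by simp only [Program.rank] at hκ; omega)
      (FExp.graded_eval hA hs e hp)
    have hs' := hs.mono hA (show B ≤ B + κ * 1 by omega)
    refine ⟨⟨hs'.var, hs'.arr, fun a' i' j' => ?_⟩, _, .setMem a i j e s, ?_⟩
    · simp only [Store.setMem]
      split_ifs
      exacts [h1, hs'.mem _ _ _]
    · have := hA.size_le h1
      omega
  | @seq p q s t u k l _ _ ih1 ih2 =>
    simp only [Program.linear, Bool.and_eq_true] at hp
    simp only [Program.rank] at hκ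
    obtain ⟨g1, k1, e1, c1⟩ := ih1 hp.1 (by omega) B hs
    obtain ⟨g2, k2, e2, c2⟩ := ih2 hp.2 (by omega) _ g1
    refine ⟨g2.mono hA (by rw [mul_add]; omega), _, .seq e1 e2, ?_⟩
    have h1 : k * (1 + (L + 3 * (B + κ * k))) ≤ k * (1 + (L + 3 * (B + κ * (k + l)))) := by
      gcongr; omega
    have h2 : l * (1 + (L + 3 * (B + κ * k + κ * l))) = l * (1 + (L + 3 * (B + κ * (k + l)))) := by
      ring
    rw [add_mul]; omega
  | @cond_true b p q s t k hb _ ih =>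
    simp only [Program.linear, Bool.and_eq_true] at hp
    simp only [Program.rank] at hκ
    obtain ⟨g1, k1, e1, c1⟩ := ih hp.1 (by omega) B hs
    refine ⟨g1.mono hA (by rw [mul_add]; omega), _, .cond_true hb e1, ?_⟩
    have h1 : k * (1 + (L + 3 * (B + κ * k))) ≤ k * (1 + (L + 3 * (B + κ * (1 + k)))) := by
      gcongr; omega
    rw [add_mul]; omega
  | @cond_false b p q s t k hb _ ih =>
    simp only [Program.linear, Bool.and_eq_true] at hp
    simp only [Program.rank] at hκ
    obtain ⟨g1, k1, e1, c1⟩ := ih hp.2 (by omega) B hs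
    refine ⟨g1.mono hA (by rw [mul_add]; omega), _, .cond_false hb e1, ?_⟩
    have h1 : k * (1 + (L + 3 * (B + κ * k))) ≤ k * (1 + (L + 3 * (B + κ * (1 + k)))) := by
      gcongr; omega
    rw [add_mul]; omega
  | @loop_true b p s t u k l hb _ _ ih1 ih2 =>
    obtain ⟨g1, k1, e1, c1⟩ := ih1 hp hκ B hs
    obtain ⟨g2, k2, e2, c2⟩ := ih2 hp hκ _ g1
    refine ⟨g2.mono hA (by rw [mul_add, mul_add]; omega), _, .loop_true hb e1 e2, ?_⟩
    have h1 : k * (1 + (L + 3 * (B + κ * k))) ≤ k * (1 + (L + 3 * (B + κ * (1 + k + l)))) := by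
      gcongr; omega
    have h2 : l * (1 + (L + 3 * (B + κ * k + κ * l))) ≤
        l * (1 + (L + 3 * (B + κ * (1 + k + l)))) := by
      have : B + κ * k + κ * l ≤ B + κ * (1 + k + l) := by rw [mul_add, mul_add]; omega
      gcongr
    rw [add_mul, add_mul]; omega
  | loop_false hb => exact ⟨hs.mono hA (by omega), 1, .loop_false hb, by omega⟩

end Cost

/-! ### Gradings of the real and the rational numbers -/

theorem sizeGrading_real : SizeGrading (fun _ : ℝ => 0) 0 fun _ _ => True :=
  ⟨fun _ _ => trivial, fun _ _ => trivial, fun _ _ => trivial, fun _ => trivial,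
    fun _ => trivial, fun _ => Nat.zero_le _⟩

/-- With `D` a common denominator of the input, grade `B` allows denominators dividing `D * 2 ^ B`
and absolute values up to `2 ^ B`. One addition, subtraction or halving costs one more factor 2 in
each. A product of two such numbers could need the denominator `D²`, which is why multiplication is
excluded. -/
theorem sizeGrading_rat {D : ℕ} (hD : 0 < D) : SizeGrading bitSize (2 * Nat.size D)
    fun B x => (∃ z : ℤ, x * (D * 2 ^ B) = z) ∧ |x| ≤ 2 ^ B where
  mono := by
    rintro B B' x h ⟨⟨z, hz⟩, hx⟩
    obtain ⟨d, rfl⟩ := Nat.exists_eq_add_of_le h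
    refine ⟨⟨z * 2 ^ d, ?_⟩, hx.trans (pow_le_pow_right₀ (by norm_num) h)⟩
    push_cast
    rw [← hz]; ring
  add := by
    rintro B x y ⟨⟨z, hz⟩, hx⟩ ⟨⟨z', hz'⟩, hy⟩
    refine ⟨⟨2 * (z + z'), ?_⟩, (abs_add_le x y).trans (by rw [pow_succ]; linarith)⟩
    push_cast
    rw [← hz, ← hz']; ring
  sub := by
    rintro B x y ⟨⟨z, hz⟩, hx⟩ ⟨⟨z', hz'⟩, hy⟩
    refine ⟨⟨2 * (z - z'), ?_⟩, (abs_sub x y).trans (by rw [pow_succ]; linarith)⟩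
    push_cast
    rw [← hz, ← hz']; ring
  half := by
    rintro B x ⟨⟨z, hz⟩, hx⟩
    refine ⟨⟨z, by rw [← hz]; ring⟩, ?_⟩
    rw [abs_div, pow_succ, abs_two]
    linarith [abs_nonneg x]
  int := by
    intro c
    refine ⟨⟨c * (D * 2 ^ c.natAbs), by push_cast; ring⟩, ?_⟩
    rw [← Int.cast_abs, Int.abs_eq_natAbs]
    exact_mod_cast Nat.lt_two_pow_self.le
  size_le := by
    rintro B x ⟨⟨z, hz⟩, hx⟩
    have hpos : 0 < D * 2 ^ B := by positivity
    have hden : x.den ≤ D * 2 ^ B := by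
      apply Nat.le_of_dvd hpos
      -- The reduced denominator of `x` divides the denominator of this representation.
      have hx' : x = Rat.divInt z ((D * 2 ^ B : ℕ) : ℤ) := by
        rw [Rat.divInt_eq_div, ← hz]
        have : ((D * 2 ^ B : ℕ) : ℚ) ≠ 0 := by positivity
        push_cast at this ⊢
        field_simp
      have := Rat.den_dvd z ((D * 2 ^ B : ℕ) : ℤ)
      rw [← hx'] at this
      exact_mod_cast this
    have hnum : x.num.natAbs ≤ 2 ^ B * (D * 2 ^ B) := by
      have h1 : ((x.num.natAbs : ℕ) : ℚ) = |x| * x.den := by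
        rw [Nat.cast_natAbs, Int.cast_abs, ← Rat.mul_den_eq_num, abs_mul, Nat.abs_cast]
      have h2 : ((x.num.natAbs : ℕ) : ℚ) ≤ ((2 ^ B * (D * 2 ^ B) : ℕ) : ℚ) := by
        rw [h1]
        have h3 : (x.den : ℚ) ≤ ((D * 2 ^ B : ℕ) : ℚ) := by exact_mod_cast hden
        push_cast at h3 ⊢
        exact mul_le_mul hx h3 (by positivity) (by positivity)
      exact_mod_cast h2
    have hlt := Nat.lt_size_self D
    have s1 : Nat.size x.den ≤ Nat.size D + B := by
      rw [Nat.size_le, pow_add]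
      exact hden.trans_lt (Nat.mul_lt_mul_of_pos_right hlt (by positivity))
    have s2 : Nat.size x.num.natAbs ≤ Nat.size D + B + B := by
      rw [Nat.size_le, pow_add, pow_add]
      refine hnum.trans_lt ?_
      rw [mul_comm (2 ^ B)]
      exact Nat.mul_lt_mul_of_pos_right (Nat.mul_lt_mul_of_pos_right hlt (by positivity))
        (by positivity)
    rw [bitSize]
    omega

theorem size_prod_le {ι : Type*} (S : Finset ι) (f : ι → ℕ) :
    Nat.size (∏ i ∈ S, f i) ≤ 1 + ∑ i ∈ S, Nat.size (f i) := by
  classical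
  have h : ∏ i ∈ S, f i ≤ 2 ^ ∑ i ∈ S, Nat.size (f i) := by
    rw [← Finset.prod_pow_eq_pow_sum]
    exact Finset.prod_le_prod' fun i _ => (Nat.lt_size_self (f i)).le
  rw [Nat.size_le, add_comm, pow_succ]
  have : 0 < 2 ^ ∑ i ∈ S, Nat.size (f i) := by positivity
  omega

/-- The product of the denominators of the weights. -/
def WGraph.denominator {n : ℕ} (G : WGraph n ℚ) : ℕ := ∏ e : Fin n × Fin n, (G.w e.1 e.2).den

theorem WGraph.denominator_pos {n : ℕ} (G : WGraph n ℚ) : 0 < G.denominator :=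
  Finset.prod_pos fun _ _ => Rat.den_pos _

theorem WGraph.bitSize_le_inputLength {n : ℕ} (G : WGraph n ℚ) (u v : Fin n) :
    bitSize (G.w u v) ≤ G.inputLength := by
  have h1 := Finset.single_le_sum (f := fun v => bitSize (G.w u v)) (fun _ _ => Nat.zero_le _)
    (Finset.mem_univ v)
  have h2 := Finset.single_le_sum (f := fun u => ∑ v, bitSize (G.w u v)) (fun _ _ => Nat.zero_le _)
    (Finset.mem_univ u)
  rw [inputLength]
  omega

/-- The product of the denominators suffices as a common denominator, because its length is at most
one more than the sum of their lengths. -/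
theorem WGraph.size_denominator_le {n : ℕ} (G : WGraph n ℚ) :
    Nat.size G.denominator ≤ 1 + G.inputLength := by
  refine (size_prod_le _ _).trans ?_
  rw [← Finset.univ_product_univ, Finset.sum_product, inputLength]
  have : ∑ u, ∑ v, Nat.size (G.w u v).den ≤ ∑ u, ∑ v, bitSize (G.w u v) :=
    Finset.sum_le_sum fun u _ => Finset.sum_le_sum fun v _ => Nat.le_add_left _ _
  change 1 + ∑ u, ∑ v, Nat.size (G.w u v).den ≤ _
  omega

theorem WGraph.input_graded_rat {n : ℕ} (G : WGraph n ℚ) :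
    (G.input).Graded (fun (B : ℕ) (x : ℚ) => (∃ z : ℤ, x * (G.denominator * 2 ^ B) = z) ∧ |x| ≤ 2 ^ B)
      G.inputLength where
  var x := by
    simp only [input]
    split_ifs
    · rw [Nat.size_le]
      exact lt_of_le_of_lt (Nat.le_add_right n _) Nat.lt_two_pow_self
    · simp
  arr a i j := by simp [input]
  mem a i j := by
    simp only [input]
    split_ifs with h
    · set u : Fin n := ⟨i, h.2.1⟩
      set v : Fin n := ⟨j, h.2.2⟩
      have hb := G.bitSize_le_inputLength u v
      constructor
      · obtain ⟨d, hd⟩ : (G.w u v).den ∣ G.denominator :=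
          Finset.dvd_prod_of_mem (fun e : Fin n × Fin n => (G.w e.1 e.2).den)
            (Finset.mem_univ (u, v))
        refine ⟨(G.w u v).num * d * 2 ^ G.inputLength, ?_⟩
        rw [hd]
        push_cast
        rw [← Rat.mul_den_eq_num (G.w u v)]
        ring
      · have h1 : |G.w u v| ≤ ((G.w u v).num.natAbs : ℚ) := by
          have h2 : ((G.w u v).num.natAbs : ℚ) = |G.w u v| * (G.w u v).den := by
            rw [Nat.cast_natAbs, Int.cast_abs, ← Rat.mul_den_eq_num, abs_mul, Nat.abs_cast]
          have h3 : (1 : ℚ) ≤ (G.w u v).den := by exact_mod_cast (G.w u v).den_pos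
          rw [h2]
          exact le_mul_of_one_le_right (abs_nonneg _) h3
        refine h1.trans ?_
        have h2 : (G.w u v).num.natAbs ≤ 2 ^ G.inputLength := by
          refine (Nat.lt_size_self _).le.trans (Nat.pow_le_pow_right (by norm_num) ?_)
          rw [bitSize] at hb
          omega
        exact_mod_cast h2
    · exact ⟨⟨0, by simp⟩, by simp⟩

theorem WGraph.input_graded_real {n : ℕ} (G : WGraph n ℝ) :
    (G.input).Graded (fun _ _ => True) n where
  var x := by
    simp only [input]
    split_ifs
    · rw [Nat.size_le]
      exact Nat.lt_two_pow_self
    · simp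
  arr a i j := by simp [input]
  mem _ _ _ := trivial

/-! ### Reasoning about unit-cost runs -/

/-- A bound on the number of steps when every loop makes at most `n + 2` iterations. -/
def Program.bound (n : ℕ) : Program → ℕ
  | .skip => 1
  | .setVar _ _ => 1
  | .setArr _ _ _ _ => 1
  | .setMem _ _ _ _ => 1
  | .seq p q => p.bound n + q.bound n
  | .cond _ p q => 1 + p.bound n + q.bound n
  | .loop _ p => (n + 2) * (1 + p.bound n) + 1

/-- `Program.bound` as a polynomial. -/
def Program.boundPoly : Program → Polynomial ℕ
  | .skip => 1
  | .setVar _ _ => 1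
  | .setArr _ _ _ _ => 1
  | .setMem _ _ _ _ => 1
  | .seq p q => p.boundPoly + q.boundPoly
  | .cond _ p q => 1 + p.boundPoly + q.boundPoly
  | .loop _ p => (Polynomial.X + 2) * (1 + p.boundPoly) + 1

theorem Program.eval_boundPoly (n : ℕ) (p : Program) : p.boundPoly.eval n = p.bound n := by
  induction p with
  | skip => simp [boundPoly, bound]
  | setVar => simp [boundPoly, bound]
  | setArr => simp [boundPoly, bound]
  | setMem => simp [boundPoly, bound]
  | seq p q hp hq => simp [boundPoly, bound, hp, hq]
  | cond b p q hp hq => simp [boundPoly, bound, hp, hq]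
  | loop b p hp => simp [boundPoly, bound, hp]

theorem Program.bound_mono {n m : ℕ} (h : n ≤ m) (p : Program) : p.bound n ≤ p.bound m := by
  induction p with
  | seq p q hp hq => exact Nat.add_le_add hp hq
  | cond b p q hp hq => simp only [bound]; omega
  | loop b p hp => simp only [bound]; gcongr
  | _ => exact le_rfl

/-- The variables that a program can modify. -/
def Program.writesVar : Program → List ℕ
  | .setVar x _ => [x]
  | .seq p q => p.writesVar ++ q.writesVar
  | .cond _ p q => p.writesVar ++ q.writesVar
  | .loop _ p => p.writesVar
  | _ => []

/-- The arrays of natural numbers that a program can modify. -/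
def Program.writesArr : Program → List ℕ
  | .setArr a _ _ _ => [a]
  | .seq p q => p.writesArr ++ q.writesArr
  | .cond _ p q => p.writesArr ++ q.writesArr
  | .loop _ p => p.writesArr
  | _ => []

/-- The arrays of field elements that a program can modify. -/
def Program.writesMem : Program → List ℕ
  | .setMem a _ _ _ => [a]
  | .seq p q => p.writesMem ++ q.writesMem
  | .cond _ p q => p.writesMem ++ q.writesMem
  | .loop _ p => p.writesMem
  | _ => []

/-- What `p` cannot modify is the same in `s` and in `t`. -/
structure Frame {K : Type} (p : Program) (s t : Store K) : Prop where
  var : ∀ x, x ∉ p.writesVar → t.var x = s.var x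
  arr : ∀ a, a ∉ p.writesArr → t.arr a = s.arr a
  mem : ∀ a, a ∉ p.writesMem → t.mem a = s.mem a

theorem Frame.refl {K : Type} (p : Program) (s : Store K) : Frame p s s :=
  ⟨fun _ _ => rfl, fun _ _ => rfl, fun _ _ => rfl⟩

theorem Frame.trans {K : Type} {p : Program} {s t u : Store K} (h : Frame p s t)
    (h' : Frame p t u) : Frame p s u :=
  ⟨fun x hx => (h'.var x hx).trans (h.var x hx), fun x hx => (h'.arr x hx).trans (h.arr x hx),
    fun x hx => (h'.mem x hx).trans (h.mem x hx)⟩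

theorem Frame.of_subset {K : Type} {p q : Program} {s t : Store K} (h : Frame p s t)
    (h1 : p.writesVar ⊆ q.writesVar) (h2 : p.writesArr ⊆ q.writesArr)
    (h3 : p.writesMem ⊆ q.writesMem) : Frame q s t :=
  ⟨fun x hx => h.var x fun h' => hx (h1 h'), fun x hx => h.arr x fun h' => hx (h2 h'),
    fun x hx => h.mem x fun h' => hx (h3 h')⟩

section Runs

variable {K : Type} [Field K] [LinearOrder K]

/-- Loop invariants need only mention what the body changes; for everything else, membership in the
write lists is decidable. -/
theorem Steps.frame {p : Program} {s t : Store K} {k : ℕ} (h : Steps p s t k) : Frame p s t := by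
  induction h with
  | skip s => exact .refl _ _
  | setVar x e s =>
    refine ⟨fun y hy => ?_, fun _ _ => rfl, fun _ _ => rfl⟩
    simp only [Program.writesVar, List.mem_singleton] at hy
    simp [Store.setVar, hy]
  | setArr a i j e s =>
    refine ⟨fun _ _ => rfl, fun y hy => ?_, fun _ _ => rfl⟩
    simp only [Program.writesArr, List.mem_singleton] at hy
    simp [Store.setArr, hy]
  | setMem a i j e s =>
    refine ⟨fun _ _ => rfl, fun _ _ => rfl, fun y hy => ?_⟩
    simp only [Program.writesMem, List.mem_singleton] at hy
    simp [Store.setMem, hy]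
  | seq _ _ h1 h2 =>
    exact (h1.of_subset (List.subset_append_left _ _) (List.subset_append_left _ _)
      (List.subset_append_left _ _)).trans (h2.of_subset (List.subset_append_right _ _)
      (List.subset_append_right _ _) (List.subset_append_right _ _))
  | cond_true _ _ h =>
    exact h.of_subset (List.subset_append_left _ _) (List.subset_append_left _ _)
      (List.subset_append_left _ _)
  | cond_false _ _ h =>
    exact h.of_subset (List.subset_append_right _ _) (List.subset_append_right _ _)
      (List.subset_append_right _ _)
  | loop_true _ _ _ h1 h2 => exact Frame.trans (p := .loop _ _) (h1.of_subset (fun _ h => h) (fun _ h => h) fun _ h => h) h2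
  | loop_false _ => exact .refl _ _

/-- Started in `s`, the program `p` halts within `p.bound n` steps in a state that satisfies `Q`. -/
def Runs (n : ℕ) (p : Program) (s : Store K) (Q : Store K → Prop) : Prop :=
  ∃ t k, Steps p s t k ∧ k ≤ p.bound n ∧ Q t

variable {n : ℕ} {p q : Program} {s : Store K} {Q Q' : Store K → Prop}

theorem Runs.conseq (h : Runs n p s Q) (hQ : ∀ t, Frame p s t → Q t → Q' t) : Runs n p s Q' := by
  obtain ⟨t, k, hs, hk, ht⟩ := h
  exact ⟨t, k, hs, hk, hQ t hs.frame ht⟩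

theorem Runs.skip (h : Q s) : Runs n .skip s Q := ⟨s, 1, .skip s, le_rfl, h⟩

theorem Runs.setVar {x : ℕ} {e : NExp} (h : Q (s.setVar x (e.eval s))) :
    Runs n (.setVar x e) s Q := ⟨_, 1, .setVar x e s, le_rfl, h⟩

theorem Runs.setArr {a : ℕ} {i j e : NExp} (h : Q (s.setArr a (i.eval s) (j.eval s) (e.eval s))) :
    Runs n (.setArr a i j e) s Q := ⟨_, 1, .setArr a i j e s, le_rfl, h⟩

theorem Runs.setMem {a : ℕ} {i j : NExp} {e : FExp}
    (h : Q (s.setMem a (i.eval s) (j.eval s) (e.eval s))) :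
    Runs n (.setMem a i j e) s Q := ⟨_, 1, .setMem a i j e s, le_rfl, h⟩

theorem Runs.seq (h : Runs n p s fun t => Runs n q t Q) : Runs n (.seq p q) s Q := by
  obtain ⟨t, k, hs, hk, u, l, hs', hl, hu⟩ := h
  exact ⟨u, k + l, .seq hs hs', Nat.add_le_add hk hl, hu⟩

theorem Runs.cond {b : Test} (h1 : b.eval s → Runs n p s Q) (h2 : ¬ b.eval s → Runs n q s Q) :
    Runs n (.cond b p q) s Q := by
  by_cases hb : b.eval s
  · obtain ⟨t, k, hs, hk, ht⟩ := h1 hb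
    exact ⟨t, 1 + k, .cond_true hb hs, by simp only [Program.bound]; omega, ht⟩
  · obtain ⟨t, k, hs, hk, ht⟩ := h2 hb
    exact ⟨t, 1 + k, .cond_false hb hs, by simp only [Program.bound]; omega, ht⟩

/-- Total correctness of a loop with invariant `I` whose first argument decreases. -/
theorem Runs.loop {b : Test} (I : ℕ → Store K → Prop) {k : ℕ} (hk : k ≤ n + 2) (h0 : I k s)
    (step : ∀ k t, Frame (.loop b p) s t → I k t → b.eval t →
      Runs n p t fun t' => ∃ k' < k, I k' t')
    (fin : ∀ k t, Frame (.loop b p) s t → I k t → ¬ b.eval t → Q t) :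
    Runs n (.loop b p) s Q := by
  -- Strong induction on the variant `k`: each pass lowers it by at least one and costs at most `1 +
  -- p.bound n`.
  have key : ∀ k t, Frame (.loop b p) s t → I k t →
      ∃ u l, Steps (.loop b p) t u l ∧ l ≤ k * (1 + p.bound n) + 1 ∧ Q u := by
    intro k
    induction k using Nat.strong_induction_on with
    | _ k ih =>
      intro t hf hI
      by_cases hb : b.eval t
      · obtain ⟨t', l, hs, hl, k', hk', hI'⟩ := step k t hf hI hb
        have hf' : Frame (.loop b p) s t' :=
          hf.trans (hs.frame.of_subset (fun _ h => h) (fun _ h => h) fun _ h => h)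
        obtain ⟨u, l', hs', hl', hu⟩ := ih k' hk' t' hf' hI'
        refine ⟨u, 1 + l + l', .loop_true hb hs hs', ?_, hu⟩
        have : (k' + 1) * (1 + p.bound n) ≤ k * (1 + p.bound n) := Nat.mul_le_mul_right _ hk'
        rw [add_mul, one_mul] at this
        omega
      · exact ⟨t, 1, .loop_false hb, by omega, fin k t hf hI hb⟩
  obtain ⟨u, l, hs, hl, hu⟩ := key k s (.refl _ _) h0
  refine ⟨u, l, hs, hl.trans ?_, hu⟩
  simp only [Program.bound]
  gcongr

/-- `for x = 0, …, n - 1`, where the bound `n` is stored in variable `0`. -/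
def forLoop (x : ℕ) (body : Program) : Program :=
  .seq (.setVar x (.lit 0)) (.loop (.not (.natLE (.var 0) (.var x)))
    (.seq body (.setVar x (.plus (.var x) (.lit 1)))))

theorem Runs.forLoop {x : ℕ} {body : Program} (I : ℕ → Store K → Prop)
    (hn : s.var 0 = n) (hx : x ≠ 0) (hxb : x ∉ body.writesVar) (h0b : 0 ∉ body.writesVar)
    (hI : ∀ i t v, I i t → I i (t.setVar x v)) (init : I 0 s)
    (step : ∀ i < n, ∀ t, Frame (forLoop x body) s t → t.var x = i → t.var 0 = n → I i t →
      Runs n body t (I (i + 1)))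
    (fin : ∀ t, Frame (EPR.forLoop x body) s t → t.var 0 = n → I n t → Q t) :
    Runs n (EPR.forLoop x body) s Q := by
  have hsub : ∀ u, Frame (.loop (.not (.natLE (.var 0) (.var x)))
      (.seq body (.setVar x (.plus (.var x) (.lit 1))))) (s.setVar x 0) u →
      Frame (EPR.forLoop x body) s u := by
    intro u hu
    have h1 : Frame (EPR.forLoop x body) s (s.setVar x 0) := by
      refine ⟨fun y hy => ?_, fun _ _ => rfl, fun _ _ => rfl⟩
      have : y ≠ x := by
        rintro rfl
        simp [EPR.forLoop, Program.writesVar] at hy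
      simp [Store.setVar, this]
    exact h1.trans (hu.of_subset (List.subset_append_right _ _) (List.subset_append_right _ _)
      (List.subset_append_right _ _))
  have hv0 : ∀ u, Frame (EPR.forLoop x body) s u → u.var 0 = n := by
    intro u hu
    rw [hu.var 0 ?_, hn]
    simp [EPR.forLoop, Program.writesVar, h0b, hx.symm]
  refine Runs.seq (Runs.setVar ?_)
  refine Runs.loop (fun k t => t.var x + k = n ∧ I (t.var x) t) (k := n) (by omega) ?_ ?_ ?_
  · refine ⟨by simp [Store.setVar, NExp.eval], ?_⟩
    simpa [Store.setVar, NExp.eval] using hI 0 s 0 init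
  · rintro k t hf ⟨hk, hIt⟩ hb
    have hft := hsub t hf
    have h0 := hv0 t hft
    simp only [Test.eval, NExp.eval, h0, not_le] at hb
    refine Runs.seq ((step _ hb t hft rfl h0 hIt).conseq fun t' hf' hI' => Runs.setVar ?_)
    have hx' : t'.var x = t.var x := hf'.var x hxb
    refine ⟨k - 1, by omega, ?_, ?_⟩
    · simp only [Store.setVar, NExp.eval, Function.update_self, hx']
      omega
    · have := hI _ _ (t'.var x + 1) hI'
      simpa [Store.setVar, NExp.eval, hx'] using this
  · rintro k t hf ⟨hk, hIt⟩ hb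
    have hft := hsub t hf
    have h0 := hv0 t hft
    simp only [Test.eval, NExp.eval, h0, not_not] at hb
    have : t.var x = n := by omega
    rw [this] at hIt
    exact fin t hft h0 hIt

end Runs

/-! ### The combinatorics of the Hungarian method -/

/-- `P` permutes `{0, …, n - 1}`. -/
def PermOn (n : ℕ) (P : ℕ → ℕ) : Prop :=
  (∀ j < n, P j < n) ∧ ∀ i < n, ∀ j < n, P i = P j → i = j

theorem PermOn.surj {n : ℕ} {P : ℕ → ℕ} (h : PermOn n P) {i : ℕ} (hi : i < n) :
    ∃ j < n, P j = i := by
  let f : Fin n → Fin n := fun j => ⟨P j, h.1 j j.2⟩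
  have hf : Function.Injective f := fun a b hab =>
    Fin.ext (h.2 a a.2 b b.2 (congrArg Fin.val hab))
  obtain ⟨j, hj⟩ := Finite.surjective_of_injective hf ⟨i, hi⟩
  exact ⟨j, j.2, congrArg Fin.val hj⟩

theorem PermOn.swap {n : ℕ} {P : ℕ → ℕ} (h : PermOn n P) {a b : ℕ} (ha : a < n) (hb : b < n) :
    PermOn n fun k => if k = b then P a else if k = a then P b else P k := by
  refine ⟨fun j hj => ?_, fun i hi j hj hij => ?_⟩
  · dsimp only
    split_ifs
    exacts [h.1 a ha, h.1 b hb, h.1 j hj]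
  · dsimp only at hij
    have key := h.2
    split_ifs at hij with h1 h2 h3 h4 h5 h6 h7 h8
    · omega
    · have := key a ha b hb hij; omega
    · have := key a ha j hj hij; omega
    · have := key b hb a ha hij; omega
    · omega
    · have := key b hb j hj hij; omega
    · have := key i hi a ha hij; omega
    · have := key i hi b hb hij; omega
    · exact key i hi j hj hij

section Hungarian

variable {K : Type} [Field K]

/-- `U`, `V` are feasible potentials for the weights `W`, and the permutation `P` (from columns to
rows) is tight on the columns that satisfy `T`. -/
structure Potentials [LinearOrder K] (n : ℕ) (W : ℕ → ℕ → K) (T : ℕ → Prop) (P : ℕ → ℕ) (U V : ℕ → K) : Prop where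
  perm : PermOn n P
  feasible : ∀ i < n, ∀ j < n, W i j ≤ U i + V j
  tight : ∀ j < n, T j → W (P j) j = U (P j) + V j

/-- The columns `j` with `1 ≤ O j` form an alternating tree of tight entries, with root `c`,
parents `Y` and depths `O`; there are `z` columns outside the tree. -/
structure AltTree (n : ℕ) (W : ℕ → ℕ → K) (c : ℕ) (P : ℕ → ℕ) (U V : ℕ → K) (O Y : ℕ → ℕ)
    (z : ℕ) : Prop where
  root : 1 ≤ O c
  parent : ∀ j < n, 1 ≤ O j → j ≠ c → Y j < n ∧ 1 ≤ O (Y j) ∧ O (Y j) < O j ∧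
    W (P (Y j)) j = U (P (Y j)) + V j
  card : ((Finset.range n).filter fun j => O j = 0).card = z
  depth : ∀ j < n, O j + z ≤ n

/-- The entry in column `h` of the permutation `P` has to be replaced along the tree path from `h`
to the root `c`; `r` is the row of the root. -/
structure Augmenting (n : ℕ) (W : ℕ → ℕ → K) (c : ℕ) (U V : ℕ → K) (O Y : ℕ → ℕ) (r : ℕ)
    (P : ℕ → ℕ) (h : ℕ) : Prop where
  lt : h < n
  mem : 1 ≤ O h
  row : P h = r
  parent : ∀ j < n, 1 ≤ O j → (if j = c then n + 1 else O j) ≤ (if h = c then n + 1 else O h) →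
    Y j < n ∧ 1 ≤ O (Y j) ∧ (Y j = c → W r j = U r + V j) ∧
    (Y j ≠ c → O (Y j) < (if j = c then n + 1 else O j) ∧ W (P (Y j)) j = U (P (Y j)) + V j)

variable {n : ℕ} {W : ℕ → ℕ → K} {c : ℕ} {P : ℕ → ℕ} {U V U' V' : ℕ → K} {O Y : ℕ → ℕ} {z : ℕ}

/-- Slack decreases only between a tree row and an open column (outside the tree, or the root), and
`δ` is at most each such slack. At a tight tree column the two changes cancel. The root column `c`
keeps its potential because it is still to be made tight. -/
theorem Potentials.update [LinearOrder K] [IsStrictOrderedRing K] (hP : Potentials n W (· < c) P U V) {δ : K} (hδ0 : 0 ≤ δ)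
    (hδ : ∀ i < n, ∀ j < n, 1 ≤ O i → (O j = 0 ∨ j = c) → δ ≤ U (P i) + V j - W (P i) j)
    (hU : ∀ j < n, U' (P j) = U (P j) - if 1 ≤ O j then δ else 0)
    (hV : ∀ j < n, V' j = V j + if 1 ≤ O j ∧ j ≠ c then δ else 0) :
    Potentials n W (· < c) P U' V' := by
  refine ⟨hP.perm, fun i hi j hj => ?_, fun j hj hjc => ?_⟩
  · obtain ⟨k, hk, rfl⟩ := hP.perm.surj hi
    have hf := hP.feasible (P k) hi j hj
    rw [hU k hk, hV j hj]
    by_cases h1 : 1 ≤ O k <;> by_cases h2 : 1 ≤ O j ∧ j ≠ c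
    · simp only [h1, h2, and_self, if_true, ne_eq, not_false_eq_true]; linarith
    · simp only [if_pos h1, if_neg h2]
      have := hδ k hk j hj h1 (by
        by_contra hcon
        push Not at hcon
        exact h2 ⟨Nat.one_le_iff_ne_zero.mpr hcon.1, hcon.2⟩)
      linarith
    · simp only [if_neg h1, if_pos h2]; linarith
    · simp only [if_neg h1, if_neg h2]; linarith
  · have ht := hP.tight j hj hjc
    have hne : j ≠ c := hjc.ne
    rw [hU j hj, hV j hj, ht]
    by_cases h1 : 1 ≤ O j
    · simp only [if_pos h1, if_pos (And.intro h1 hne)]; ring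
    · have h2 : ¬ (1 ≤ O j ∧ j ≠ c) := fun h => h1 h.1
      simp only [if_neg h1, if_neg h2]; ring

/-- A tree edge joins a tree row to a tree column other than the root, where the two changes cancel.
-/
theorem AltTree.update (hT : AltTree n W c P U V O Y z) {δ : K}
    (hU : ∀ j < n, U' (P j) = U (P j) - if 1 ≤ O j then δ else 0)
    (hV : ∀ j < n, V' j = V j + if 1 ≤ O j ∧ j ≠ c then δ else 0) :
    AltTree n W c P U' V' O Y z := by
  refine ⟨hT.root, fun j hj h1 hne => ?_, hT.card, hT.depth⟩
  obtain ⟨a, b, d, e⟩ := hT.parent j hj h1 hne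
  refine ⟨a, b, d, ?_⟩
  rw [e, hU _ a, hV _ hj, if_pos b, if_pos ⟨h1, hne⟩]
  ring

/-- The new leaf is one deeper than its parent, but `z` drops by one, so the bound `O j + z ≤ n`
survives. -/
theorem AltTree.grow (hT : AltTree n W c P U V O Y z) {bi bj : ℕ} (hbi : bi < n) (hbj : bj < n)
    (hi : 1 ≤ O bi) (hj : O bj = 0) (ht : W (P bi) bj = U (P bi) + V bj) :
    1 ≤ z ∧ AltTree n W c P U V (fun j => if j = bj then O bi + 1 else O j)
      (fun j => if j = bj then bi else Y j) (z - 1) := by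
  have hmem : bj ∈ (Finset.range n).filter fun j => O j = 0 := by simp [hbj, hj]
  have hz : 1 ≤ z := by
    rw [← hT.card]; exact Finset.card_pos.mpr ⟨bj, hmem⟩
  have hbne : bi ≠ bj := by rintro rfl; omega
  refine ⟨hz, ?_, fun j hjn h1 hne => ?_, ?_, fun j hjn => ?_⟩
  · split_ifs
    · omega
    · exact hT.root
  · by_cases hjb : j = bj
    · subst hjb
      simp only [if_true, if_neg hbne]
      exact ⟨hbi, hi, by omega, ht⟩
    · simp only [if_neg hjb] at h1 ⊢
      obtain ⟨a, b, d, e⟩ := hT.parent j hjn h1 hne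
      have hY : Y j ≠ bj := by intro h; rw [h] at b; omega
      rw [if_neg hY]
      exact ⟨a, b, d, e⟩
  · have : ((Finset.range n).filter fun j => (if j = bj then O bi + 1 else O j) = 0) =
        ((Finset.range n).filter fun j => O j = 0).erase bj := by
      ext j
      by_cases hjb : j = bj
      · simp [hjb]
      · simp [hjb]
    rw [this, Finset.card_erase_of_mem hmem, hT.card]
  · have h1 := hT.depth j hjn
    have h2 := hT.depth bi hbi
    split_ifs <;> omega

/-- A tight entry from a tree row to the root column closes the path between `bi` and `c` into a
cycle. As start of the walk, `c` gets rank `n + 1`, above every depth, so ranks decrease strictly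
until the walk returns to `c`. -/
theorem AltTree.augmenting (hT : AltTree n W c P U V O Y z) (hc : c < n) {bi : ℕ} (hbi : bi < n)
    (hi : 1 ≤ O bi) (ht : W (P bi) c = U (P bi) + V c) :
    Augmenting n W c U V O (fun j => if j = c then bi else Y j) (P c) P c := by
  refine ⟨hc, hT.root, rfl, fun j hj h1 _ => ?_⟩
  by_cases hjc : j = c
  · subst hjc
    simp only [if_true]
    refine ⟨hbi, hi, ?_, fun hne => ⟨?_, ht⟩⟩
    · rintro rfl; exact ht
    · have := hT.depth bi hbi
      omega
  · simp only [if_neg hjc]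
    obtain ⟨a, b, d, e⟩ := hT.parent j hj h1 hjc
    exact ⟨a, b, fun h => by rw [← h]; exact e, fun _ => ⟨d, e⟩⟩

/-- Exchanging the rows of `h` and `Y h` makes column `h` tight and moves the hole, together with
the row `r`, to `Y h`. The parents met later have smaller depth, so they differ from both exchanged
columns and their tight entries are untouched. -/
theorem Augmenting.step [LinearOrder K] {r h : ℕ} (hA : Augmenting n W c U V O Y r P h)
    (hP : Potentials n W (fun j => j ≤ c ∧ j ≠ h) P U V) (hne : Y h ≠ c) :
    Augmenting n W c U V O Y r (fun k => if k = Y h then P h else if k = h then P (Y h) else P k)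
      (Y h) ∧
    Potentials n W (fun j => j ≤ c ∧ j ≠ Y h)
      (fun k => if k = Y h then P h else if k = h then P (Y h) else P k) U V ∧
    O (Y h) < (if h = c then n + 1 else O h) := by
  obtain ⟨a, b, -, d⟩ := hA.parent h hA.lt hA.mem le_rfl
  obtain ⟨d1, d2⟩ := d hne
  have hYh : h ≠ Y h := by
    intro e
    rw [← e] at hne d1
    rw [if_neg hne] at d1
    omega
  refine ⟨⟨a, b, by simp [hA.row], fun j hj h1 hle => ?_⟩, ⟨hP.perm.swap hA.lt a, hP.feasible,
    fun j hj hjc => ?_⟩, d1⟩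
  · rw [if_neg hne] at hle
    obtain ⟨p1, p2, p3, p4⟩ := hA.parent j hj h1 (hle.trans d1.le)
    refine ⟨p1, p2, p3, fun hjne => ?_⟩
    obtain ⟨p5, p6⟩ := p4 hjne
    have n1 : Y j ≠ Y h := by intro e; rw [e] at p5; omega
    have n2 : Y j ≠ h := by
      intro e
      rw [e] at p5 hjne
      rw [if_neg hjne] at d1
      omega
    simp only [if_neg n1, if_neg n2]
    exact ⟨p5, p6⟩
  · by_cases hjh : j = h
    · subst hjh
      simp only [if_neg hYh, if_true]
      exact d2
    · simp only [if_neg hjc.2, if_neg hjh]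
      exact hP.tight j hj ⟨hjc.1, hjh⟩

/-- When the parent is the root, the row to be placed is the one the root had originally. That row
is `r`, which the hole already carries. -/
theorem Augmenting.finish [LinearOrder K] {r h : ℕ} (hA : Augmenting n W c U V O Y r P h)
    (hP : Potentials n W (fun j => j ≤ c ∧ j ≠ h) P U V) (he : Y h = c) :
    Potentials n W (· < c + 1) P U V := by
  refine ⟨hP.perm, hP.feasible, fun j hj hjc => ?_⟩
  by_cases hjh : j = h
  · subst hjh
    obtain ⟨-, -, d, -⟩ := hA.parent j hj hA.mem le_rfl
    rw [hA.row]
    exact d he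
  · exact hP.tight j hj ⟨Nat.lt_succ_iff.mp hjc, hjh⟩

end Hungarian

/-! ### The program -/

/-- Equality test. -/
def natEq (e f : NExp) : Test := .and (.natLE e f) (.natLE f e)

/-- The row matched to column `j`. -/
def rowOf (j : NExp) : NExp := .arr 1 (.lit 0) j

/-- The depth of column `j` in the tree of the current stage. -/
def depthOf (j : NExp) : NExp := .arr 2 (.var 1) j

/-- The parent of column `j` in the tree of the current stage. -/
def parentOf (j : NExp) : NExp := .arr 3 (.var 1) j

/-- The slack of the row matched to column `i` and column `j`. -/
def slackOf (i j : NExp) : FExp :=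
  .minus (.plus (.mem 3 (.lit 0) (rowOf i)) (.mem 4 (.lit 0) j)) (.mem 2 (rowOf i) j)

/-- Store half the weights, the row sums as row potentials, and the identity permutation. -/
def initProgram : Program :=
  forLoop 2 <| .seq (.setArr 1 (.lit 0) (.var 2) (.var 2)) <|
    .seq (.setMem 3 (.lit 0) (.var 2) (.lit 0)) <| forLoop 3 <|
    .seq (.setMem 2 (.var 2) (.var 3) (.divide (.mem 0 (.var 2) (.var 3)) (.lit 2))) <|
    .setMem 3 (.lit 0) (.var 2)
      (.plus (.mem 3 (.lit 0) (.var 2)) (.mem 2 (.var 2) (.var 3)))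

/-- Find a pair of a tree column and an open column with the smallest slack. -/
def searchProgram : Program :=
  .seq (.setVar 4 (.var 1)) <| .seq (.setVar 5 (.var 1)) <| forLoop 2 <|
    .cond (.natLE (.lit 1) (depthOf (.var 2)))
      (forLoop 3 <|
        .cond (.and (.natLE (.lit 1) (depthOf (.var 3))) (.not (natEq (.var 3) (.var 1)))) .skip <|
        .cond (.fieldLE (slackOf (.var 2) (.var 3)) (slackOf (.var 4) (.var 5)))
          (.seq (.setVar 4 (.var 2)) (.setVar 5 (.var 3))) .skip)
      .skip

/-- Change the potentials by the smallest slack. -/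
def updateProgram : Program :=
  .seq (.setMem 5 (.lit 0) (.lit 0) (slackOf (.var 4) (.var 5))) <| forLoop 3 <|
    .cond (.natLE (.lit 1) (depthOf (.var 3)))
      (.seq (.setMem 3 (.lit 0) (rowOf (.var 3))
          (.minus (.mem 3 (.lit 0) (rowOf (.var 3))) (.mem 5 (.lit 0) (.lit 0))))
        (.cond (natEq (.var 3) (.var 1)) .skip
          (.setMem 4 (.lit 0) (.var 3)
            (.plus (.mem 4 (.lit 0) (.var 3)) (.mem 5 (.lit 0) (.lit 0))))))
      .skip

/-- Add a column to the tree. -/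
def growProgram : Program :=
  .seq searchProgram <| .seq updateProgram <| .seq (.setArr 3 (.var 1) (.var 5) (.var 4)) <|
    .cond (natEq (.var 5) (.var 1)) .skip
      (.setArr 2 (.var 1) (.var 5) (.plus (depthOf (.var 4)) (.lit 1)))

/-- Grow a tree from the current column until it is reached again. -/
def treeProgram : Program :=
  .seq (.setVar 5 (.plus (.var 1) (.lit 1))) <| .seq (.setArr 2 (.var 1) (.var 1) (.lit 1)) <|
    .loop (.not (natEq (.var 5) (.var 1))) growProgram

/-- Permute along a path in the tree. -/
def augmentProgram : Program :=
  .seq (.setVar 6 (.var 1)) <| .loop (.not (natEq (parentOf (.var 6)) (.var 1))) <|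
    .seq (.setVar 7 (rowOf (.var 6))) <|
    .seq (.setArr 1 (.lit 0) (.var 6) (rowOf (parentOf (.var 6)))) <|
    .seq (.setArr 1 (.lit 0) (parentOf (.var 6)) (.var 7)) <| .setVar 6 (parentOf (.var 6))

/-- The Hungarian method. -/
def hungarianProgram : Program :=
  .seq initProgram <| forLoop 1 <| .seq treeProgram augmentProgram

/-- Add half of an edge to the matching value of the current gate and to the bound. -/
def addHalfProgram : Program :=
  .seq (.setMem 0 (.var 8) (.lit 0) (.plus (.mem 0 (.var 8) (.lit 0)) (.divide (.lit 1) (.lit 2))))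
    (.setMem 1 (.lit 0) (.lit 0) (.plus (.mem 1 (.lit 0) (.lit 0)) (.mem 2 (.var 2) (.var 3))))

/-- Output the gate of the edge that is given by variables `2` and `3`. -/
def gateProgram : Program :=
  .seq (.setArr 0 (.var 8) (.lit 0) (.var 2)) <| .seq (.setArr 0 (.var 8) (.lit 1) (.var 3)) <|
  .seq (.setMem 0 (.var 8) (.lit 0) (.lit 0)) <|
  .seq (.setMem 1 (.lit 0) (.lit 0) (.plus (.mem 1 (.lit 0) (.lit 0))
    (.plus (.mem 2 (.var 2) (.var 3)) (.mem 2 (.var 2) (.var 3))))) <|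
  .seq (.cond (natEq (rowOf (.var 3)) (.var 2)) addHalfProgram .skip) <|
  .seq (.cond (natEq (rowOf (.var 2)) (.var 3)) addHalfProgram .skip) <|
  .setVar 8 (.plus (.var 8) (.lit 1))

/-- Output the circuit and the bound. -/
def outputProgram : Program :=
  .seq (.setVar 8 (.lit 0)) <|
  .seq (forLoop 2 <| forLoop 3 <|
    .cond (.and (.not (.natLE (.var 3) (.var 2))) (.not (.fieldLE (.mem 2 (.var 2) (.var 3)) (.lit 0))))
      gateProgram .skip) <|
  .setVar 0 (.var 8)

/-- The matching circuit program. -/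
def matchingProgram : Program := .seq hungarianProgram outputProgram

/-! ### Correctness of the Hungarian method -/

section Correctness

variable {K : Type} [Field K] [LinearOrder K]

theorem eval_natEq (s : Store K) (e f : NExp) : (natEq e f).eval s ↔ e.eval s = f.eval s := by
  simp [natEq, Test.eval, le_antisymm_iff]

/-- As the weights are nonnegative, each entry is at most its row sum, so row sums are feasible row
potentials against zero column potentials. -/
theorem initProgram_runs [IsStrictOrderedRing K] {n : ℕ} {s : Store K} (hn : s.var 0 = n)
    (hw : ∀ i j, 0 ≤ s.mem 0 i j) :
    Runs n initProgram s fun t => ∀ i < n, t.arr 1 0 i = i ∧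
      ∀ j < n, t.mem 2 i j = s.mem 0 i j / 2 ∧ t.mem 2 i j ≤ t.mem 3 0 i := by
  refine Runs.forLoop (fun i t => ∀ k < i, t.arr 1 0 k = k ∧
      ∀ j < n, t.mem 2 k j = s.mem 0 k j / 2 ∧ t.mem 2 k j ≤ t.mem 3 0 k) hn (by decide) (by decide)
    (by decide) (fun _ _ _ h => h) (by intro k hk; omega) ?_ (fun t _ _ h => h)
  intro i hi t hf hx h0 hI
  refine Runs.seq (Runs.setArr (Runs.seq (Runs.setMem ?_)))
  refine Runs.forLoop (fun j t => (∀ k < i, t.arr 1 0 k = k ∧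
      ∀ j < n, t.mem 2 k j = s.mem 0 k j / 2 ∧ t.mem 2 k j ≤ t.mem 3 0 k) ∧ t.arr 1 0 i = i ∧
      0 ≤ t.mem 3 0 i ∧ ∀ j' < j, t.mem 2 i j' = s.mem 0 i j' / 2 ∧ t.mem 2 i j' ≤ t.mem 3 0 i)
    h0 (by decide) (by decide) (by decide) (fun _ _ _ h => h) ?_ ?_ ?_
  · refine ⟨fun k hk => ?_, ?_, ?_, by intro j hj; omega⟩
    · have hki : k ≠ i := hk.ne
      simpa [Store.setArr, Store.setMem, NExp.eval, FExp.eval, hx, hki] using hI k hk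
    · simp [Store.setArr, Store.setMem, NExp.eval, hx]
    · simp [Store.setArr, Store.setMem, NExp.eval, FExp.eval, hx]
  · rintro j hj u hfu hxu hu0 ⟨h1, h2, h3, h4⟩
    have hx2 : u.var 2 = i := (hfu.var 2 (by decide)).trans hx
    have hm0 : u.mem 0 = s.mem 0 := (hfu.mem 0 (by decide)).trans (hf.mem 0 (by decide))
    have hnn : 0 ≤ s.mem 0 i j / 2 := by have := hw i j; positivity
    refine Runs.seq (Runs.setMem (Runs.setMem ?_))
    simp only [Store.setMem, NExp.eval, FExp.eval, hx2, hxu, hm0]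
    refine ⟨fun k hk => ⟨(h1 k hk).1, fun j' hj' => ?_⟩, h2, ?_, fun j' hj' => ?_⟩
    · have hki : k ≠ i := hk.ne
      simpa [hki] using (h1 k hk).2 j' hj'
    · simp
      linarith
    · by_cases hjj : j' = j
      · subst hjj
        simp
        exact h3
      · have h5 := h4 j' (by omega)
        simp [hjj]
        exact ⟨h5.1, by linarith [h5.2]⟩
  · rintro u hfu hu0 ⟨h1, h2, h3, h4⟩ k hk
    by_cases hki : k = i
    · subst hki; exact ⟨h2, h4⟩
    · exact h1 k (by omega)

/-- The value of `slackOf`. -/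
def Store.slack (s : Store K) (i j : ℕ) : K :=
  s.mem 3 0 (s.arr 1 0 i) + s.mem 4 0 j - s.mem 2 (s.arr 1 0 i) j

theorem searchProgram_runs {n : ℕ} {s : Store K} (hn : s.var 0 = n) (hc : s.var 1 < n)
    (hroot : 1 ≤ s.arr 2 (s.var 1) (s.var 1)) :
    Runs n searchProgram s fun t => t.var 4 < n ∧ t.var 5 < n ∧
      1 ≤ s.arr 2 (s.var 1) (t.var 4) ∧
      (s.arr 2 (s.var 1) (t.var 5) = 0 ∨ t.var 5 = s.var 1) ∧
      ∀ i < n, ∀ j < n, 1 ≤ s.arr 2 (s.var 1) i → (s.arr 2 (s.var 1) j = 0 ∨ j = s.var 1) →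
        s.slack (t.var 4) (t.var 5) ≤ s.slack i j := by
  -- The pairs before `(i, j)` in lexicographic order have been scanned. The search starts from `(c,
  -- c)`, which is admissible because the root lies in the tree and also counts as open.
  let I : ℕ → ℕ → Store K → Prop := fun i j t => t.var 4 < n ∧ t.var 5 < n ∧
      1 ≤ s.arr 2 (s.var 1) (t.var 4) ∧
      (s.arr 2 (s.var 1) (t.var 5) = 0 ∨ t.var 5 = s.var 1) ∧
      ∀ i' < n, ∀ j' < n, (i' < i ∨ i' = i ∧ j' < j) → 1 ≤ s.arr 2 (s.var 1) i' →
        (s.arr 2 (s.var 1) j' = 0 ∨ j' = s.var 1) → s.slack (t.var 4) (t.var 5) ≤ s.slack i' j'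
  refine Runs.seq (Runs.setVar (Runs.seq (Runs.setVar ?_)))
  refine Runs.forLoop (fun i t => I i 0 t) hn (by decide) (by decide)
    (by decide) (fun _ _ _ h => h) ?_ ?_ ?_
  · exact ⟨hc, hc, hroot, Or.inr rfl, by intro i' _ j' _ h; omega⟩
  · intro i hi t hf hx h0 hI
    have v1 : t.var 1 = s.var 1 := hf.var 1 (by decide)
    have a2 : t.arr 2 = s.arr 2 := hf.arr 2 (by decide)
    refine Runs.cond (fun hb => ?_) (fun hb => ?_)
    · simp only [Test.eval, NExp.eval, depthOf, hx, v1, a2] at hb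
      refine Runs.forLoop (fun j t => I i j t) h0 (by decide) (by decide)
        (by decide) (fun _ _ _ h => h) hI ?_ ?_
      · intro j hj u hfu hxu hu0 hIu
        have v1 : u.var 1 = s.var 1 := (hfu.var 1 (by decide)).trans v1
        have v2 : u.var 2 = i := (hfu.var 2 (by decide)).trans hx
        have a2 : u.arr 2 = s.arr 2 := (hfu.arr 2 (by decide)).trans a2
        have a1 : u.arr 1 = s.arr 1 := (hfu.arr 1 (by decide)).trans (hf.arr 1 (by decide))
        have m2 : u.mem 2 = s.mem 2 := (hfu.mem 2 (by decide)).trans (hf.mem 2 (by decide))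
        have m3 : u.mem 3 = s.mem 3 := (hfu.mem 3 (by decide)).trans (hf.mem 3 (by decide))
        have m4 : u.mem 4 = s.mem 4 := (hfu.mem 4 (by decide)).trans (hf.mem 4 (by decide))
        obtain ⟨h1, h2, h3, h4, h5⟩ := hIu
        refine Runs.cond (fun hb' => Runs.skip ?_) (fun hb' => ?_)
        · simp only [Test.eval, NExp.eval, depthOf, eval_natEq, hxu, v1, a2] at hb'
          refine ⟨h1, h2, h3, h4, fun i' hi' j' hj' hlt ho hj'' => h5 i' hi' j' hj' ?_ ho hj''⟩
          rcases hlt with hlt | ⟨rfl, hlt⟩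
          · exact Or.inl hlt
          · refine Or.inr ⟨rfl, ?_⟩
            rcases Nat.lt_succ_iff_lt_or_eq.mp hlt with h | rfl
            · exact h
            · omega
        · simp only [Test.eval, NExp.eval, depthOf, eval_natEq, hxu, v1, a2] at hb'
          have hopen : s.arr 2 (s.var 1) j = 0 ∨ j = s.var 1 := by
            by_contra hcon
            push Not at hcon
            exact hb' ⟨by omega, hcon.2⟩
          refine Runs.cond (fun hle => Runs.seq (Runs.setVar (Runs.setVar ?_)))
            (fun hle => Runs.skip ?_)
          all_goals
            simp only [Test.eval, NExp.eval, FExp.eval, slackOf, rowOf, v2, hxu, a1, m2, m3,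
              m4] at hle
          · change s.slack i j ≤ s.slack (u.var 4) (u.var 5) at hle
            have e4 : ((u.setVar 4 ((NExp.var 2).eval u)).setVar 5
                ((NExp.var 3).eval (u.setVar 4 ((NExp.var 2).eval u)))).var 4 = i := by
              simp [Store.setVar, NExp.eval, v2]
            have e5 : ((u.setVar 4 ((NExp.var 2).eval u)).setVar 5
                ((NExp.var 3).eval (u.setVar 4 ((NExp.var 2).eval u)))).var 5 = j := by
              simp [Store.setVar, NExp.eval, hxu]
            simp only [I, e4, e5]
            refine ⟨hi, hj, hb, hopen, fun i' hi' j' hj' hlt ho hj'' => ?_⟩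
            by_cases heq : i' = i ∧ j' = j
            · rw [heq.1, heq.2]
            · exact hle.trans (h5 i' hi' j' hj' (by omega) ho hj'')
          · change ¬ s.slack i j ≤ s.slack (u.var 4) (u.var 5) at hle
            refine ⟨h1, h2, h3, h4, fun i' hi' j' hj' hlt ho hj'' => ?_⟩
            by_cases heq : i' = i ∧ j' = j
            · rw [heq.1, heq.2]; exact (not_le.mp hle).le
            · exact h5 i' hi' j' hj' (by omega) ho hj''
      · rintro u - - ⟨h1, h2, h3, h4, h5⟩
        exact ⟨h1, h2, h3, h4, fun i' hi' j' hj' hlt => h5 i' hi' j' hj' (by omega)⟩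
    · simp only [Test.eval, NExp.eval, depthOf, hx, v1, a2] at hb
      obtain ⟨h1, h2, h3, h4, h5⟩ := hI
      refine Runs.skip ⟨h1, h2, h3, h4, fun i' hi' j' hj' hlt ho => ?_⟩
      refine h5 i' hi' j' hj' ?_ ho
      rcases hlt with hlt | hlt
      · rcases Nat.lt_succ_iff_lt_or_eq.mp hlt with h | rfl
        · exact Or.inl h
        · exact absurd ho hb
      · omega
  · rintro t - - ⟨h1, h2, h3, h4, h5⟩
    exact ⟨h1, h2, h3, h4, fun i' hi' j' hj' => h5 i' hi' j' hj' (Or.inl hi')⟩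

theorem updateProgram_runs {n : ℕ} {s : Store K} (hn : s.var 0 = n)
    (hP : PermOn n (s.arr 1 0)) :
    Runs n updateProgram s fun t =>
      (∀ j < n, t.mem 3 0 (s.arr 1 0 j) = s.mem 3 0 (s.arr 1 0 j) -
        if 1 ≤ s.arr 2 (s.var 1) j then s.slack (s.var 4) (s.var 5) else 0) ∧
      ∀ j < n, t.mem 4 0 j = s.mem 4 0 j +
        if 1 ≤ s.arr 2 (s.var 1) j ∧ j ≠ s.var 1 then s.slack (s.var 4) (s.var 5) else 0 := by
  refine Runs.seq (Runs.setMem ?_)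
  -- The smallest slack is saved first, since the loop changes the potentials that define it.
  set s' := s.setMem 5 ((NExp.lit 0).eval s) ((NExp.lit 0).eval s)
    ((slackOf (.var 4) (.var 5)).eval s) with hs'
  have hδ : s'.mem 5 0 0 = s.slack (s.var 4) (s.var 5) := by
    simp [hs', Store.setMem, NExp.eval, FExp.eval, slackOf, rowOf, Store.slack]
  have hm : ∀ a, a ≠ 5 → s'.mem a = s.mem a := by
    intro a ha
    simp [hs', Store.setMem, ha]
  refine Runs.forLoop (fun x t =>
    (∀ j < n, t.mem 3 0 (s.arr 1 0 j) = s.mem 3 0 (s.arr 1 0 j) -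
        if j < x ∧ 1 ≤ s.arr 2 (s.var 1) j then s.slack (s.var 4) (s.var 5) else 0) ∧
    (∀ j < n, t.mem 4 0 j = s.mem 4 0 j +
        if j < x ∧ 1 ≤ s.arr 2 (s.var 1) j ∧ j ≠ s.var 1 then s.slack (s.var 4) (s.var 5) else 0))
    hn (by decide) (by decide) (by decide) (fun _ _ _ h => h) ?_ ?_ ?_
  · simp [hm]
  · rintro x hx t hf hxt h0 ⟨h1, h2⟩
    have a1 : t.arr 1 = s.arr 1 := hf.arr 1 (by decide)
    have a2 : t.arr 2 = s.arr 2 := hf.arr 2 (by decide)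
    have v1 : t.var 1 = s.var 1 := hf.var 1 (by decide)
    have m5 : t.mem 5 0 0 = s.slack (s.var 4) (s.var 5) := by
      rw [hf.mem 5 (by decide), hδ]
    -- Distinct columns have distinct rows, so each row potential is changed at most once.
    have hinj : ∀ j < n, (s.arr 1 0 j = s.arr 1 0 x ↔ j = x) := fun j hj =>
      ⟨fun h => hP.2 j hj x hx h, fun h => by rw [h]⟩
    have hlt : ∀ j, j ≠ x → (j < x + 1 ↔ j < x) := fun j hj => by omega
    refine Runs.cond (fun hb => Runs.seq (Runs.setMem ?_)) (fun hb => Runs.skip ?_)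
    all_goals simp only [Test.eval, NExp.eval, depthOf, hxt, v1, a2] at hb
    · have g1 : ∀ j < n, (t.setMem 3 ((NExp.lit 0).eval t) ((rowOf (.var 3)).eval t)
          ((FExp.minus (.mem 3 (.lit 0) (rowOf (.var 3))) (.mem 5 (.lit 0) (.lit 0))).eval t)).mem 3 0
            (s.arr 1 0 j) = s.mem 3 0 (s.arr 1 0 j) -
          if j < x + 1 ∧ 1 ≤ s.arr 2 (s.var 1) j then s.slack (s.var 4) (s.var 5) else 0 := by
        intro j hj
        simp only [Store.setMem, NExp.eval, FExp.eval, rowOf, hxt, a1, m5, hinj j hj, true_and]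
        by_cases hjx : j = x
        · subst hjx
          simp [hb, h1 j hj]
        · simp [hjx, h1 j hj, hlt j hjx]
      refine Runs.cond (fun hb' => Runs.skip ⟨g1, fun j hj => ?_⟩)
        (fun hb' => Runs.setMem ⟨g1, fun j hj => ?_⟩)
      all_goals
        rw [eval_natEq] at hb'
        simp only [NExp.eval, Store.setMem, hxt, v1] at hb'
        by_cases hjx : j = x
      · subst hjx
        have h3 := h2 j hj
        simp only [lt_irrefl, false_and, if_false, add_zero] at h3
        simpa [Store.setMem, hb'] using h3
      · simp [Store.setMem, h2 j hj, hlt j hjx]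
      · subst hjx
        simp [Store.setMem, h2 j hj, hb', NExp.eval, FExp.eval, hb, hxt, m5]
      · simp [Store.setMem, h2 j hj, hlt j hjx, NExp.eval, hxt, hjx]
    · refine ⟨fun j hj => ?_, fun j hj => ?_⟩
      · by_cases hjx : j = x
        · subst hjx; simp [h1 j hj, hb]
        · simp [h1 j hj, hlt j hjx]
      · by_cases hjx : j = x
        · subst hjx; simp [h2 j hj, hb]
        · simp [h2 j hj, hlt j hjx]
  · rintro t - - ⟨h1, h2⟩
    refine ⟨fun j hj => ?_, fun j hj => ?_⟩
    · simpa [hj] using h1 j hj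
    · simpa [hj] using h2 j hj

end Correctness

section Correctness

variable {K : Type} [Field K] [LinearOrder K]

theorem growProgram_runs [IsStrictOrderedRing K] {n c z : ℕ} {s : Store K} (hn : s.var 0 = n)
    (hc : c < n) (h1 : s.var 1 = c)
    (hP : Potentials n (s.mem 2) (· < c) (s.arr 1 0) (s.mem 3 0) (s.mem 4 0))
    (hT : AltTree n (s.mem 2) c (s.arr 1 0) (s.mem 3 0) (s.mem 4 0) (s.arr 2 c) (s.arr 3 c) z) :
    Runs n growProgram s fun t =>
      Potentials n (s.mem 2) (· < c) (s.arr 1 0) (t.mem 3 0) (t.mem 4 0) ∧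
      (∀ c' ≠ c, t.arr 2 c' = s.arr 2 c') ∧
      (t.var 5 ≠ c ∧ 1 ≤ z ∧
          AltTree n (s.mem 2) c (s.arr 1 0) (t.mem 3 0) (t.mem 4 0) (t.arr 2 c) (t.arr 3 c) (z - 1) ∨
        t.var 5 = c ∧ Augmenting n (s.mem 2) c (t.mem 3 0) (t.mem 4 0) (t.arr 2 c) (t.arr 3 c)
          (s.arr 1 0 c) (s.arr 1 0) c) := by
  refine Runs.seq ((searchProgram_runs hn (by omega) (by rw [h1]; exact hT.root)).conseq ?_)
  rintro t hft ⟨hi, hj, hOi, hOj, hmin⟩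
  have t0 : t.var 0 = n := (hft.var 0 (by decide)).trans hn
  have t1 : t.var 1 = c := (hft.var 1 (by decide)).trans h1
  have ta1 : t.arr 1 = s.arr 1 := hft.arr 1 (by decide)
  have ta2 : t.arr 2 = s.arr 2 := hft.arr 2 (by decide)
  have ta3 : t.arr 3 = s.arr 3 := hft.arr 3 (by decide)
  have tm2 : t.mem 2 = s.mem 2 := hft.mem 2 (by decide)
  have tm3 : t.mem 3 = s.mem 3 := hft.mem 3 (by decide)
  have tm4 : t.mem 4 = s.mem 4 := hft.mem 4 (by decide)
  rw [h1] at hOi hOj hmin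
  refine Runs.seq ((updateProgram_runs t0 (by rw [ta1]; exact hP.perm)).conseq ?_)
  rintro u hfu ⟨hU, hV⟩
  have u1 : u.var 1 = c := (hfu.var 1 (by decide)).trans t1
  have u4 : u.var 4 = t.var 4 := hfu.var 4 (by decide)
  have u5 : u.var 5 = t.var 5 := hfu.var 5 (by decide)
  have ua2 : u.arr 2 = s.arr 2 := (hfu.arr 2 (by decide)).trans ta2
  have ua3 : u.arr 3 = s.arr 3 := (hfu.arr 3 (by decide)).trans ta3
  have hsl : t.slack = s.slack := by
    funext i j; simp only [Store.slack, ta1, tm2, tm3, tm4]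
  rw [t1, hsl, ta1, ta2, tm3] at hU
  rw [t1, hsl, ta2, tm4] at hV
  generalize hbi : t.var 4 = bi at *
  generalize hbj : t.var 5 = bj at *
  have hδ0 : 0 ≤ s.slack bi bj := by
    have := hP.feasible _ (hP.perm.1 bi hi) bj hj
    rw [Store.slack]; linarith
  have hP' := hP.update hδ0 hmin hU hV
  have hT' := hT.update hU hV
  -- Shifting by its own slack makes the minimising entry tight.
  have htight : s.mem 2 (s.arr 1 0 bi) bj = u.mem 3 0 (s.arr 1 0 bi) + u.mem 4 0 bj := by
    have hcl : ¬ (1 ≤ s.arr 2 c bj ∧ bj ≠ c) := by omega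
    rw [hU bi hi, hV bj hj, if_pos hOi, if_neg hcl, Store.slack]
    ring
  refine Runs.seq (Runs.setArr ?_)
  refine Runs.cond (fun hb => Runs.skip ?_) (fun hb => Runs.setArr ?_)
  all_goals
    rw [eval_natEq] at hb
    simp only [NExp.eval, Store.setArr, u1, u5] at hb
  · refine ⟨hP', fun c' _ => ?_, Or.inr ⟨by simp [Store.setArr, u5, hb], ?_⟩⟩
    · funext j; simp [Store.setArr, ua2]
    · rw [hb] at htight
      have := hT'.augmenting hc hi hOi htight
      simpa [Store.setArr, NExp.eval, u1, u4, u5, ua2, ua3, hb] using this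
  · have hO : s.arr 2 c bj = 0 := by omega
    obtain ⟨hz, hT''⟩ := hT'.grow hi hj hOi hO htight
    refine ⟨hP', fun c' hc' => ?_, Or.inl ⟨by simpa [Store.setArr, u5] using hb, hz, ?_⟩⟩
    · funext j
      simp [Store.setArr, NExp.eval, ua2, u1, hc']
    · simpa [Store.setArr, NExp.eval, depthOf, u1, u4, u5, ua2, ua3] using hT''

theorem treeProgram_runs [IsStrictOrderedRing K] {n c : ℕ} {s : Store K} (hn : s.var 0 = n)
    (hc : c < n) (h1 : s.var 1 = c)
    (hP : Potentials n (s.mem 2) (· < c) (s.arr 1 0) (s.mem 3 0) (s.mem 4 0))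
    (h0 : ∀ j, s.arr 2 c j = 0) :
    Runs n treeProgram s fun t =>
      Potentials n (s.mem 2) (· < c) (s.arr 1 0) (t.mem 3 0) (t.mem 4 0) ∧
      (∀ c' ≠ c, t.arr 2 c' = s.arr 2 c') ∧
      Augmenting n (s.mem 2) c (t.mem 3 0) (t.mem 4 0) (t.arr 2 c) (t.arr 3 c)
          (s.arr 1 0 c) (s.arr 1 0) c := by
  refine Runs.seq (Runs.setVar (Runs.seq (Runs.setArr ?_)))
  -- The variant is `z + 1` while `z` columns lie outside the tree, and `0` once the root is reached
  -- again. The initial value `c + 1` of variable `5` only ensures that the loop is entered.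
  refine Runs.loop (fun k t => Potentials n (s.mem 2) (· < c) (s.arr 1 0) (t.mem 3 0) (t.mem 4 0) ∧
      (∀ c' ≠ c, t.arr 2 c' = s.arr 2 c') ∧
      ((t.var 5 ≠ c ∧ ∃ z, k = z + 1 ∧
          AltTree n (s.mem 2) c (s.arr 1 0) (t.mem 3 0) (t.mem 4 0) (t.arr 2 c) (t.arr 3 c) z) ∨
        (t.var 5 = c ∧ k = 0 ∧ Augmenting n (s.mem 2) c (t.mem 3 0) (t.mem 4 0) (t.arr 2 c)
          (t.arr 3 c) (s.arr 1 0 c) (s.arr 1 0) c))) (k := n) (by omega) ?_ ?_ ?_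
  · refine ⟨hP, fun c' hc' => ?_, Or.inl ⟨?_, n - 1, by omega, ?_⟩⟩
    · funext j; simp [Store.setArr, Store.setVar, NExp.eval, h1, hc']
    · simp [Store.setArr, Store.setVar, NExp.eval, h1]
    · have hO : ((s.setVar 5 ((NExp.plus (.var 1) (.lit 1)).eval s)).setArr 2
          ((NExp.var 1).eval (s.setVar 5 ((NExp.plus (.var 1) (.lit 1)).eval s)))
          ((NExp.var 1).eval (s.setVar 5 ((NExp.plus (.var 1) (.lit 1)).eval s)))
          ((NExp.lit 1).eval (s.setVar 5 ((NExp.plus (.var 1) (.lit 1)).eval s)))).arr 2 c =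
          fun j => if j = c then 1 else 0 := by
        funext j; simp [Store.setArr, Store.setVar, NExp.eval, h1, h0]
      rw [hO]
      refine ⟨by simp, fun j _ h1 hne => by simp [hne] at h1, ?_, fun j _ => ?_⟩
      · have : ((Finset.range n).filter fun j => (if j = c then 1 else 0) = 0) =
            (Finset.range n).erase c := by
          ext j
          by_cases h : j = c <;> simp [h]
        rw [this, Finset.card_erase_of_mem (Finset.mem_range.mpr hc), Finset.card_range]
      · split_ifs <;> omega
  · rintro k t hf ⟨hPt, hrow, ht⟩ hb
    have t1 : t.var 1 = c := (hf.var 1 (by decide)).trans h1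
    have t0 : t.var 0 = n := (hf.var 0 (by decide)).trans hn
    have ta1 : t.arr 1 = s.arr 1 := hf.arr 1 (by decide)
    have tm2 : t.mem 2 = s.mem 2 := hf.mem 2 (by decide)
    rw [Test.eval, eval_natEq] at hb
    simp only [NExp.eval, t1] at hb
    obtain ⟨-, z, rfl, hT⟩ | ⟨h5, -⟩ := ht
    swap; · exact absurd h5 hb
    have key := growProgram_runs (z := z) t0 hc t1 (by rw [ta1, tm2]; exact hPt)
      (by rw [ta1, tm2]; exact hT)
    refine key.conseq ?_
    rintro u - ⟨hPu, hrowu, hu⟩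
    rw [ta1, tm2] at hPu hu
    have hrow' : ∀ c' ≠ c, u.arr 2 c' = s.arr 2 c' := fun c' hc' =>
      (hrowu c' hc').trans (hrow c' hc')
    obtain ⟨h5, hz, hTu⟩ | ⟨h5, hA⟩ := hu
    · exact ⟨z, by omega, hPu, hrow', Or.inl ⟨h5, z - 1, by omega, hTu⟩⟩
    · exact ⟨0, by omega, hPu, hrow', Or.inr ⟨h5, rfl, hA⟩⟩
  · rintro k t hf ⟨hPt, hrow, ht⟩ hb
    have t1 : t.var 1 = c := (hf.var 1 (by decide)).trans h1
    rw [Test.eval, eval_natEq, not_not] at hb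
    simp only [NExp.eval, t1] at hb
    obtain ⟨h5, -⟩ | ⟨-, -, hA⟩ := ht
    · exact absurd hb h5
    · exact ⟨hPt, hrow, hA⟩

theorem augmentProgram_runs {n c r : ℕ} {s : Store K} (h1 : s.var 1 = c)
    (hP : Potentials n (s.mem 2) (· < c) (s.arr 1 0) (s.mem 3 0) (s.mem 4 0))
    (hA : Augmenting n (s.mem 2) c (s.mem 3 0) (s.mem 4 0) (s.arr 2 c) (s.arr 3 c) r (s.arr 1 0) c) :
    Runs n augmentProgram s fun t =>
      Potentials n (s.mem 2) (· < c + 1) (t.arr 1 0) (s.mem 3 0) (s.mem 4 0) := by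
  refine Runs.seq (Runs.setVar ?_)
  -- The variant is the rank of the hole: `n + 1` at the start `c`, and its depth in the tree
  -- afterwards.
  refine Runs.loop (fun k t => k = (if t.var 6 = c then n + 1 else s.arr 2 c (t.var 6)) ∧
    Potentials n (s.mem 2) (fun j => j ≤ c ∧ j ≠ t.var 6) (t.arr 1 0) (s.mem 3 0) (s.mem 4 0) ∧
    Augmenting n (s.mem 2) c (s.mem 3 0) (s.mem 4 0) (s.arr 2 c) (s.arr 3 c) r (t.arr 1 0)
      (t.var 6)) (k := n + 1) (by omega) ?_ ?_ ?_
  · have h6 : (s.setVar 6 ((NExp.var 1).eval s)).var 6 = c := by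
      simp [Store.setVar, NExp.eval, h1]
    rw [h6]
    exact ⟨by simp, ⟨hP.perm, hP.feasible, fun j hj hjc => hP.tight j hj
      (lt_of_le_of_ne hjc.1 hjc.2)⟩, hA⟩
  · rintro k t hf ⟨hk, hPt, hAt⟩ hb
    have t1 : t.var 1 = c := (hf.var 1 (by decide)).trans h1
    have ta3 : t.arr 3 = s.arr 3 := hf.arr 3 (by decide)
    rw [Test.eval, eval_natEq] at hb
    simp only [NExp.eval, parentOf, t1, ta3] at hb
    obtain ⟨hA', hP', hlt⟩ := hAt.step hPt hb
    refine Runs.seq (Runs.setVar (Runs.seq (Runs.setArr (Runs.seq (Runs.setArr (Runs.setVar ?_))))))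
    refine ⟨s.arr 2 c (s.arr 3 c (t.var 6)), by omega, ?_⟩
    simp [NExp.eval, parentOf, rowOf, Store.setArr, Store.setVar, t1, ta3, hb]
    exact ⟨hP', hA'⟩
  · rintro k t hf ⟨hk, hPt, hAt⟩ hb
    have t1 : t.var 1 = c := (hf.var 1 (by decide)).trans h1
    have ta3 : t.arr 3 = s.arr 3 := hf.arr 3 (by decide)
    rw [Test.eval, eval_natEq, not_not] at hb
    simp only [NExp.eval, parentOf, t1, ta3] at hb
    exact hAt.finish hPt hb

theorem hungarianProgram_runs [IsStrictOrderedRing K] {n : ℕ} {s : Store K} (hn : s.var 0 = n)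
    (hw : ∀ i j, 0 ≤ s.mem 0 i j) (hv : ∀ j, s.mem 4 0 j = 0) (ho : ∀ c j, s.arr 2 c j = 0) :
    Runs n hungarianProgram s fun t => (∀ i < n, ∀ j < n, t.mem 2 i j = s.mem 0 i j / 2) ∧
      Potentials n (t.mem 2) (fun _ => True) (t.arr 1 0) (t.mem 3 0) (t.mem 4 0) := by
  refine Runs.seq ((initProgram_runs hn hw).conseq fun t hft ht => ?_)
  have t0 : t.var 0 = n := (hft.var 0 (by decide)).trans hn
  have ta2 : t.arr 2 = s.arr 2 := hft.arr 2 (by decide)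
  have tm4 : t.mem 4 = s.mem 4 := hft.mem 4 (by decide)
  -- Stage `c` writes only to row `c` of array `2`, so the depths of all later stages are still zero
  -- and nothing has to be cleared.
  refine Runs.forLoop (fun c u =>
    Potentials n (t.mem 2) (· < c) (u.arr 1 0) (u.mem 3 0) (u.mem 4 0) ∧
    ∀ c' ≥ c, ∀ j, u.arr 2 c' j = 0) t0 (by decide) (by decide) (by decide) (fun _ _ _ h => h)
    ?_ ?_ ?_
  · refine ⟨⟨⟨fun j hj => ?_, fun i hi j hj hij => ?_⟩, fun i hi j hj => ?_, fun j _ h => ?_⟩,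
      fun c' _ j => by rw [ta2, ho]⟩
    · rw [(ht j hj).1]; exact hj
    · rwa [(ht i hi).1, (ht j hj).1] at hij
    · rw [tm4, hv, add_zero]; exact ((ht i hi).2 j hj).2
    · omega
  · rintro c hc u hfu u1 u0 ⟨hP, hrow⟩
    have um2 : u.mem 2 = t.mem 2 := hfu.mem 2 (by decide)
    rw [← um2] at hP ⊢
    refine Runs.seq ((treeProgram_runs u0 hc u1 hP (hrow c le_rfl)).conseq ?_)
    rintro v hfv ⟨hPv, hrowv, hA⟩
    have v1 : v.var 1 = c := (hfv.var 1 (by decide)).trans u1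
    have va1 : v.arr 1 = u.arr 1 := hfv.arr 1 (by decide)
    have vm2 : v.mem 2 = u.mem 2 := hfv.mem 2 (by decide)
    rw [← va1, ← vm2] at hPv hA
    refine (augmentProgram_runs v1 hPv hA).conseq fun x hfx hPx => ?_
    have xa2 : x.arr 2 = v.arr 2 := hfx.arr 2 (by decide)
    have xm3 : x.mem 3 = v.mem 3 := hfx.mem 3 (by decide)
    have xm4 : x.mem 4 = v.mem 4 := hfx.mem 4 (by decide)
    refine ⟨by rw [xm3, xm4, ← vm2]; exact hPx, fun c' hc' j => ?_⟩
    rw [xa2, hrowv c' (by omega)]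
    exact hrow c' (by omega) j
  · rintro u hfu - ⟨hP, -⟩
    have um2 : u.mem 2 = t.mem 2 := hfu.mem 2 (by decide)
    rw [um2]
    exact ⟨fun i hi j hj => ((ht i hi).2 j hj).1, hP.perm, hP.feasible,
      fun j hj _ => hP.tight j hj hj⟩

end Correctness

/-- The matching value of the edge `e` for a permutation `p` of the vertices. -/
def halfMatching {n : ℕ} (K : Type) [Field K] (p : Fin n → Fin n) (e : Fin n × Fin n) : K :=
  (if p e.2 = e.1 then 1 / 2 else 0) + if p e.1 = e.2 then 1 / 2 else 0

/-! ### Correctness of the output -/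

section Output

variable {K : Type} [Field K] [LinearOrder K]

/-- Array `2` holds half the weights, so adding `½` to the matching value adds an entry of this
array to the bound, without any multiplication. -/
theorem addHalfProgram_runs {n : ℕ} {s : Store K} {e f : NExp} :
    Runs n (.cond (natEq e f) addHalfProgram .skip) s fun t =>
      t.mem 0 (s.var 8) 0 = s.mem 0 (s.var 8) 0 + (if e.eval s = f.eval s then 1 / 2 else 0) ∧
      (∀ k ≠ s.var 8, t.mem 0 k = s.mem 0 k) ∧
      t.mem 1 0 0 = s.mem 1 0 0 +
        if e.eval s = f.eval s then s.mem 2 (s.var 2) (s.var 3) else 0 := by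
  refine Runs.cond (fun hb => Runs.seq (Runs.setMem (Runs.setMem ?_))) (fun hb => Runs.skip ?_)
  all_goals rw [eval_natEq] at hb
  · refine ⟨?_, fun k hk => ?_, ?_⟩
    · simp [Store.setMem, NExp.eval, FExp.eval, hb]
    · funext j; simp [Store.setMem, NExp.eval, FExp.eval, hk]
    · simp [Store.setMem, NExp.eval, FExp.eval, hb]
  · simp [hb]

theorem gateProgram_runs {n i j c : ℕ} {s : Store K} (h2 : s.var 2 = i) (h3 : s.var 3 = j)
    (h8 : s.var 8 = c) :
    Runs n gateProgram s fun t => t.var 8 = c + 1 ∧ t.arr 0 c 0 = i ∧ t.arr 0 c 1 = j ∧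
      (∀ k ≠ c, t.arr 0 k = s.arr 0 k) ∧ (∀ k ≠ c, t.mem 0 k = s.mem 0 k) ∧
      t.mem 0 c 0 = (if s.arr 1 0 j = i then 1 / 2 else 0) +
        (if s.arr 1 0 i = j then 1 / 2 else 0) ∧
      t.mem 1 0 0 = s.mem 1 0 0 + (s.mem 2 i j + s.mem 2 i j) +
        (if s.arr 1 0 j = i then s.mem 2 i j else 0) +
        (if s.arr 1 0 i = j then s.mem 2 i j else 0) := by
  refine Runs.seq (Runs.setArr (Runs.seq (Runs.setArr (Runs.seq (Runs.setMem
    (Runs.seq (Runs.setMem ?_)))))))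
  generalize hu : Store.setMem (Store.setMem _ _ _ _ _) _ _ _ _ = u
  have u2 : u.var 2 = i := by rw [← hu]; exact h2
  have u3 : u.var 3 = j := by rw [← hu]; exact h3
  have u8 : u.var 8 = c := by rw [← hu]; exact h8
  have ua0 : u.arr 0 c 0 = i ∧ u.arr 0 c 1 = j ∧ ∀ k ≠ c, u.arr 0 k = s.arr 0 k := by
    subst hu
    refine ⟨?_, ?_, fun k hk => ?_⟩
    · simp [Store.setMem, Store.setArr, NExp.eval, h2, h8]
    · simp [Store.setMem, Store.setArr, NExp.eval, h3, h8]
    · funext l; simp [Store.setMem, Store.setArr, NExp.eval, h8, hk]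
  have ua1 : u.arr 1 = s.arr 1 := by
    subst hu; funext k l; simp [Store.setMem, Store.setArr]
  have um2 : u.mem 2 = s.mem 2 := by
    subst hu; funext k l; simp [Store.setMem, Store.setArr]
  have um0 : u.mem 0 c 0 = 0 ∧ ∀ k ≠ c, u.mem 0 k = s.mem 0 k := by
    subst hu
    refine ⟨?_, fun k hk => ?_⟩
    · simp [Store.setMem, Store.setArr, NExp.eval, FExp.eval, h8]
    · funext l; simp [Store.setMem, Store.setArr, NExp.eval, h8, hk]
  have um1 : u.mem 1 0 0 = s.mem 1 0 0 + (s.mem 2 i j + s.mem 2 i j) := by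
    subst hu
    simp [Store.setMem, Store.setArr, NExp.eval, FExp.eval, h2, h3]
  clear hu
  refine Runs.seq (addHalfProgram_runs.conseq fun v hfv hv => ?_)
  have v2 : v.var 2 = i := (hfv.var 2 (by decide)).trans u2
  have v3 : v.var 3 = j := (hfv.var 3 (by decide)).trans u3
  have v8 : v.var 8 = c := (hfv.var 8 (by decide)).trans u8
  have va0 : v.arr 0 = u.arr 0 := hfv.arr 0 (by decide)
  have va1 : v.arr 1 = s.arr 1 := (hfv.arr 1 (by decide)).trans ua1
  have vm2 : v.mem 2 = s.mem 2 := (hfv.mem 2 (by decide)).trans um2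
  simp only [NExp.eval, rowOf, u2, u3, u8, ua1, um2] at hv
  refine Runs.seq (addHalfProgram_runs.conseq fun x hfx hx => Runs.setVar ?_)
  have x8 : x.var 8 = c := (hfx.var 8 (by decide)).trans v8
  have xa0 : x.arr 0 = u.arr 0 := (hfx.arr 0 (by decide)).trans va0
  simp only [NExp.eval, rowOf, v2, v3, v8, va1, vm2] at hx
  refine ⟨by simp [Store.setVar, NExp.eval, x8], ?_, ?_, fun k hk => ?_, fun k hk => ?_, ?_, ?_⟩
  · change x.arr 0 c 0 = i
    rw [xa0, ua0.1]
  · change x.arr 0 c 1 = j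
    rw [xa0, ua0.2.1]
  · change x.arr 0 k = _
    rw [xa0, ua0.2.2 k hk]
  · change x.mem 0 k = _
    rw [hx.2.1 k hk, hv.2.1 k hk, um0.2 k hk]
  · change x.mem 0 c 0 = _
    rw [hx.1, hv.1, um0.1, zero_add]
  · change x.mem 1 0 0 = _
    rw [hx.2.2, hv.2.2, um1]

/-- The memory `t` lists the edges `l` with matching values `f` and the sum of `g` over `l`. -/
structure Emits {n : ℕ} (f g : Fin n × Fin n → K) (l : List (Fin n × Fin n)) (t : Store K) :
    Prop where
  length : t.var 8 = l.length
  gates : ∀ k (hk : k < l.length), t.arr 0 k 0 = l[k].1 ∧ t.arr 0 k 1 = l[k].2 ∧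
    t.mem 0 k 0 = f l[k]
  sum : t.mem 1 0 0 = (l.map g).sum

theorem outputProgram_runs [IsStrictOrderedRing K] {n : ℕ} (G : WGraph n K) {s : Store K}
    (hn : s.var 0 = n)
    (hb : s.mem 1 0 0 = 0) (hw : ∀ i j : Fin n, s.mem 2 i j = G.w i j / 2) (p : Fin n → Fin n)
    (hp : ∀ j : Fin n, s.arr 1 0 j = p j) :
    Runs n outputProgram s fun t => ∃ l : List (Fin n × Fin n), l.Nodup ∧
      (∀ e, e ∈ l ↔ e.1 < e.2 ∧ 0 < G.w e.1 e.2) ∧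
      t.Outputs (l.map fun e => (e.1, e.2, halfMatching K p e))
        (l.map fun e => G.w e.1 e.2 * (1 + halfMatching K p e)).sum := by
  -- The edges that precede `(i, j)` in lexicographic order have been emitted.
  let I : ℕ → ℕ → Store K → Prop := fun i j t => ∃ l : List (Fin n × Fin n), l.Nodup ∧
    (∀ e : Fin n × Fin n, e ∈ l ↔ (e.1 < e.2 ∧ 0 < G.w e.1 e.2) ∧
      ((e.1 : ℕ) < i ∨ (e.1 : ℕ) = i ∧ (e.2 : ℕ) < j)) ∧
    Emits (halfMatching K p) (fun e => G.w e.1 e.2 * (1 + halfMatching K p e)) l t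
  have hI : ∀ i j t x v, x ≠ 8 → I i j t → I i j (t.setVar x v) := by
    rintro i j t x v hx ⟨l, h1, h2, h3⟩
    refine ⟨l, h1, h2, ?_, h3.gates, h3.sum⟩
    simp [Store.setVar, hx.symm, h3.length]
  refine Runs.seq (Runs.setVar (Runs.seq ?_))
  refine Runs.forLoop (fun i t => I i 0 t) hn (by decide) (by decide)
    (by decide) (fun i t v => hI i 0 t 2 v (by decide)) ?_ ?_ ?_
  · refine ⟨[], List.nodup_nil, fun e => by simp, ?_, fun k hk => ?_, ?_⟩
    · simp [Store.setVar, NExp.eval]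
    · simp at hk
    · simpa [Store.setVar] using hb
  · intro i hi t hf hx h0 hIt
    refine Runs.forLoop (fun j t => I i j t) h0 (by decide) (by decide)
      (by decide) (fun j t v => hI i j t 3 v (by decide)) hIt ?_ ?_
    · rintro j hj u hfu hxu hu0 ⟨l, h1, h2, h3⟩
      have v2 : u.var 2 = i := (hfu.var 2 (by decide)).trans hx
      have a1 : u.arr 1 = s.arr 1 := (hfu.arr 1 (by decide)).trans (hf.arr 1 (by decide))
      have m2 : u.mem 2 = s.mem 2 := (hfu.mem 2 (by decide)).trans (hf.mem 2 (by decide))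
      have hwij := hw ⟨i, hi⟩ ⟨j, hj⟩
      simp only at hwij
      have hcond : (Test.and (.not (.natLE (.var 3) (.var 2)))
          (.not (.fieldLE (.mem 2 (.var 2) (.var 3)) (.lit 0)))).eval u ↔
          (⟨i, hi⟩ : Fin n) < ⟨j, hj⟩ ∧ 0 < G.w ⟨i, hi⟩ ⟨j, hj⟩ := by
        simp only [Test.eval, NExp.eval, FExp.eval, v2, hxu, m2, hwij, not_le, Int.cast_zero,
          Fin.mk_lt_mk]
        rw [div_pos_iff_of_pos_right (by norm_num)]
      refine Runs.cond (fun hc => ?_) (fun hc => Runs.skip ?_)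
      all_goals rw [hcond] at hc
      · refine (gateProgram_runs v2 hxu h3.length).conseq ?_
        rintro v - ⟨g1, g2, g3, g4, g5, g6, g7⟩
        rw [a1, hp ⟨i, hi⟩, hp ⟨j, hj⟩] at g6 g7
        have e1 : ((p ⟨j, hj⟩ : Fin n) : ℕ) = i ↔ p ⟨j, hj⟩ = ⟨i, hi⟩ := by
          rw [Fin.ext_iff]
        have e2 : ((p ⟨i, hi⟩ : Fin n) : ℕ) = j ↔ p ⟨i, hi⟩ = ⟨j, hj⟩ := by
          rw [Fin.ext_iff]
        simp only [e1, e2] at g6 g7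
        refine ⟨l ++ [(⟨i, hi⟩, ⟨j, hj⟩)], ?_, fun e => ?_, ?_, fun k hk => ?_, ?_⟩
        · refine List.Nodup.append h1 (List.nodup_singleton _) ?_
          rw [List.disjoint_singleton, h2]
          simp
        · rw [List.mem_append, List.mem_singleton, h2]
          constructor
          · rintro (⟨h, h'⟩ | rfl)
            · exact ⟨h, by omega⟩
            · exact ⟨hc, by simp⟩
          · rintro ⟨h, h'⟩
            by_cases heq : (e.1 : ℕ) = i ∧ (e.2 : ℕ) = j
            · exact Or.inr (Prod.ext (Fin.ext heq.1) (Fin.ext heq.2))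
            · exact Or.inl ⟨h, by omega⟩
        · simpa using g1
        · rw [List.length_append, List.length_singleton] at hk
          rcases Nat.lt_succ_iff_lt_or_eq.mp hk with hk | rfl
          · rw [List.getElem_append_left hk, g4 k hk.ne, g5 k hk.ne]
            exact h3.gates k hk
          · rw [List.getElem_append_right le_rfl]
            simp only [Nat.sub_self, List.getElem_cons_zero]
            exact ⟨g2, g3, g6⟩
        · rw [List.map_append, List.sum_append, g7, h3.sum, m2, hwij]
          simp only [List.map_singleton, List.sum_singleton, halfMatching]
          split_ifs <;> ring
      · refine ⟨l, h1, fun e => ?_, h3⟩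
        rw [h2]
        refine and_congr_right fun he => ?_
        by_cases heq : (e.1 : ℕ) = i ∧ (e.2 : ℕ) = j
        · have : e = (⟨i, hi⟩, ⟨j, hj⟩) := Prod.ext (Fin.ext heq.1) (Fin.ext heq.2)
          rw [this] at he
          exact absurd he hc
        · omega
    · rintro u - - ⟨l, h1, h2, h3⟩
      refine ⟨l, h1, fun e => ?_, h3⟩
      rw [h2]
      have := e.2.2
      refine and_congr_right fun _ => ?_
      omega
  · rintro t - - ⟨l, h1, h2, h3⟩
    refine Runs.setVar ⟨l, h1, fun e => ?_, ?_, fun k => ?_, ?_⟩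
    · rw [h2]
      have := e.1.2
      simp [this]
    · simp [Store.setVar, NExp.eval, h3.length]
    · have hk : (k : ℕ) < l.length := by simpa using k.2
      have := h3.gates k hk
      simpa [Store.setVar] using this
    · exact h3.sum

/-- The program outputs the circuit of a permutation that is optimal for the assignment problem. -/
theorem matchingProgram_runs [IsStrictOrderedRing K] {n : ℕ} (G : WGraph n K) :
    Runs n matchingProgram G.input fun t => ∃ p : Fin n → Fin n, Function.Injective p ∧
      ∃ a b : Fin n → K, (∀ i j, G.w i j ≤ a i + b j) ∧ (∀ j, G.w (p j) j = a (p j) + b j) ∧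
      ∃ l : List (Fin n × Fin n), l.Nodup ∧ (∀ e, e ∈ l ↔ e.1 < e.2 ∧ 0 < G.w e.1 e.2) ∧
        t.Outputs (l.map fun e => (e.1, e.2, halfMatching K p e))
          (l.map fun e => G.w e.1 e.2 * (1 + halfMatching K p e)).sum := by
  have hw : ∀ i j, 0 ≤ G.input.mem 0 i j := by
    intro i j
    simp only [WGraph.input]
    split_ifs
    · exact G.nonneg _ _
    · exact le_rfl
  have hw' : ∀ i j : Fin n, G.input.mem 0 i j = G.w i j := by
    intro i j
    simp [WGraph.input]
  refine Runs.seq ((hungarianProgram_runs (s := G.input) (n := n) (by simp [WGraph.input]) hw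
    (by simp [WGraph.input]) (by simp [WGraph.input])).conseq ?_)
  rintro t hf ⟨hW, hP⟩
  have hW' : ∀ i j : Fin n, t.mem 2 i j = G.w i j / 2 := fun i j => by
    rw [hW i i.2 j j.2, hw']
  let p : Fin n → Fin n := fun j => ⟨t.arr 1 0 j, hP.perm.1 j j.2⟩
  have hp : Function.Injective p := fun a b hab =>
    Fin.ext (hP.perm.2 a a.2 b b.2 (congrArg Fin.val hab))
  have t0 : t.var 0 = n := by
    rw [hf.var 0 (by decide)]; simp [WGraph.input]
  have t1 : t.mem 1 0 0 = 0 := by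
    rw [hf.mem 1 (by decide)]; simp [WGraph.input]
  refine (outputProgram_runs G t0 t1 hW' p fun j => rfl).conseq ?_
  rintro u - hu
  -- The potentials belong to half the weights and are doubled here.
  refine ⟨p, hp, fun i => 2 * t.mem 3 0 i, fun j => 2 * t.mem 4 0 j, fun i j => ?_, fun j => ?_, hu⟩
  · have := hP.feasible i i.2 j j.2
    rw [hW'] at this
    linarith
  · have := hP.tight j j.2 trivial
    rw [show t.arr 1 0 j = ((p j : Fin n) : ℕ) from rfl, hW'] at this
    linarith

end Output

/-! ### Optimality of the matching -/

/-- The fractional matching of a permutation of the vertices. -/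
def WGraph.permMatching {n : ℕ} (G : WGraph n ℝ) (p : Fin n → Fin n) (u v : Fin n) : ℝ :=
  if 0 < G.w u v then halfMatching ℝ p (u, v) else 0

/-- Weak duality. The averages `(a u + b u) / 2` form a fractional vertex cover, which bounds every
fractional matching, and the matching of `p` attains its total because `p` is tight. Absent edges
have weight 0, so they cost nothing in the assignment and can be dropped from the matching. -/
theorem WGraph.permMatching_isMax {n : ℕ} (G : WGraph n ℝ) {p : Fin n → Fin n}
    (hp : Function.Injective p) {a b : Fin n → ℝ} (hab : ∀ i j, G.w i j ≤ a i + b j)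
    (ht : ∀ j, G.w (p j) j = a (p j) + b j) : G.IsMaxFracMatching (G.permMatching p) := by
  have hbij : Function.Bijective p := Finite.injective_iff_bijective.mp hp
  have hh0 : ∀ u v, 0 ≤ halfMatching ℝ p (u, v) := fun u v => by
    rw [halfMatching]; positivity
  have hm0 : ∀ u v, 0 ≤ G.permMatching p u v := fun u v => by
    rw [permMatching]; split_ifs; exacts [hh0 u v, le_rfl]
  have hle : ∀ u v, G.permMatching p u v ≤ halfMatching ℝ p (u, v) := fun u v => by
    rw [permMatching]; split_ifs; exacts [le_rfl, hh0 u v]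
  -- Each of the two halves of `halfMatching` contributes exactly `1/2` at a vertex.
  have hcol : ∀ u, ∑ v, (if p v = u then (1 / 2 : ℝ) else 0) = 1 / 2 := by
    intro u
    obtain ⟨v, rfl⟩ := hbij.2 u
    simp only [hp.eq_iff]
    simp
  have hsum : ∀ u, ∑ v, G.permMatching p u v ≤ 1 := by
    intro u
    refine (Finset.sum_le_sum fun v _ => hle u v).trans ?_
    simp only [halfMatching, Finset.sum_add_distrib, hcol, Finset.sum_ite_eq, Finset.mem_univ,
      if_true]
    norm_num
  have hsymm : ∀ u v, G.permMatching p u v = G.permMatching p v u := by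
    intro u v
    simp only [permMatching, halfMatching, G.symm v u, add_comm]
  have hfrac : G.IsFracMatching (G.permMatching p) :=
    ⟨hsymm, hm0, fun u v => (Finset.single_le_sum (fun v _ => hm0 u v) (Finset.mem_univ v)).trans
      (hsum u), fun u v h => by rw [permMatching, if_neg h], hsum⟩
  have hweight : ∀ m, G.IsFracMatching m →
      G.matchingWeight m = (∑ u, ∑ v, G.w u v * m u v) / 2 := by
    intro m hm
    refine G.sum_edges_eq (F := fun u v => G.w u v * m u v) (fun u v => ?_) fun u v h => ?_
    · simp only [G.symm v u, hm.symm v u]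
    · simp only [hm.supp u v h, mul_zero]
  have hopt : G.matchingWeight (G.permMatching p) = (∑ u, (a u + b u)) / 2 := by
    rw [hweight _ hfrac]
    congr 1
    have e1 : ∀ u v, G.w u v * G.permMatching p u v =
        (if p v = u then G.w u v / 2 else 0) + if p u = v then G.w u v / 2 else 0 := by
      intro u v
      by_cases h0 : 0 < G.w u v
      · rw [permMatching, if_pos h0, halfMatching]
        split_ifs <;> ring
      · have hz : G.w u v = 0 := le_antisymm (not_lt.mp h0) (G.nonneg u v)
        simp [hz]
    have e2 : ∑ u, ∑ v, (if p v = u then G.w u v / 2 else 0) = ∑ v, G.w (p v) v / 2 := by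
      rw [Finset.sum_comm]
      simp
    have e3 : ∑ u, ∑ v, (if p u = v then G.w u v / 2 else 0) = ∑ v, G.w (p v) v / 2 := by
      simp [G.symm (p _)]
    have e4 : ∑ v, a (p v) = ∑ v, a v := hbij.sum_comp a
    simp only [e1, Finset.sum_add_distrib, e2, e3]
    rw [← Finset.sum_add_distrib, ← e4, ← Finset.sum_add_distrib]
    refine Finset.sum_congr rfl fun v _ => ?_
    rw [ht]; ring
  refine ⟨hfrac, fun m hm => ?_⟩
  rw [hopt, hweight m hm]
  -- The zero diagonal makes the vertex cover nonnegative.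
  have hy : ∀ u, 0 ≤ a u + b u := fun u => by
    have := hab u u
    rwa [G.loopless] at this
  -- The average of the dual constraints for `(u, v)` and `(v, u)`.
  have h1 : ∀ u v, G.w u v * m u v ≤ (a u + b u) / 2 * m u v + (a v + b v) / 2 * m u v := by
    intro u v
    have h2 := hab u v
    have h3 := hab v u
    rw [G.symm v u] at h3
    rw [← add_mul]
    exact mul_le_mul_of_nonneg_right (by linarith) (hm.nonneg u v)
  have h2 : ∑ u, ∑ v, G.w u v * m u v ≤
      ∑ u, ∑ v, (a u + b u) / 2 * m u v + ∑ u, ∑ v, (a v + b v) / 2 * m u v := by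
    simp only [← Finset.sum_add_distrib]
    exact Finset.sum_le_sum fun u _ => Finset.sum_le_sum fun v _ => h1 u v
  rw [Finset.sum_comm (f := fun u v => (a v + b v) / 2 * m u v)] at h2
  simp only [hm.symm _ _] at h2
  have h3 : ∑ u, ∑ v, (a u + b u) / 2 * m u v ≤ ∑ u, (a u + b u) / 2 := by
    refine Finset.sum_le_sum fun u _ => ?_
    rw [← Finset.mul_sum]
    exact mul_le_of_le_one_right (by linarith [hy u]) (hm.sum_le_one u)
  have h4 : ∑ u, ∑ v, (a u + b u) / 2 * m v u = ∑ u, ∑ v, (a u + b u) / 2 * m u v := by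
    simp only [hm.symm _ _]
  rw [← Finset.sum_div] at h3
  linarith

theorem WGraph.isMatchingCircuit {n : ℕ} (G : WGraph n ℝ) {p : Fin n → Fin n}
    (hp : Function.Injective p) {a b : Fin n → ℝ} (hab : ∀ i j, G.w i j ≤ a i + b j)
    (ht : ∀ j, G.w (p j) j = a (p j) + b j) {l : List (Fin n × Fin n)} (hl : l.Nodup)
    (hmem : ∀ e, e ∈ l ↔ e.1 < e.2 ∧ 0 < G.w e.1 e.2) :
    IsMatchingCircuit G (l.map fun e => (e.1, e.2, halfMatching ℝ p e)) ∧
    (l.map fun e => G.w e.1 e.2 * (1 + halfMatching ℝ p e)).sum = G.totalWeight + G.FM := by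
  have hmax := G.permMatching_isMax hp hab ht
  have hedge : ∀ e, e ∈ l ↔ e ∈ G.edges := fun e => by simp [hmem, edges]
  have hval : ∀ e ∈ l, halfMatching ℝ p e = G.permMatching p e.1 e.2 := fun e he => by
    rw [permMatching, if_pos ((hmem e).mp he).2]
  refine ⟨⟨_, hmax, l, hl, hedge, ?_⟩, ?_⟩
  · exact List.map_congr_left fun e he => by rw [hval e he]
  · have hl' : l.toFinset = G.edges := by ext e; simp [hedge]
    rw [hmax.eq_FM, totalWeight, matchingWeight, ← Finset.sum_add_distrib, ← hl',
      List.sum_toFinset _ hl]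
    congr 1
    refine List.map_congr_left fun e he => ?_
    rw [hval e he]; ring

/-! ### Efficiency -/

theorem matchingProgram_real {n : ℕ} (G : WGraph n ℝ) :
    ∃ (t : Store ℝ) (k : ℕ) (C : Circuit n ℝ) (b : ℝ),
      Exec (fun _ => 0) matchingProgram G.input t k ∧
      k ≤ matchingProgram.bound n *
        (1 + (0 + 3 * (n + matchingProgram.rank * matchingProgram.bound n))) ∧
      t.Outputs C b ∧ IsMatchingCircuit G C ∧ b = G.totalWeight + G.FM := by
  obtain ⟨t, k, hs, hk, p, hp, a, b, hab, ht, l, hl, hmem, hout⟩ := matchingProgram_runs G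
  -- `decide` checks that the values stored by the program are computed without multiplication and
  -- with division by `2` only.
  obtain ⟨-, k', he, hk'⟩ := hs.exec sizeGrading_real (by decide) le_rfl n G.input_graded_real
  obtain ⟨hC, hb⟩ := G.isMatchingCircuit hp hab ht hl hmem
  refine ⟨t, k', _, _, he, hk'.trans ?_, hout, hC, hb⟩
  gcongr

theorem matchingProgram_rat {n : ℕ} (G : WGraph n ℚ) :
    ∃ (t : Store ℚ) (k : ℕ) (C : Circuit n ℚ) (b : ℚ),
      Exec bitSize matchingProgram G.input t k ∧
      k ≤ matchingProgram.bound G.inputLength * (1 + (2 * (1 + G.inputLength) +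
        3 * (G.inputLength + matchingProgram.rank * matchingProgram.bound G.inputLength))) ∧
      t.Outputs C b ∧ IsMatchingCircuit G.toReal C.toReal ∧
      (b : ℝ) = G.toReal.totalWeight + G.toReal.FM := by
  obtain ⟨t, k, hs, hk, p, hp, a, b, hab, ht, l, hl, hmem, hout⟩ := matchingProgram_runs G
  obtain ⟨-, k', he, hk'⟩ := hs.exec (sizeGrading_rat G.denominator_pos) (by decide) le_rfl _
    G.input_graded_rat
  have hhalf : ∀ e, ((halfMatching ℚ p e : ℚ) : ℝ) = halfMatching ℝ p e := fun e => by
    simp only [halfMatching]; split_ifs <;> push_cast <;> rfl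
  obtain ⟨hC, hb⟩ := G.toReal.isMatchingCircuit hp (a := fun i => (a i : ℝ))
    (b := fun i => (b i : ℝ)) (fun i j => by simpa [WGraph.toReal] using mod_cast hab i j)
    (fun j => by simpa [WGraph.toReal] using mod_cast ht j) hl
    (fun e => by simpa [WGraph.toReal] using hmem e)
  refine ⟨t, k', _, _, he, hk'.trans ?_, hout, ?_, ?_⟩
  · have h1 : matchingProgram.bound n ≤ matchingProgram.bound G.inputLength :=
      Program.bound_mono (Nat.le_add_right _ _) _
    have h2 := hk.trans h1
    have h3 := G.size_denominator_le
    gcongr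
  · convert hC using 1
    simp only [Circuit.toReal, List.map_map]
    refine List.map_congr_left fun e _ => ?_
    simp [hhalf]
  · rw [← hb, Rat.cast_list_sum, List.map_map]
    congr 1
    refine List.map_congr_left fun e _ => ?_
    simp only [Function.comp_apply]
    push_cast
    rw [hhalf]
    rfl

/-- A polynomial bound on the cost of the matching circuit program. -/
def costPoly : Polynomial ℕ :=
  matchingProgram.boundPoly * (1 + (2 * (1 + Polynomial.X) +
    3 * (Polynomial.X + Polynomial.C matchingProgram.rank * matchingProgram.boundPoly)))

theorem eval_costPoly (N : ℕ) : costPoly.eval N = matchingProgram.bound N *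
    (1 + (2 * (1 + N) + 3 * (N + matchingProgram.rank * matchingProgram.bound N))) := by
  simp [costPoly, Program.eval_boundPoly]

end EPR

end

theorem theorem1 :
    -- the guarantee, for every choice of maximum-weight fractional matching and order of the gates
    (∀ (n : ℕ) (G : EPR.WGraph n ℝ),
      EPR.lambdaMax (EPR.hamiltonian G) ≤ G.totalWeight + G.FM ∧
      ∀ C : EPR.Circuit n ℝ, EPR.IsMatchingCircuit G C →
        C.length = G.edges.card ∧
        star C.state ⬝ᵥ C.state = 1 ∧
        0 ≤ Real.goldenRatio / 2 * (G.totalWeight + G.FM) ∧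
        Real.goldenRatio / 2 * (G.totalWeight + G.FM) ≤
          EPR.energy (EPR.hamiltonian G) C.state ∧
        EPR.energy (EPR.hamiltonian G) C.state ≤ EPR.lambdaMax (EPR.hamiltonian G) ∧
        Real.goldenRatio / 2 * EPR.lambdaMax (EPR.hamiltonian G) ≤
          EPR.energy (EPR.hamiltonian G) C.state) ∧
    -- efficiency: one program computes such a circuit and the upper bound `W + FM`
    ∃ (p : EPR.Program) (T : Polynomial ℕ),
      -- real weights: polynomially many steps in the number of vertices
      (∀ (n : ℕ) (G : EPR.WGraph n ℝ),
        ∃ (t : EPR.Store ℝ) (k : ℕ) (C : EPR.Circuit n ℝ) (b : ℝ),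
          EPR.Exec (fun _ => 0) p G.input t k ∧ k ≤ T.eval n ∧ t.Outputs C b ∧
          EPR.IsMatchingCircuit G C ∧ b = G.totalWeight + G.FM) ∧
      -- rational weights: polynomial bit cost in the length of the input
      (∀ (n : ℕ) (G : EPR.WGraph n ℚ),
        ∃ (t : EPR.Store ℚ) (k : ℕ) (C : EPR.Circuit n ℚ) (b : ℚ),
          EPR.Exec EPR.bitSize p G.input t k ∧ k ≤ T.eval G.inputLength ∧ t.Outputs C b ∧
          EPR.IsMatchingCircuit G.toReal C.toReal ∧
          (b : ℝ) = G.toReal.totalWeight + G.toReal.FM) := by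
  refine ⟨fun n G => ⟨EPR.lambdaMax_hamiltonian_le G, fun C hC => ⟨hC.length_eq, hC.guarantee⟩⟩,
    EPR.matchingProgram, EPR.costPoly, fun n G => ?_, fun n G => ?_⟩
  · obtain ⟨t, k, C, b, he, hk, h⟩ := EPR.matchingProgram_real G
    refine ⟨t, k, C, b, he, hk.trans ?_, h⟩
    rw [EPR.eval_costPoly]
    -- The same polynomial serves both cost models: the denominator term `2 * (1 + n)` is absent for
    -- real weights.
    gcongr
    exact Nat.zero_le _
  · obtain ⟨t, k, C, b, he, hk, h⟩ := EPR.matchingProgram_rat G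
    exact ⟨t, k, C, b, he, by rw [EPR.eval_costPoly]; exact hk, h⟩
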